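/- Let $P\subset\mathbb{R}^3$ be a convex polyhedron, i.e. the convex hull of finitely many points that do not all lie on one line. If $P$ lies in a plane, its surface is understood to be the doubly-covered convex polygon, with two faces, the two sheets of $P$, glued along the boundary of $P$. A \emph{Hamiltonian quasigeodesic} of $P$ is a simple closed curve $Q$ that runs along edges of $P$, passes through every vertex of $P$, and has total surface angle at most $\pi$ on each of its two sides at every vertex. An \emph{edge-unfolding} of $P$ cuts the surface along a set of edges that forms a spanning tree of the vertices of $P$ and develops the cut surface into the plane: every face is mapped isometrically, and any two faces sharing an uncut edge stay attached along it, on opposite sides of it. The edge-unfolding is a \emph{net} if the development is injective on the cut surface (so there is no overlap) and its image is a simple polygon, i.e. the closed region bounded by a simple closed polygonal curve. If a convex polyhedron $P$ has a Hamiltonian quasigeodesic, then $P$ has an edge-unfolding to a net. -/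

import Mathlib

/-- Euclidean 3-space. -/
abbrev E3 := EuclideanSpace ℝ (Fin 3)

/-- The Euclidean plane. -/
abbrev E2 := EuclideanSpace ℝ (Fin 2)

namespace Polyhedron

/-- A convex polyhedron: the convex hull of finitely many points of 3-space, not all collinear.
Flat ones are included; they stand for doubly-covered convex polygons. -/
def IsConvexPolyhedron (P : Set E3) : Prop :=
  (∃ S : Set E3, S.Finite ∧ P = convexHull ℝ S) ∧ 2 ≤ Module.finrank ℝ (vectorSpan ℝ P)

/-- The vertices of `P`. -/
abbrev Vertex (P : Set E3) : Type := ↥(P.extremePoints ℝ)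

/-- The 1-skeleton of `P`: two vertices are adjacent when the segment joining them is an edge
of `P`. -/
def skeleton (P : Set E3) : SimpleGraph (Vertex P) where
  Adj u v := u ≠ v ∧ IsExposed ℝ P (segment ℝ (u : E3) (v : E3))
  symm := ⟨fun u v h => ⟨h.1.symm, by rw [segment_symm]; exact h.2⟩⟩
  loopless := ⟨fun _ h => h.1 rfl⟩

/-- The points of `P` that are extreme in the direction `n`. -/
def support (P : Set E3) (n : E3) : Set E3 :=
  {x ∈ P | ∀ y ∈ P, inner ℝ n y ≤ inner ℝ n x}

/-- A (2-dimensional) face of the surface of `P`, given by its outward unit normal. If `P` spans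
3-space, distinct faces have distinct normals. If `P` is a flat polygon, there are exactly two
faces, with opposite normals and both with carrier `P`: the two sheets of the doubly-covered
polygon. -/
structure Face (P : Set E3) where
  /-- The outward unit normal. -/
  normal : E3
  norm_normal : ‖normal‖ = 1
  finrank_support : Module.finrank ℝ (vectorSpan ℝ (support P normal)) = 2

/-- The set of points of a face. -/
def Face.carrier {P : Set E3} (f : Face P) : Set E3 := support P f.normal

/-- A support set of a polytope is the convex hull of its extreme points, which are among the
spanning points. -/
theorem support_eq_hull {P S : Set E3} (hS : S.Finite) (hP : P = convexHull ℝ S) (n : E3) :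
    (support P n).extremePoints ℝ ⊆ S ∧
      convexHull ℝ ((support P n).extremePoints ℝ) = support P n := by
  have hexp : IsExposed ℝ P (support P n) := fun _ => ⟨innerSL ℝ n, rfl⟩
  have hc : IsCompact P := by rw [hP]; exact hS.isCompact_convexHull ℝ
  have hconv : Convex ℝ P := by rw [hP]; exact convex_convexHull ℝ S
  have hsub : (support P n).extremePoints ℝ ⊆ S := by
    rw [hexp.isExtreme.extremePoints_eq]
    refine Set.inter_subset_right.trans ?_
    rw [hP]
    exact extremePoints_convexHull_subset
  refine ⟨hsub, ?_⟩
  have h := closure_convexHull_extremePoints (hexp.isCompact hc) (hexp.convex hconv)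
  rwa [((hS.subset hsub).isClosed_convexHull ℝ).closure_eq] at h

/-- A convex polyhedron has finitely many faces, so the sum in `sideAngle` is a finite sum. -/
theorem finite_face {P : Set E3} (hP : IsConvexPolyhedron P) : Finite (Face P) := by
  obtain ⟨⟨S, hS, hPS⟩, -⟩ := hP
  have hfin : Set.Finite ((fun f : Face P => f.carrier.extremePoints ℝ) '' Set.univ) :=
    hS.powerset.subset (by
      rintro _ ⟨f, -, rfl⟩
      exact (support_eq_hull hS hPS f.normal).1)
  rw [← Set.finite_univ_iff]
  refine Set.Finite.of_finite_fibers _ hfin ?_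
  rintro _ ⟨f, -, rfl⟩
  set W := vectorSpan ℝ f.carrier with hW
  have hWd : Module.finrank ℝ Wᗮ = 1 := by
    have := W.finrank_add_finrank_orthogonal
    have h2 : Module.finrank ℝ W = 2 := f.finrank_support
    simp at this
    omega
  have hmem : ∀ g : Face P, g.normal ∈ (vectorSpan ℝ g.carrier)ᗮ := by
    intro g
    rw [Submodule.mem_orthogonal']
    intro u hu
    induction hu using Submodule.span_induction with
    | mem x hx =>
      obtain ⟨a, ha, b, hb, rfl⟩ := hx
      have h1 := ha.2 b hb.1
      have h2 := hb.2 a ha.1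
      simp [inner_sub_right]; linarith
    | zero => simp
    | add x y _ _ hx hy => simp [inner_add_right, hx, hy]
    | smul c x _ hx => simp [inner_smul_right, hx]
  have hcar : ∀ g : Face P, convexHull ℝ (g.carrier.extremePoints ℝ) = g.carrier :=
    fun g => (support_eq_hull hS hPS g.normal).2
  refine Set.Finite.of_finite_image (f := Face.normal) ?_ ?_
  · refine Set.Finite.subset (Set.toFinite {f.normal, -f.normal}) ?_
    rintro _ ⟨g, ⟨-, hg⟩, rfl⟩
    have hg' : g.carrier = f.carrier := by
      rw [← hcar g, ← hcar f]; exact congrArg _ hg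
    have hgm := hmem g
    rw [hg'] at hgm
    have hf0 : (⟨f.normal, hmem f⟩ : Wᗮ) ≠ 0 := by
      intro h
      have h0 : f.normal = 0 := congrArg Subtype.val h
      have := f.norm_normal
      simp [h0] at this
    obtain ⟨c, hc⟩ := (finrank_eq_one_iff_of_nonzero' _ hf0).1 hWd ⟨g.normal, hgm⟩
    have hc' : c • f.normal = g.normal := congrArg Subtype.val hc
    have h1 := g.norm_normal
    rw [← hc', norm_smul, f.norm_normal, mul_one, Real.norm_eq_abs] at h1
    rcases (abs_eq zero_le_one).1 h1 with rfl | rfl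
    · left; simpa using hc'.symm
    · right; simpa using hc'.symm
  · intro g _ h _ hgh
    cases g; cases h; simp_all

/-- The interior angle of the face `f` at its vertex `v`, that is, the angle between the two edges
of `f` that meet at `v` (taking `a = b` below only contributes the value `0`). -/
noncomputable def Face.angle {P : Set E3} (f : Face P) (v : Vertex P) : ℝ :=
  sSup {θ : ℝ | ∃ a b : Vertex P, (skeleton P).Adj v a ∧ (skeleton P).Adj v b ∧
    segment ℝ (v : E3) (a : E3) ⊆ f.carrier ∧ segment ℝ (v : E3) (b : E3) ⊆ f.carrier ∧
    θ = EuclideanGeometry.angle (a : E3) (v : E3) (b : E3)}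

/-- `f` and `g` are joined at the point `x` along an edge of `P` that contains `x` and does not
belong to the set of edges `K`. -/
def JoinedAt {P : Set E3} (K : Set (Sym2 (Vertex P))) (x : E3) (f g : Face P) : Prop :=
  ∃ u v : Vertex P, (skeleton P).Adj u v ∧ s(u, v) ∉ K ∧ x ∈ segment ℝ (u : E3) (v : E3) ∧
    segment ℝ (u : E3) (v : E3) ⊆ f.carrier ∧ segment ℝ (u : E3) (v : E3) ⊆ g.carrier

/-- At the point `x`, one can turn from the face `f` to the face `g` around `x` without crossing
an edge in `K`. In other words, after cutting along `K`, the copies of `x` in `f` and in `g` are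
still the same point of the surface. -/
def ConnectedAt {P : Set E3} (K : Set (Sym2 (Vertex P))) (x : E3) : Face P → Face P → Prop :=
  Relation.ReflTransGen (JoinedAt K x)

/-- The total surface angle at the vertex `v` on the side of the edge set `K` that contains the
face `f`. -/
noncomputable def sideAngle {P : Set E3} (K : Set (Sym2 (Vertex P))) (v : Vertex P)
    (f : Face P) : ℝ :=
  ∑ᶠ g ∈ {g : Face P | ConnectedAt K (v : E3) f g}, g.angle v

open Classical in
/-- A Hamiltonian quasigeodesic: a closed walk along edges of `P` that passes through every vertex
exactly once and has surface angle at most `π` on each side at every vertex. (At a point inside an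
edge the angle on each side is `π` anyway.) -/
def IsHamiltonianQuasigeodesic {P : Set E3} {v : Vertex P} (Q : (skeleton P).Walk v v) : Prop :=
  Q.IsHamiltonianCycle ∧
    ∀ (w : Vertex P) (f : Face P), (w : E3) ∈ f.carrier → sideAngle Q.edgeSet w f ≤ Real.pi

/-- The edges of `T` are a legal set of cuts for an edge-unfolding: they are edges of `P` and
form a spanning tree of the vertices of `P`. -/
def IsCutTree {P : Set E3} (T : SimpleGraph (Vertex P)) : Prop :=
  T ≤ skeleton P ∧ T.IsTree

/-- The maps `φ f` lay out the surface of `P`, cut along the edges of `T`, in the plane: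
each face is mapped isometrically, two faces stay attached along every edge that is not cut,
and they lie on opposite sides of it. -/
structure IsUnfolding {P : Set E3} (T : SimpleGraph (Vertex P)) (φ : Face P → E3 → E2) :
    Prop where
  isometry : ∀ f : Face P, ∀ x ∈ f.carrier, ∀ y ∈ f.carrier, dist (φ f x) (φ f y) = dist x y
  attached : ∀ (f g : Face P) (x : E3), JoinedAt T.edgeSet x f g → φ f x = φ g x
  opposite : ∀ f g : Face P, f ≠ g → ∀ u v : Vertex P, (skeleton P).Adj u v → ¬ T.Adj u v →
    segment ℝ (u : E3) (v : E3) ⊆ f.carrier → segment ℝ (u : E3) (v : E3) ⊆ g.carrier →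
    ∀ x ∈ f.carrier, ∀ y ∈ g.carrier,
      (affineSpan ℝ {φ f u, φ f v}).WOppSide (φ f x) (φ g y)

/-- A closed polygonal curve is simple: it has at least three vertices and its half-open edges,
traversed one after the other, never revisit a point. -/
def IsSimplePolygon {n : ℕ} (p : Polygon E2 n) : Prop :=
  3 ≤ n ∧ ∀ i j : Fin n, ∀ s ∈ Set.Ico (0 : ℝ) 1, ∀ t ∈ Set.Ico (0 : ℝ) 1,
    p.edgePath ℝ i s = p.edgePath ℝ j t → i = j ∧ s = t

/-- The closed region bounded by a closed polygonal curve: the points on the curve and the points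
in the bounded components of its complement. -/
def enclosedRegion {n : ℕ} (p : Polygon E2 n) : Set E2 :=
  p.boundary ℝ ∪ {x | x ∉ p.boundary ℝ ∧
    Bornology.IsBounded (connectedComponentIn (p.boundary ℝ)ᶜ x)}

/-- The planar unfolding `φ` is a net: it does not overlap or touch itself (two points of the cut
surface with the same image are the same point of the cut surface), and its image is a simple
polygon. -/
structure IsNet {P : Set E3} (T : SimpleGraph (Vertex P)) (φ : Face P → E3 → E2) : Prop where
  no_overlap : ∀ (f g : Face P), ∀ x ∈ f.carrier, ∀ y ∈ g.carrier, φ f x = φ g y →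
    x = y ∧ ConnectedAt T.edgeSet x f g
  simple_polygon : ∃ (n : ℕ) (p : Polygon E2 n), IsSimplePolygon p ∧
    (⋃ f : Face P, φ f '' f.carrier) = enclosedRegion p

/-- `P` has an edge-unfolding to a net. -/
def HasNet (P : Set E3) : Prop :=
  ∃ T : SimpleGraph (Vertex P), IsCutTree T ∧
    ∃ φ : Face P → E3 → E2, IsUnfolding T φ ∧ IsNet T φ

end Polyhedron

/-! The closed curve `Q` splits the surface into two sides. Since `Q` passes through every vertex, a
side has no vertex in its interior, and its faces hang together like a tree across the edges that
are not on `Q`. It develops to a polygon whose angle at each vertex is the surface angle on that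
side, at most π, so the polygon is convex. Now cut every edge of `Q` except one, `ab`. The cuts form
a Hamiltonian path, hence a spanning tree, and the two convex polygons stay glued along `ab`, on
opposite sides of its line. They can meet only on that line. If they met beyond an end of `ab`, both
would have angle π at that end and the total angle there would be at least 2π, whereas a vertex of a
convex surface has total angle strictly less than 2π. So they meet exactly in `ab`, and their union
is bounded by a simple polygon.

The convex development is grown face by face (`Layout`, `Attachment.layout_insert`,
`exists_closed_layout`). The invariant says that the plane region is convex, that its angle at a
vertex is at most the sum of the angles of the faces already placed on that side of the vertex, and
that it lies on one side of the line of every edge on its rim. Old angle sum and new face angle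
together stay at most π, so a segment from the old region to the new face crosses the shared edge
itself, not its prolongation, and the union is convex again (`Attachment.convex`).

Mod 2 homology replaces the Jordan curve theorem on the surface. Every cycle of edges bounds a chain
of faces (`exists_bd_eq`, by a sweep over the vertices in order of height), which gives
`exists_separating`. Hence a new face is attached to the layout along one edge only, and the two
halves are disjoint (`disjoint_halves`). They cover the surface (`mem_halves`) because a tree
carries no cycle and a chain of faces without boundary is constant.

Two further ingredients are `sum_angle_lt`, the angle bound at a vertex, proved by comparing a
pyramid with its base, and `exists_simplePolygon`, which describes the union of the two convex
polygons; it uses boundary arcs obtained by peeling vertices off a convex polygon. -/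

section

/-! ### Supporting planes, vertices, edges and faces of a polytope -/

namespace Polyhedron

/-- Two non-parallel vectors of 3-space have a common unit normal, and the three together detect
zero. -/
theorem exists_unit_normal (n m : E3) (h : LinearIndependent ℝ ![n, m]) :
    ∃ t : E3, ‖t‖ = 1 ∧ inner ℝ t n = 0 ∧ inner ℝ t m = 0 ∧
      ∀ x : E3, inner ℝ n x = 0 → inner ℝ m x = 0 → inner ℝ t x = 0 → x = 0 := by
  set W := Submodule.span ℝ (Set.range ![n, m]) with hW
  have hWd : Module.finrank ℝ W = 2 := by
    simpa using finrank_span_eq_card h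
  have hWo : Module.finrank ℝ Wᗮ = 1 := by
    have := W.finrank_add_finrank_orthogonal
    simp at this
    omega
  obtain ⟨t0, ht0, hsp⟩ := finrank_eq_one_iff'.1 hWo
  have hn0 : (t0 : E3) ≠ 0 := fun h => ht0 (Subtype.ext h)
  have hnorm : ‖(t0 : E3)‖ ≠ 0 := norm_ne_zero_iff.2 hn0
  have hmem : ∀ x ∈ W, inner ℝ (t0 : E3) x = 0 := fun x hx => by
    have := (Submodule.mem_orthogonal' W (t0 : E3)).1 t0.2 x hx
    simpa using this
  refine ⟨‖(t0 : E3)‖⁻¹ • (t0 : E3), ?_, ?_, ?_, ?_⟩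
  · rw [norm_smul, norm_inv, norm_norm, inv_mul_cancel₀ hnorm]
  · rw [inner_smul_left, hmem n (Submodule.subset_span ⟨0, rfl⟩), mul_zero]
  · rw [inner_smul_left, hmem m (Submodule.subset_span ⟨1, rfl⟩), mul_zero]
  · intro x h1 h2 h3
    have hx : x ∈ Wᗮ := by
      rw [Submodule.mem_orthogonal]
      intro u hu
      induction hu using Submodule.span_induction with
      | mem y hy =>
        obtain ⟨i, rfl⟩ := hy
        fin_cases i
        · simpa using h1
        · simpa using h2
      | zero => simp
      | add a b _ _ ha hb => simp [inner_add_left, ha, hb]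
      | smul c a _ ha => simp [inner_smul_left, ha]
    obtain ⟨c, hc⟩ := hsp ⟨x, hx⟩
    have hc' : c • (t0 : E3) = x := congrArg Subtype.val hc
    rw [← hc', inner_smul_left, inner_smul_right, real_inner_self_eq_norm_sq] at h3
    have hc0 : c = 0 := by
      have : (‖(t0 : E3)‖⁻¹) ≠ 0 := inv_ne_zero hnorm
      simpa [hnorm, hn0] using h3
    rw [← hc', hc0, zero_smul]

variable {P : Set E3}

theorem IsConvexPolyhedron.convex (hP : IsConvexPolyhedron P) : Convex ℝ P := by
  obtain ⟨⟨S, hS, rfl⟩, -⟩ := hP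
  exact convex_convexHull ℝ S

theorem IsConvexPolyhedron.finite_extremePoints (hP : IsConvexPolyhedron P) :
    (P.extremePoints ℝ).Finite := by
  obtain ⟨⟨S, hS, rfl⟩, -⟩ := hP
  exact hS.subset extremePoints_convexHull_subset

theorem IsConvexPolyhedron.finite_vertex (hP : IsConvexPolyhedron P) : Finite (Vertex P) :=
  hP.finite_extremePoints.to_subtype

theorem support_extremePoints (n : E3) :
    (support P n).extremePoints ℝ = support P n ∩ P.extremePoints ℝ := by
  have hexp : IsExposed ℝ P (support P n) := fun _ => ⟨innerSL ℝ n, rfl⟩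
  exact hexp.isExtreme.extremePoints_eq

/-- A support set is the convex hull of the vertices it contains. -/
theorem support_eq_convexHull (hP : IsConvexPolyhedron P) (n : E3) :
    support P n = convexHull ℝ (support P n ∩ P.extremePoints ℝ) := by
  obtain ⟨S, hS, hPS⟩ := hP.1
  rw [← support_extremePoints, (support_eq_hull hS hPS n).2]

theorem eq_convexHull (hP : IsConvexPolyhedron P) : P = convexHull ℝ (P.extremePoints ℝ) := by
  have h := support_eq_convexHull hP 0
  have h0 : support P 0 = P := by ext; simp [support]
  rw [h0, Set.inter_eq_self_of_subset_right extremePoints_subset] at h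
  exact h

theorem inner_le_of_mem_convexHull {E : Type*} [NormedAddCommGroup E] [InnerProductSpace ℝ E]
    {S : Set E} {n : E} {c : ℝ} (h : ∀ s ∈ S, inner ℝ n s ≤ c) :
    ∀ x ∈ convexHull ℝ S, inner ℝ n x ≤ c := by
  have hc : Convex ℝ {x : E | inner ℝ n x ≤ c} :=
    convex_halfSpace_le (f := fun x => inner ℝ n x)
      ⟨fun x y => inner_add_right _ _ _, fun a x => inner_smul_right _ _ _⟩ c
  exact fun x hx => convexHull_min h hc hx

theorem inner_sub_le_of_mem_convexHull {E : Type*} [NormedAddCommGroup E] [InnerProductSpace ℝ E]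
    {S : Set E} {n v : E} (h : ∀ s ∈ S, inner ℝ n (s - v) ≤ 0) :
    ∀ x ∈ convexHull ℝ S, inner ℝ n (x - v) ≤ 0 := by
  intro x hx
  have := inner_le_of_mem_convexHull (n := n) (c := inner ℝ n v)
    (fun s hs => by have := h s hs; rw [inner_sub_right] at this; linarith) x hx
  rw [inner_sub_right]; linarith

theorem inner_sub_le (hP : IsConvexPolyhedron P) {n v : E3}
    (h : ∀ s : Vertex P, inner ℝ n ((s : E3) - v) ≤ 0) : ∀ x ∈ P, inner ℝ n (x - v) ≤ 0 := by
  intro x hx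
  rw [eq_convexHull hP] at hx
  exact inner_sub_le_of_mem_convexHull (fun s hs => h ⟨s, hs⟩) x hx

theorem mem_support_iff {n x y : E3} (hy : y ∈ support P n) :
    x ∈ support P n ↔ x ∈ P ∧ inner ℝ n (x - y) = 0 := by
  constructor
  · intro hx
    refine ⟨hx.1, ?_⟩
    rw [inner_sub_right]
    linarith [hx.2 y hy.1, hy.2 x hx.1]
  · rintro ⟨hx, h⟩
    rw [inner_sub_right] at h
    exact ⟨hx, fun z hz => by linarith [hy.2 z hz]⟩

/-- Two vertices on a common line through a vertex `v`, other than `v`, coincide. -/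
theorem vertex_eq_of_collinear (v a s : Vertex P) (ha : a ≠ v) (hs : s ≠ v)
    {r : ℝ} (h : (s : E3) - v = r • ((a : E3) - v)) : s = a := by
  have hav : (a : E3) - v ≠ 0 := sub_ne_zero.2 fun h => ha (Subtype.ext h)
  have hseq : (s : E3) = (v : E3) + r • ((a : E3) - v) := by rw [← h]; abel
  -- No vertex lies strictly between two others. The cases `r < 0`, `0 < r < 1` and `r > 1` put `v`,
  -- `s` and `a` respectively in that position, and `r = 0` gives `s = v`; only `r = 1` is left.
  have key : ∀ x y z : Vertex P, x ≠ y → ∀ t : ℝ, 0 < t → t < 1 →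
      (z : E3) ≠ (x : E3) + t • ((y : E3) - x) := by
    intro x y z hxy t h0 h1 hz
    have hm : (z : E3) ∈ openSegment ℝ (x : E3) (y : E3) :=
      ⟨1 - t, t, by linarith, h0, by ring, by rw [hz]; module⟩
    have := z.2.2 x.2.1 y.2.1 hm
    have h2 := (mem_extremePoints.1 z.2).2 x x.2.1 y y.2.1 hm
    exact hxy (Subtype.ext (h2.1.trans h2.2.symm))
  rcases lt_trichotomy r 0 with hr | hr | hr
  · exfalso
    have hsa : s ≠ a := by
      rintro rfl
      have : (r - 1) • ((s : E3) - v) = 0 := by rw [sub_smul, ← h]; simp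
      rcases smul_eq_zero.1 this with h' | h'
      · linarith
      · exact hav h'
    have hr1 : (1 - r) ≠ 0 := by linarith
    refine key s a v hsa (-r / (1 - r)) (div_pos (by linarith) (by linarith))
      ((div_lt_one (by linarith)).2 (by linarith)) ?_
    rw [hseq]
    have : (v : E3) + r • ((a : E3) - v) + (-r / (1 - r)) • ((a : E3) - (v + r • ((a : E3) - v)))
        = (v : E3) + (r + (-r / (1 - r)) * (1 - r)) • ((a : E3) - v) := by module
    rw [this, div_mul_cancel₀ _ hr1]
    simp
  · exfalso; apply hs; apply Subtype.ext; rw [hseq, hr]; simp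
  · rcases lt_trichotomy r 1 with h1 | h1 | h1
    · exact absurd hseq (key v a s ha.symm r hr h1)
    · apply Subtype.ext; rw [hseq, h1]; module
    · exfalso
      refine key v s a hs.symm (1 / r) (by positivity) ((div_lt_one hr).2 h1) ?_
      rw [h, smul_smul, one_div, inv_mul_cancel₀ hr.ne']; module

/-- A vertex on an edge is one of its ends. -/
theorem vertex_mem_segment {u v w : Vertex P} (h : (w : E3) ∈ segment ℝ (u : E3) (v : E3)) :
    w = u ∨ w = v := by
  by_contra hcon
  push Not at hcon
  have hm : (w : E3) ∈ openSegment ℝ (u : E3) (v : E3) :=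
    mem_openSegment_of_ne_left_right (fun h => hcon.1 (Subtype.ext h.symm))
      (fun h => hcon.2 (Subtype.ext h.symm)) h
  exact hcon.1 (Subtype.ext ((mem_extremePoints.1 w.2).2 u u.2.1 v v.2.1 hm).1.symm)

/-- A functional that exposes a vertex. -/
theorem exists_exposing (hP : IsConvexPolyhedron P) (v : Vertex P) :
    ∃ η : E3, ∀ y ∈ P, y ≠ v → 0 < inner ℝ η (y - v) := by
  set S := P.extremePoints ℝ \ {(v : E3)} with hS
  have hfin : S.Finite := hP.finite_extremePoints.subset Set.sdiff_subset
  -- Extremality of `v` means that `P \ {v}` is convex, so the hull of the other vertices misses `v`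
  -- and can be strictly separated from it. Every other point of `P` lies on a segment from `v` to
  -- that hull.
  have hv : (v : E3) ∉ convexHull ℝ S := by
    intro hmem
    have hc := (hP.convex.mem_extremePoints_iff_convex_sdiff).1 v.2
    have : convexHull ℝ S ⊆ P \ {(v : E3)} :=
      convexHull_min (Set.sdiff_subset_sdiff_left extremePoints_subset) hc.2
    exact (this hmem).2 rfl
  have hins : insert (v : E3) S = P.extremePoints ℝ := by
    rw [hS, Set.insert_sdiff_singleton, Set.insert_eq_of_mem v.2]
  rcases S.eq_empty_or_nonempty with he | hne
  · refine ⟨0, fun y hy hyv => ?_⟩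
    exfalso
    rw [eq_convexHull hP, ← hins, he] at hy
    simp at hy
    exact hyv hy
  · obtain ⟨f, c, hfc, hcf⟩ := geometric_hahn_banach_point_closed (convex_convexHull ℝ S)
      (hfin.isClosed_convexHull ℝ) hv
    refine ⟨(InnerProductSpace.toDual ℝ E3).symm f, fun y hy hyv => ?_⟩
    rw [InnerProductSpace.toDual_symm_apply]
    rw [eq_convexHull hP, ← hins, convexHull_insert hne] at hy
    obtain ⟨_, rfl, z, hz, hy⟩ := mem_convexJoin.1 hy
    obtain ⟨a, b, ha, hb, hab, rfl⟩ := hy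
    have hb' : b ≠ 0 := by
      rintro rfl
      apply hyv
      have : a = 1 := by linarith
      simp [this]
    have : a • (v : E3) + b • z - v = b • (z - v) := by
      have : a = 1 - b := by linarith
      rw [this]; module
    rw [this, map_smul, map_sub, smul_eq_mul]
    have := hcf z hz
    have hb0 : 0 < b := lt_of_le_of_ne hb hb'.symm
    exact mul_pos hb0 (by linarith)

/-- Criterion for being an edge. -/
theorem adj_of_functional (hP : IsConvexPolyhedron P) {v a : Vertex P} (hva : v ≠ a) (m : E3)
    (hm : ∀ s : Vertex P, inner ℝ m ((s : E3) - v) ≤ 0)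
    (hma : inner ℝ m ((a : E3) - v) = 0)
    (hcol : ∀ s : Vertex P, inner ℝ m ((s : E3) - v) = 0 →
      ∃ r : ℝ, (s : E3) - v = r • ((a : E3) - v)) :
    (skeleton P).Adj v a := by
  refine ⟨hva, ?_⟩
  have hsup : (v : E3) ∈ support P m := ⟨v.2.1, fun y hy => by
    have := inner_sub_le hP hm y hy
    rw [inner_sub_right] at this; linarith⟩
  have : support P m = segment ℝ (v : E3) (a : E3) := by
    rw [support_eq_convexHull hP]
    have : support P m ∩ P.extremePoints ℝ = {(v : E3), (a : E3)} := by
      ext s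
      constructor
      · rintro ⟨hs, hse⟩
        by_cases hsv : (⟨s, hse⟩ : Vertex P) = v
        · left; exact congrArg Subtype.val hsv
        · right
          obtain ⟨r, hr⟩ := hcol ⟨s, hse⟩ ((mem_support_iff hsup).1 hs).2
          exact congrArg Subtype.val (vertex_eq_of_collinear v a ⟨s, hse⟩ hva.symm hsv hr)
      · rintro (rfl | rfl)
        · exact ⟨hsup, v.2⟩
        · exact ⟨(mem_support_iff hsup).2 ⟨a.2.1, hma⟩, a.2⟩
    rw [this, convexHull_pair]
  rw [← this]
  exact fun _ => ⟨innerSL ℝ m, rfl⟩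

/-- A functional that exposes an edge. -/
theorem exists_edge_functional {u v : Vertex P} (h : (skeleton P).Adj u v) :
    ∃ m : E3, (∀ x ∈ P, inner ℝ m (x - u) ≤ 0) ∧
      ∀ x ∈ P, inner ℝ m (x - u) = 0 ↔ x ∈ segment ℝ (u : E3) (v : E3) := by
  obtain ⟨l, hl⟩ := h.2 ⟨_, left_mem_segment ℝ _ _⟩
  refine ⟨(InnerProductSpace.toDual ℝ E3).symm l, ?_⟩
  simp only [InnerProductSpace.toDual_symm_apply, map_sub]
  have hu : (u : E3) ∈ segment ℝ (u : E3) (v : E3) := left_mem_segment ℝ _ _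
  rw [hl] at hu
  refine ⟨fun x hx => by linarith [hu.2 x hx], fun x hx => ?_⟩
  rw [hl]
  constructor
  · intro h0
    exact ⟨hx, fun y hy => by linarith [hu.2 y hy]⟩
  · intro h0
    linarith [hu.2 x hx, h0.2 u hu.1]

/-- A finite family of linear conditions, made lexicographic, is one linear condition. -/
theorem exists_lex_functional (hP : IsConvexPolyhedron P) (v n k : E3)
    (hn : ∀ s : Vertex P, inner ℝ n ((s : E3) - v) ≤ 0)
    (hk : ∀ s : Vertex P, inner ℝ n ((s : E3) - v) = 0 → inner ℝ k ((s : E3) - v) ≤ 0) :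
    ∃ N : ℝ, ∀ s : Vertex P, inner ℝ (N • n + k) ((s : E3) - v) ≤ 0 ∧
      (inner ℝ (N • n + k) ((s : E3) - v) = 0 →
        inner ℝ n ((s : E3) - v) = 0 ∧ inner ℝ k ((s : E3) - v) = 0) := by
  have := hP.finite_vertex
  -- `N` bounds finitely many quotients, so `N • n` already outweighs `k` wherever `n` is negative;
  -- one more copy of `n` makes the sum strictly negative there. Quotients with denominator zero
  -- play no role.
  obtain ⟨N, hN⟩ := (Set.finite_range fun s : Vertex P =>
    inner ℝ k ((s : E3) - v) / (-inner ℝ n ((s : E3) - v))).bddAbove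
  refine ⟨N + 1, fun s => ?_⟩
  rw [inner_add_left, inner_smul_left]
  simp only [conj_trivial]
  rcases (hn s).lt_or_eq with h | h
  · have hle := hN ⟨s, rfl⟩
    simp only at hle
    rw [div_le_iff₀ (by linarith)] at hle
    have : (N + 1) * inner ℝ n ((s : E3) - v) + inner ℝ k ((s : E3) - v) < 0 := by nlinarith
    exact ⟨this.le, fun h0 => absurd h0 this.ne⟩
  · have := hk s h
    rw [h, mul_zero, zero_add]
    exact ⟨this, fun h0 => ⟨rfl, h0⟩⟩

theorem Face.normal_ne_zero (f : Face P) : f.normal ≠ 0 := by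
  intro h
  have := f.norm_normal
  simp [h] at this

theorem Face.convex (hP : IsConvexPolyhedron P) (f : Face P) : Convex ℝ f.carrier := by
  rw [Face.carrier, support_eq_convexHull hP]
  exact convex_convexHull ℝ _

theorem Face.inner_le (f : Face P) {x y : E3} (hy : y ∈ f.carrier) (hx : x ∈ P) :
    inner ℝ f.normal (x - y) ≤ 0 := by
  rw [inner_sub_right]
  linarith [hy.2 x hx]

theorem Face.mem_iff (f : Face P) {x y : E3} (hy : y ∈ f.carrier) :
    x ∈ f.carrier ↔ x ∈ P ∧ inner ℝ f.normal (x - y) = 0 :=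
  mem_support_iff hy

theorem Face.segment_subset (hP : IsConvexPolyhedron P) (f : Face P) {x y : E3}
    (hx : x ∈ f.carrier) (hy : y ∈ f.carrier) : segment ℝ x y ⊆ f.carrier :=
  (f.convex hP).segment_subset hx hy

theorem finrank_orthogonal_singleton {n : E3} (hn : n ≠ 0) :
    Module.finrank ℝ (ℝ ∙ n)ᗮ = 2 := by
  have := (ℝ ∙ n).finrank_add_finrank_orthogonal
  rw [finrank_span_singleton hn] at this
  simp at this
  omega

/-- A supporting plane that contains three non-collinear points of `P` gives a face. -/
theorem exists_face {n v a b : E3} (hn : n ≠ 0) (hle : ∀ x ∈ P, inner ℝ n (x - v) ≤ 0)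
    (hv : v ∈ P) (ha : a ∈ P) (hb : b ∈ P) (hna : inner ℝ n (a - v) = 0)
    (hnb : inner ℝ n (b - v) = 0) (hli : LinearIndependent ℝ ![a - v, b - v]) :
    ∃ f : Face P, f.normal = ‖n‖⁻¹ • n ∧ ∀ x, x ∈ f.carrier ↔ x ∈ P ∧ inner ℝ n (x - v) = 0 := by
  have hn' : 0 < ‖n‖⁻¹ := inv_pos.2 (norm_pos_iff.2 hn)
  have hsv : v ∈ support P (‖n‖⁻¹ • n) := by
    refine ⟨hv, fun y hy => ?_⟩
    have := hle y hy
    rw [inner_sub_right] at this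
    rw [inner_smul_left, inner_smul_left]
    simp only [conj_trivial]
    exact mul_le_mul_of_nonneg_left (by linarith) hn'.le
  have hmem : ∀ x, x ∈ support P (‖n‖⁻¹ • n) ↔ x ∈ P ∧ inner ℝ n (x - v) = 0 := by
    intro x
    rw [mem_support_iff hsv, inner_smul_left]
    simp [hn]
  refine ⟨⟨‖n‖⁻¹ • n, ?_, le_antisymm ?_ ?_⟩, rfl, hmem⟩
  · rw [norm_smul, norm_inv, norm_norm, inv_mul_cancel₀ (norm_ne_zero_iff.2 hn)]
  · rw [← finrank_orthogonal_singleton hn]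
    refine Submodule.finrank_mono ?_
    rw [vectorSpan_def, Submodule.span_le]
    rintro _ ⟨x, hx, y, hy, rfl⟩
    rw [SetLike.mem_coe, Submodule.mem_orthogonal_singleton_iff_inner_right]
    have h1 := ((hmem x).1 hx).2
    have h2 := ((hmem y).1 hy).2
    have : x - y = (x - v) - (y - v) := by simp
    change inner ℝ n (x - y) = 0
    rw [this, inner_sub_right, h1, h2, sub_zero]
  · have h2 : Module.finrank ℝ (Submodule.span ℝ (Set.range ![a - v, b - v])) = 2 := by
      simpa using finrank_span_eq_card hli
    rw [← h2]
    refine Submodule.finrank_mono ?_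
    rw [Submodule.span_le]
    rintro _ ⟨i, rfl⟩
    fin_cases i
    · exact vsub_mem_vectorSpan ℝ ((hmem a).2 ⟨ha, hna⟩) hsv
    · exact vsub_mem_vectorSpan ℝ ((hmem b).2 ⟨hb, hnb⟩) hsv

theorem finrank_span_singleton_le_one (d : E3) : Module.finrank ℝ (ℝ ∙ d) ≤ 1 := by
  simpa using finrank_span_le_card (R := ℝ) ({d} : Set E3)

/-- A face is not contained in a line. -/
theorem Face.not_collinear (f : Face P) (v d : E3) :
    ¬ ∀ x ∈ f.carrier, ∃ r : ℝ, x - v = r • d := by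
  intro h
  have h1 : Module.finrank ℝ (vectorSpan ℝ f.carrier) ≤ 1 := by
    refine le_trans (Submodule.finrank_mono (t := ℝ ∙ d) ?_) (finrank_span_singleton_le_one d)
    rw [vectorSpan_def, Submodule.span_le]
    rintro _ ⟨x, hx, y, hy, rfl⟩
    obtain ⟨r, hr⟩ := h x hx
    obtain ⟨s, hs⟩ := h y hy
    rw [SetLike.mem_coe, Submodule.mem_span_singleton]
    refine ⟨r - s, ?_⟩
    rw [sub_smul, ← hr, ← hs]; simp
  have h2 : Module.finrank ℝ (vectorSpan ℝ f.carrier) = 2 := f.finrank_support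
  omega

theorem not_subset_line (hP : IsConvexPolyhedron P) (v d : E3) :
    ¬ ∀ x : Vertex P, ∃ r : ℝ, (x : E3) - v = r • d := by
  intro h
  have h1 : Module.finrank ℝ (vectorSpan ℝ P) ≤ 1 := by
    refine le_trans (Submodule.finrank_mono (t := ℝ ∙ d) ?_) (finrank_span_singleton_le_one d)
    rw [eq_convexHull hP, ← direction_affineSpan, affineSpan_convexHull, direction_affineSpan,
      vectorSpan_def, Submodule.span_le]
    rintro _ ⟨x, hx, y, hy, rfl⟩
    obtain ⟨r, hr⟩ := h ⟨x, hx⟩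
    obtain ⟨s, hs⟩ := h ⟨y, hy⟩
    rw [SetLike.mem_coe, Submodule.mem_span_singleton]
    refine ⟨r - s, ?_⟩
    simp only at hr hs
    rw [sub_smul, ← hr, ← hs]; simp
  have := hP.2
  omega

end Polyhedron

end

/-! ### Local structure: two faces at an edge, two edges at a corner of a face -/

section

namespace Polyhedron

variable {P : Set E3}

theorem Face.eq_of_normal {f g : Face P} (h : f.normal = g.normal) : f = g := by
  obtain ⟨n, _, _⟩ := f
  obtain ⟨m, _, _⟩ := g
  obtain rfl : n = m := h
  rfl

theorem linearIndependent_pair_of_inner_eq_zero {E : Type*} [NormedAddCommGroup E]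
    [InnerProductSpace ℝ E] {m d : E} (hm : m ≠ 0) (hd : d ≠ 0) (h : inner ℝ m d = 0) :
    LinearIndependent ℝ ![m, d] := by
  rw [LinearIndependent.pair_iff]
  intro a b hab
  have h1 : inner ℝ m (a • m + b • d) = 0 := by rw [hab, inner_zero_right]
  have h2 : inner ℝ d (a • m + b • d) = 0 := by rw [hab, inner_zero_right]
  rw [inner_add_right, inner_smul_right, inner_smul_right, h, real_inner_self_eq_norm_sq] at h1
  rw [inner_add_right, inner_smul_right, inner_smul_right, real_inner_comm, h,
    real_inner_self_eq_norm_sq] at h2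
  have hm' := norm_ne_zero_iff.2 hm
  have hd' := norm_ne_zero_iff.2 hd
  constructor <;> simp_all

theorem vertex_sub_ne_zero {u v : Vertex P} (h : u ≠ v) : (v : E3) - u ≠ 0 :=
  sub_ne_zero.2 fun h' => h (Subtype.ext h'.symm)

theorem adj_sub_ne_zero {u v : Vertex P} (h : (skeleton P).Adj u v) : (v : E3) - u ≠ 0 :=
  vertex_sub_ne_zero h.1

theorem edge_functional_ne_zero (hP : IsConvexPolyhedron P) {u v : Vertex P} {m : E3}
    (hm0 : ∀ x ∈ P, inner ℝ m (x - u) = 0 ↔ x ∈ segment ℝ (u : E3) (v : E3)) : m ≠ 0 := by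
  rintro rfl
  refine not_subset_line hP (u : E3) ((v : E3) - u) fun x => ?_
  obtain ⟨a, b, _, _, hab, hx⟩ := (hm0 x x.2.1).1 (by simp)
  refine ⟨b, ?_⟩
  rw [← hx]
  have : a = 1 - b := by linarith
  rw [this]; module

/-- One of the two faces at an edge, obtained by rotating a supporting plane around the edge. -/
theorem edge_face_aux (hP : IsConvexPolyhedron P) {u v : Vertex P} (h : (skeleton P).Adj u v)
    {m t : E3} (hm : ∀ x ∈ P, inner ℝ m (x - u) ≤ 0)
    (hm0 : ∀ x ∈ P, inner ℝ m (x - u) = 0 ↔ x ∈ segment ℝ (u : E3) (v : E3))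
    (ht1 : ‖t‖ = 1) (htm : inner ℝ t m = 0) (htd : inner ℝ t ((v : E3) - u) = 0)
    (hdet : ∀ x : E3, inner ℝ m x = 0 → inner ℝ ((v : E3) - u) x = 0 → inner ℝ t x = 0 → x = 0) :
    ∃ (f : Face P) (ρ : ℝ) (s : Vertex P), 0 < inner ℝ f.normal t ∧
      (u : E3) ∈ f.carrier ∧ (v : E3) ∈ f.carrier ∧ (s : E3) ∈ f.carrier ∧
      inner ℝ m ((s : E3) - u) < 0 ∧
      (∀ x ∈ P, inner ℝ t (x - u) ≤ - ρ * inner ℝ m (x - u)) ∧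
      inner ℝ t ((s : E3) - u) = - ρ * inner ℝ m ((s : E3) - u) ∧
      ∀ g : Face P, (u : E3) ∈ g.carrier → (v : E3) ∈ g.carrier → 0 < inner ℝ g.normal t →
        g = f := by
  have hfin := hP.finite_vertex
  have hmne := edge_functional_ne_zero hP hm0
  have hmd : inner ℝ m ((v : E3) - u) = 0 := (hm0 v v.2.1).2 (right_mem_segment ℝ _ _)
  set A : Set (Vertex P) := {s | inner ℝ m ((s : E3) - u) < 0} with hA
  have hnA : ∀ s : Vertex P, s ∉ A → s = u ∨ s = v := fun s hs =>
    vertex_mem_segment ((hm0 s s.2.1).1 (le_antisymm (hm s s.2.1) (not_lt.1 hs)))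
  have hAne : A.Nonempty := by
    by_contra hcon
    rw [Set.not_nonempty_iff_eq_empty] at hcon
    refine not_subset_line hP (u : E3) ((v : E3) - u) fun x => ?_
    rcases hnA x (by simp [hcon]) with rfl | rfl
    · exact ⟨0, by simp⟩
    · exact ⟨1, by simp⟩
  -- The plane with normal `t + ρ • m` contains the edge and supports `P` as soon as `ρ` is at least
  -- the slope of every vertex off the edge. The largest slope is where the rotating plane first
  -- hits such a vertex.
  obtain ⟨s, hsA, hmax⟩ := Set.exists_max_image A
    (fun s => inner ℝ t ((s : E3) - u) / (-inner ℝ m ((s : E3) - u))) A.toFinite hAne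
  set ρ := inner ℝ t ((s : E3) - u) / (-inner ℝ m ((s : E3) - u)) with hρ
  have hsm : inner ℝ m ((s : E3) - u) < 0 := hsA
  have hs : inner ℝ t ((s : E3) - u) = - ρ * inner ℝ m ((s : E3) - u) := by
    rw [hρ, div_neg, neg_neg, div_mul_cancel₀ _ hsm.ne]
  have hle' : ∀ x : Vertex P, inner ℝ (t + ρ • m) ((x : E3) - u) ≤ 0 := by
    intro x
    rw [inner_add_left, inner_smul_left]
    simp only [conj_trivial]
    by_cases hx : x ∈ A
    · have h1 := hmax x hx
      have h2 : inner ℝ m ((x : E3) - u) < 0 := hx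
      rw [div_le_iff₀ (by linarith)] at h1
      linarith
    · rcases hnA x hx with rfl | rfl
      · simp
      · rw [htd, hmd]; simp
  have hle := inner_sub_le hP hle'
  have hnt : inner ℝ (t + ρ • m) t = 1 := by
    rw [inner_add_left, inner_smul_left, real_inner_comm t m, htm, real_inner_self_eq_norm_sq, ht1]
    simp
  have hn0 : t + ρ • m ≠ 0 := by
    intro h0; rw [h0] at hnt; simp at hnt
  have hnd : inner ℝ (t + ρ • m) ((v : E3) - u) = 0 := by
    rw [inner_add_left, inner_smul_left, htd, hmd]; simp
  have hns : inner ℝ (t + ρ • m) ((s : E3) - u) = 0 := by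
    rw [inner_add_left, inner_smul_left, hs]; simp
  have hli : LinearIndependent ℝ ![(v : E3) - u, (s : E3) - u] := by
    rw [LinearIndependent.pair_iff]
    intro a b hab
    have h1 : inner ℝ m (a • ((v : E3) - u) + b • ((s : E3) - u)) = 0 := by
      rw [hab, inner_zero_right]
    rw [inner_add_right, inner_smul_right, inner_smul_right, hmd, mul_zero, zero_add] at h1
    have hb : b = 0 := (mul_eq_zero.1 h1).resolve_right hsm.ne
    rw [hb, zero_smul, add_zero] at hab
    exact ⟨(smul_eq_zero.1 hab).resolve_right (adj_sub_ne_zero h), hb⟩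
  obtain ⟨f, hfn, hf⟩ := exists_face hn0 hle u.2.1 v.2.1 s.2.1 hnd hns hli
  refine ⟨f, ρ, s, ?_, (hf u).2 ⟨u.2.1, by simp⟩, (hf v).2 ⟨v.2.1, hnd⟩, (hf s).2 ⟨s.2.1, hns⟩,
    hsm, ?_, hs, ?_⟩
  · rw [hfn, inner_smul_left, hnt]
    simp [hn0]
  · intro x hx
    have := hle x hx
    rw [inner_add_left, inner_smul_left] at this
    simp only [conj_trivial] at this
    linarith
  -- Any face normal at the edge is a combination `α • t + β • m`. The vertex `s` gives `β ≥ α * ρ`,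
  -- a point of `g` off the edge gives `β ≤ α * ρ`, and unit length determines `α`.
  · intro g hgu hgv hgt
    set α := inner ℝ g.normal t with hα
    set β := inner ℝ g.normal m / ‖m‖ ^ 2 with hβ
    have hmn : ‖m‖ ≠ 0 := norm_ne_zero_iff.2 hmne
    have hgd : inner ℝ g.normal ((v : E3) - u) = 0 := ((g.mem_iff hgu).1 hgv).2
    have hg : g.normal = α • t + β • m := by
      rw [← sub_eq_zero]
      apply hdet
      · rw [inner_sub_right, inner_add_right, inner_smul_right, inner_smul_right,
          real_inner_comm t m, htm, real_inner_self_eq_norm_sq, hβ, div_mul_cancel₀ _ (by positivity),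
          real_inner_comm]
        simp
      · rw [real_inner_comm, inner_sub_left, inner_add_left, inner_smul_left, inner_smul_left, htd,
          hmd, hgd]
        simp
      · rw [inner_sub_right, inner_add_right, inner_smul_right, inner_smul_right,
          htm, real_inner_self_eq_norm_sq, ht1, real_inner_comm]
        simp [hα]
    have hgx : ∀ x : E3, inner ℝ g.normal x = α * inner ℝ t x + β * inner ℝ m x := by
      intro x; rw [hg, inner_add_left, inner_smul_left, inner_smul_left]; simp
    have h1 : α * ρ ≤ β := by
      have := g.inner_le hgu s.2.1
      rw [hgx, hs] at this
      nlinarith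
    have h2 : β ≤ α * ρ := by
      obtain ⟨x, hx, hxs⟩ : ∃ x ∈ g.carrier, x ∉ segment ℝ (u : E3) (v : E3) := by
        by_contra hcon
        push Not at hcon
        refine g.not_collinear (u : E3) ((v : E3) - u) fun x hx => ?_
        obtain ⟨a, b, _, _, hab, rfl⟩ := hcon x hx
        refine ⟨b, ?_⟩
        have : a = 1 - b := by linarith
        rw [this]; module
      have hxm : inner ℝ m (x - u) < 0 := lt_of_le_of_ne (hm x hx.1) fun h0 =>
        hxs ((hm0 x hx.1).1 h0)
      have h3 := ((g.mem_iff hgu).1 hx).2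
      rw [hgx] at h3
      have h4 := hle x hx.1
      rw [inner_add_left, inner_smul_left] at h4
      simp only [conj_trivial] at h4
      nlinarith
    have hβρ : β = α * ρ := le_antisymm h2 h1
    have hg' : g.normal = α • (t + ρ • m) := by rw [hg, hβρ]; module
    have hα1 : α = ‖t + ρ • m‖⁻¹ := by
      have := g.norm_normal
      rw [hg', norm_smul, Real.norm_eq_abs, abs_of_pos hgt] at this
      exact eq_inv_of_mul_eq_one_left this
    have : g.normal = f.normal := by rw [hg', hα1, hfn]
    exact Face.eq_of_normal this

theorem Face.edge_subset_iff (hP : IsConvexPolyhedron P) (f : Face P) {u v : E3} :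
    segment ℝ u v ⊆ f.carrier ↔ u ∈ f.carrier ∧ v ∈ f.carrier :=
  ⟨fun h => ⟨h (left_mem_segment ℝ _ _), h (right_mem_segment ℝ _ _)⟩,
    fun h => f.segment_subset hP h.1 h.2⟩

/-- Every edge lies in exactly two faces, and `P` lies in the wedge that they span. -/
theorem edge_faces (hP : IsConvexPolyhedron P) {u v : Vertex P} (h : (skeleton P).Adj u v) :
    ∃ f g : Face P, f ≠ g ∧ segment ℝ (u : E3) v ⊆ f.carrier ∧ segment ℝ (u : E3) v ⊆ g.carrier ∧
      (∀ k : Face P, segment ℝ (u : E3) v ⊆ k.carrier → k = f ∨ k = g) ∧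
      ∀ k : E3, inner ℝ k ((v : E3) - u) = 0 → (∀ x ∈ f.carrier, 0 ≤ inner ℝ k (x - u)) →
        (∀ x ∈ g.carrier, 0 ≤ inner ℝ k (x - u)) → ∀ x ∈ P, 0 ≤ inner ℝ k (x - u) := by
  obtain ⟨m, hm, hm0⟩ := exists_edge_functional h
  have hmne := edge_functional_ne_zero hP hm0
  have hmn : ‖m‖ ≠ 0 := norm_ne_zero_iff.2 hmne
  have hmd : inner ℝ m ((v : E3) - u) = 0 := (hm0 v v.2.1).2 (right_mem_segment ℝ _ _)
  obtain ⟨t, ht1, htm, htd, hdet⟩ := exists_unit_normal m ((v : E3) - u)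
    (linearIndependent_pair_of_inner_eq_zero hmne (adj_sub_ne_zero h) hmd)
  obtain ⟨f, ρ, s, hft, hfu, hfv, hfs, hsm, hfle, hseq, hfuniq⟩ :=
    edge_face_aux hP h hm hm0 ht1 htm htd hdet
  -- Rotating the other way yields the second face. The sign of the normal along `t` tells the two
  -- apart, and the sign cannot be zero because a face is not contained in the edge.
  obtain ⟨g, σ, r, hgt, hgu, hgv, hgr, hrm, hgle, hreq, hguniq⟩ :=
    edge_face_aux (t := -t) hP h hm hm0 (by simpa using ht1) (by simpa using htm)
      (by simpa using htd) (fun x h1 h2 h3 => hdet x h1 h2 (by simpa using h3))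
  have hexp : ∀ k : E3, inner ℝ k ((v : E3) - u) = 0 → ∃ α β : ℝ, α = inner ℝ k t ∧
      ∀ x, inner ℝ k x = α * inner ℝ t x + β * inner ℝ m x := by
    intro k hk
    refine ⟨inner ℝ k t, inner ℝ k m / ‖m‖ ^ 2, rfl, ?_⟩
    have hg : k = (inner ℝ k t) • t + (inner ℝ k m / ‖m‖ ^ 2) • m := by
      rw [← sub_eq_zero]
      apply hdet
      · rw [inner_sub_right, inner_add_right, inner_smul_right, inner_smul_right,
          real_inner_comm t m, htm, real_inner_self_eq_norm_sq, div_mul_cancel₀ _ (by positivity),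
          real_inner_comm]
        simp
      · rw [real_inner_comm, inner_sub_left, inner_add_left, inner_smul_left, inner_smul_left, htd,
          hmd, hk]
        simp
      · rw [inner_sub_right, inner_add_right, inner_smul_right, inner_smul_right,
          htm, real_inner_self_eq_norm_sq, ht1, real_inner_comm]
        simp
    intro x
    conv_lhs => rw [hg]
    rw [inner_add_left, inner_smul_left, inner_smul_left]; simp
  simp only [inner_neg_right, inner_neg_left] at hgt hgle hreq hguniq
  refine ⟨f, g, ?_, (f.edge_subset_iff hP).2 ⟨hfu, hfv⟩, (g.edge_subset_iff hP).2 ⟨hgu, hgv⟩, ?_, ?_⟩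
  · rintro rfl
    linarith
  · intro k hk
    have hku := hk (left_mem_segment ℝ _ _)
    have hkv := hk (right_mem_segment ℝ _ _)
    rcases lt_trichotomy (inner ℝ k.normal t) 0 with h0 | h0 | h0
    · right; exact hguniq k hku hkv (by linarith)
    · exfalso
      obtain ⟨α, β, hα, hkx⟩ := hexp k.normal ((k.mem_iff hku).1 hkv).2
      rw [h0] at hα
      subst hα
      obtain ⟨x, hx, hxs⟩ : ∃ x ∈ k.carrier, x ∉ segment ℝ (u : E3) (v : E3) := by
        by_contra hcon
        push Not at hcon
        refine k.not_collinear (u : E3) ((v : E3) - u) fun x hx => ?_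
        obtain ⟨a, b, _, _, hab, rfl⟩ := hcon x hx
        refine ⟨b, ?_⟩
        have : a = 1 - b := by linarith
        rw [this]; module
      have hxm : inner ℝ m (x - u) ≠ 0 := fun h0 => hxs ((hm0 x hx.1).1 h0)
      have h3 := ((k.mem_iff hku).1 hx).2
      rw [hkx] at h3
      have hβ : β = 0 := by simpa [hxm] using h3
      have h4 := hkx k.normal
      rw [hβ, real_inner_self_eq_norm_sq, k.norm_normal] at h4
      simp at h4
    · left; exact hfuniq k hku hkv h0
  -- Such a `k` is `α • t + β • m`. Its values at the vertices `s` and `r` of the two faces bound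
  -- `β` from above by `α * ρ` and by `-(α * σ)`; the sign of `α` decides which face plane gives the
  -- estimate at `x`.
  · intro k hk hkf hkg x hx
    obtain ⟨α, β, -, hkx⟩ := hexp k hk
    have h1 := hkf s hfs
    have h2 := hkg r hgr
    rw [hkx] at h1 h2 ⊢
    have h3 := hfle x hx
    have h4 := hgle x hx
    have h5 := hm x hx
    have hreq' : inner ℝ t ((r : E3) - u) = σ * inner ℝ m ((r : E3) - u) := by linarith
    rw [hseq] at h1
    rw [hreq'] at h2
    have h6 : β ≤ α * ρ := by nlinarith
    have h7 : β ≤ - (α * σ) := by nlinarith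
    rcases le_total 0 α with h8 | h8
    · have : α * (σ * inner ℝ m (x - u)) ≤ α * inner ℝ t (x - u) :=
        mul_le_mul_of_nonneg_left (by linarith) h8
      nlinarith
    · have : α * (-ρ * inner ℝ m (x - u)) ≤ α * inner ℝ t (x - u) :=
        mul_le_mul_of_nonpos_left (by linarith) h8
      nlinarith

/-- The extreme direction of a face at a vertex, on the side of `t`, is an edge of `P`. -/
theorem face_corner_aux (hP : IsConvexPolyhedron P) (f : Face P) {v : Vertex P}
    (hv : (v : E3) ∈ f.carrier) {η t : E3} (hη : ∀ y ∈ P, y ≠ v → 0 < inner ℝ η (y - v))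
    (hdet : ∀ x : E3, inner ℝ f.normal x = 0 → inner ℝ η x = 0 → inner ℝ t x = 0 → x = 0) :
    ∃ (a : Vertex P) (ρ : ℝ), (skeleton P).Adj v a ∧ (a : E3) ∈ f.carrier ∧
      inner ℝ t ((a : E3) - v) = ρ * inner ℝ η ((a : E3) - v) ∧
      ∀ x ∈ f.carrier, inner ℝ t (x - v) ≤ ρ * inner ℝ η (x - v) := by
  have hfin := hP.finite_vertex
  have hηv : ∀ s : Vertex P, s ≠ v → 0 < inner ℝ η ((s : E3) - v) := fun s hs =>
    hη s s.2.1 fun h => hs (Subtype.ext h)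
  set A : Set (Vertex P) := {s | (s : E3) ∈ f.carrier ∧ s ≠ v} with hA
  have hAne : A.Nonempty := by
    by_contra hcon
    rw [Set.not_nonempty_iff_eq_empty] at hcon
    refine f.not_collinear (v : E3) 0 fun x hx => ⟨0, ?_⟩
    have hs : f.carrier = convexHull ℝ (f.carrier ∩ P.extremePoints ℝ) :=
      support_eq_convexHull hP f.normal
    have hsub : f.carrier ∩ P.extremePoints ℝ ⊆ {(v : E3)} := by
      rintro y ⟨hy, hye⟩
      by_contra hne
      have : (⟨y, hye⟩ : Vertex P) ∈ A := ⟨hy, fun h => hne (congrArg Subtype.val h)⟩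
      rw [hcon] at this
      exact this
    have : x ∈ convexHull ℝ {(v : E3)} := by
      rw [hs] at hx; exact convexHull_mono hsub hx
    rw [convexHull_singleton] at this
    rw [this]; simp
  obtain ⟨a, ⟨haf, hav⟩, hmax⟩ := Set.exists_max_image A
    (fun s => inner ℝ t ((s : E3) - v) / (inner ℝ η ((s : E3) - v))) A.toFinite hAne
  set ρ := inner ℝ t ((a : E3) - v) / (inner ℝ η ((a : E3) - v)) with hρ
  have hηa := hηv a hav
  have ha : inner ℝ t ((a : E3) - v) = ρ * inner ℝ η ((a : E3) - v) := by
    rw [hρ]; field_simp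
  have hk : ∀ s : Vertex P, inner ℝ f.normal ((s : E3) - v) = 0 →
      inner ℝ (t - ρ • η) ((s : E3) - v) ≤ 0 := by
    intro s hs
    rw [inner_sub_left, inner_smul_left]
    simp only [conj_trivial]
    by_cases hsv : s = v
    · subst hsv; simp
    · have h1 := hmax s ⟨(f.mem_iff hv).2 ⟨s.2.1, hs⟩, hsv⟩
      have h2 := hηv s hsv
      rw [div_le_iff₀ h2] at h1
      linarith
  obtain ⟨N, hN⟩ := exists_lex_functional hP v f.normal (t - ρ • η)
    (fun s => f.inner_le hv s.2.1) hk
  -- Being on the face and having the largest slope are two successive linear conditions; their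
  -- lexicographic combination is a single functional on `P`, and it exposes the edge from `v` to
  -- `a`.
  have hka : inner ℝ (t - ρ • η) ((a : E3) - v) = 0 := by
    rw [inner_sub_left, inner_smul_left, ha]; simp
  refine ⟨a, ρ, adj_of_functional hP (Ne.symm hav) (N • f.normal + (t - ρ • η)) (fun s => (hN s).1)
    ?_ ?_, haf, ha, ?_⟩
  · rw [inner_add_left, hka, inner_smul_left, ((f.mem_iff hv).1 haf).2]; simp
  · intro s hs
    obtain ⟨h1, h2⟩ := (hN s).2 hs
    refine ⟨inner ℝ η ((s : E3) - v) / inner ℝ η ((a : E3) - v), ?_⟩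
    rw [← sub_eq_zero]
    rw [inner_sub_left, inner_smul_left] at h2
    simp only [conj_trivial] at h2
    apply hdet
    · rw [inner_sub_right, inner_smul_right, h1, ((f.mem_iff hv).1 haf).2]; simp
    · rw [inner_sub_right, inner_smul_right, div_mul_cancel₀ _ hηa.ne']; simp
    · rw [inner_sub_right, inner_smul_right, ha]
      field_simp
      linarith
  · intro x hx
    have hs : f.carrier = convexHull ℝ (f.carrier ∩ P.extremePoints ℝ) :=
      support_eq_convexHull hP f.normal
    rw [hs] at hx
    have := inner_sub_le_of_mem_convexHull (n := t - ρ • η) (v := (v : E3))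
      (fun s hs => hk ⟨s, hs.2⟩ ((f.mem_iff hv).1 hs.1).2) x hx
    rw [inner_sub_left, inner_smul_left] at this
    simp only [conj_trivial] at this
    linarith

/-- A face has exactly two edges at each of its vertices, and lies in the sector they span. -/
theorem face_corner (hP : IsConvexPolyhedron P) (f : Face P) {v : Vertex P}
    (hv : (v : E3) ∈ f.carrier) :
    ∃ a b : Vertex P, a ≠ b ∧ (skeleton P).Adj v a ∧ (skeleton P).Adj v b ∧
      (a : E3) ∈ f.carrier ∧ (b : E3) ∈ f.carrier ∧
      LinearIndependent ℝ ![(a : E3) - v, (b : E3) - v] ∧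
      (∀ x ∈ f.carrier, ∃ α β : ℝ, 0 ≤ α ∧ 0 ≤ β ∧
        x - v = α • ((a : E3) - v) + β • ((b : E3) - v)) ∧
      ∀ c : Vertex P, (skeleton P).Adj v c → (c : E3) ∈ f.carrier → c = a ∨ c = b := by
  obtain ⟨η, hη⟩ := exists_exposing hP v
  have hli : LinearIndependent ℝ ![f.normal, η] := by
    rw [LinearIndependent.pair_iff' f.normal_ne_zero]
    intro c hc
    refine f.not_collinear (v : E3) 0 fun x hx => ⟨0, ?_⟩
    by_contra hne
    have hxv : x ≠ v := fun h => hne (by simp [h])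
    have h1 := hη x hx.1 hxv
    rw [← hc, inner_smul_left, ((f.mem_iff hv).1 hx).2] at h1
    simp at h1
  obtain ⟨t, -, -, -, hdet⟩ := exists_unit_normal _ _ hli
  obtain ⟨a, ρ, hva, haf, haeq, hale⟩ := face_corner_aux hP f hv hη hdet
  obtain ⟨b, σ, hvb, hbf, hbeq, hble⟩ := face_corner_aux (t := -t) hP f hv hη
    (fun x h1 h2 h3 => hdet x h1 h2 (by simpa using h3))
  simp only [inner_neg_left] at hbeq hble
  have hna : ∀ x ∈ f.carrier, inner ℝ f.normal (x - v) = 0 := fun x hx => ((f.mem_iff hv).1 hx).2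
  have hηa := hη a a.2.1 fun h => hva.1 (Subtype.ext h.symm)
  have hηb := hη b b.2.1 fun h => hvb.1 (Subtype.ext h.symm)
  -- `ρ` and `-σ` are the extreme slopes of the face at `v`. If they agreed, the face would lie on a
  -- line.
  have hρσ : 0 < ρ + σ := by
    have h0 : 0 ≤ ρ + σ := by
      have h1 := hble a haf
      rw [haeq] at h1
      nlinarith
    refine lt_of_le_of_ne h0 fun h1 => ?_
    refine f.not_collinear (v : E3) ((a : E3) - v) fun x hx => ?_
    refine ⟨inner ℝ η (x - v) / inner ℝ η ((a : E3) - v), ?_⟩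
    rw [← sub_eq_zero]
    have h3 := hale x hx
    have h4 := hble x hx
    have h5 : σ = -ρ := by linarith
    rw [h5] at h4
    apply hdet
    · rw [inner_sub_right, inner_smul_right, hna x hx, hna a haf]; simp
    · rw [inner_sub_right, inner_smul_right, div_mul_cancel₀ _ hηa.ne']; simp
    · rw [inner_sub_right, inner_smul_right, haeq]
      field_simp
      linarith
  have hli2 : LinearIndependent ℝ ![(a : E3) - v, (b : E3) - v] := by
    rw [LinearIndependent.pair_iff]
    intro x y hxy
    have h1 : inner ℝ t (x • ((a : E3) - v) + y • ((b : E3) - v)) = 0 := by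
      rw [hxy, inner_zero_right]
    have h2 : inner ℝ η (x • ((a : E3) - v) + y • ((b : E3) - v)) = 0 := by
      rw [hxy, inner_zero_right]
    have hb' : inner ℝ t ((b : E3) - v) = -σ * inner ℝ η ((b : E3) - v) := by linarith
    rw [inner_add_right, inner_smul_right, inner_smul_right] at h1 h2
    rw [haeq, hb'] at h1
    have hx : (ρ + σ) * inner ℝ η ((a : E3) - v) * x = 0 := by linear_combination h1 + σ * h2
    have hy : (ρ + σ) * inner ℝ η ((b : E3) - v) * y = 0 := by linear_combination -h1 + ρ * h2
    exact ⟨(mul_eq_zero.1 hx).resolve_left (by positivity),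
      (mul_eq_zero.1 hy).resolve_left (by positivity)⟩
  have hcone : ∀ x ∈ f.carrier, ∃ α β : ℝ, 0 ≤ α ∧ 0 ≤ β ∧
        x - v = α • ((a : E3) - v) + β • ((b : E3) - v) := by
    intro x hx
    have h3 := hale x hx
    have h4 := hble x hx
    have hb' : inner ℝ t ((b : E3) - v) = -σ * inner ℝ η ((b : E3) - v) := by linarith
    refine ⟨(inner ℝ t (x - v) + σ * inner ℝ η (x - v)) / ((ρ + σ) * inner ℝ η ((a : E3) - v)),
      (ρ * inner ℝ η (x - v) - inner ℝ t (x - v)) / ((ρ + σ) * inner ℝ η ((b : E3) - v)),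
      div_nonneg (by linarith) (by positivity), div_nonneg (by linarith) (by positivity), ?_⟩
    rw [← sub_eq_zero]
    apply hdet
    · rw [inner_sub_right, inner_add_right, inner_smul_right, inner_smul_right, hna x hx, hna a haf,
        hna b hbf]; simp
    · rw [inner_sub_right, inner_add_right, inner_smul_right, inner_smul_right]
      field_simp
      ring
    · rw [inner_sub_right, inner_add_right, inner_smul_right, inner_smul_right, haeq, hb']
      field_simp
      ring
  refine ⟨a, b, ?_, hva, hvb, haf, hbf, hli2, hcone, ?_⟩
  · rintro rfl
    have := hli2.injective.ne (show (0 : Fin 2) ≠ 1 by decide)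
    simp at this
  · intro c hvc hcf
    obtain ⟨α, β, hα, hβ, hc⟩ := hcone c hcf
    rcases hβ.eq_or_lt with h0 | hβ
    · left
      rw [← h0, zero_smul, add_zero] at hc
      exact vertex_eq_of_collinear v a c hva.1.symm hvc.1.symm hc
    · right
      -- The functional exposing the edge `v c` is nonpositive at `a` and `b` and vanishes at a
      -- combination in which `b` has positive weight, so it vanishes at `b`, which must then be
      -- `c`.
      obtain ⟨m, hm, hm0⟩ := exists_edge_functional hvc
      have h1 : inner ℝ m ((c : E3) - v) = 0 := (hm0 c c.2.1).2 (right_mem_segment ℝ _ _)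
      rw [hc, inner_add_right, inner_smul_right, inner_smul_right] at h1
      have h2 := hm a a.2.1
      have h3 := hm b b.2.1
      have h4 : inner ℝ m ((b : E3) - v) = 0 := by
        by_contra hne
        have : inner ℝ m ((b : E3) - v) < 0 := lt_of_le_of_ne h3 hne
        nlinarith
      exact ((vertex_mem_segment ((hm0 b b.2.1).1 h4)).resolve_left hvb.1.symm).symm

end Polyhedron

end

/-! ### Mod 2 homology: vertex links are connected and cycles of edges bound -/

section

namespace Polyhedron

variable {P : Set E3}

/-- Simplex step around a vertex: an edge at `v` that does not minimise `k` has a neighbour, across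
a face, on which `k` is smaller. -/
theorem exists_lower_neighbor (hP : IsConvexPolyhedron P) {v w : Vertex P}
    (h : (skeleton P).Adj v w) {k : E3} (hk : inner ℝ k ((w : E3) - v) = 0) {x : E3} (hx : x ∈ P)
    (hkx : inner ℝ k (x - v) < 0) :
    ∃ (f : Face P) (a : Vertex P), (v : E3) ∈ f.carrier ∧ (w : E3) ∈ f.carrier ∧
      (a : E3) ∈ f.carrier ∧ (skeleton P).Adj v a ∧ inner ℝ k ((a : E3) - v) < 0 := by
  by_contra hcon
  push Not at hcon
  obtain ⟨f, g, -, hf, hg, -, hwedge⟩ := edge_faces hP h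
  have key : ∀ f : Face P, segment ℝ (v : E3) w ⊆ f.carrier →
      ∀ x ∈ f.carrier, 0 ≤ inner ℝ k (x - v) := by
    intro f hf x hx
    have hv := hf (left_mem_segment ℝ _ _)
    have hw := hf (right_mem_segment ℝ _ _)
    obtain ⟨a, b, -, hva, hvb, ha, hb, -, hcone, -⟩ := face_corner hP f hv
    obtain ⟨α, β, hα, hβ, hxe⟩ := hcone x hx
    rw [hxe, inner_add_right, inner_smul_right, inner_smul_right]
    have := mul_nonneg hα (hcon f a hv hw ha hva)
    have := mul_nonneg hβ (hcon f b hv hw hb hvb)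
    linarith
  exact absurd (hwedge k hk (key f hf) (key g hg) x hx) (not_le.2 hkx)

/-- Two distinct edges at `v`, descending for `h`, in a common face. -/
def Link (v : Vertex P) (h : E3) (a b : Vertex P) : Prop :=
  a ≠ b ∧ (skeleton P).Adj v a ∧ (skeleton P).Adj v b ∧ inner ℝ h ((a : E3) - v) < 0 ∧
    inner ℝ h ((b : E3) - v) < 0 ∧
    ∃ f : Face P, (v : E3) ∈ f.carrier ∧ (a : E3) ∈ f.carrier ∧ (b : E3) ∈ f.carrier

theorem Link.symm {v : Vertex P} {h : E3} {a b : Vertex P} (hl : Link v h a b) : Link v h b a := by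
  obtain ⟨h1, h2, h3, h4, h5, f, h6, h7, h8⟩ := hl
  exact ⟨h1.symm, h3, h2, h5, h4, f, h6, h8, h7⟩

theorem reflTransGen_symm {α : Type*} {r : α → α → Prop} (hr : ∀ a b, r a b → r b a) {a b : α}
    (h : Relation.ReflTransGen r a b) : Relation.ReflTransGen r b a := by
  induction h with
  | refl => exact .refl
  | tail _ h ih => exact .head (hr _ _ h) ih

/-- The simplex method in the vertex figure. Among the descending edges reachable through links,
take one with least slope of `h` against `η`. If `h - s • η` were negative somewhere on `P`, then
`exists_lower_neighbor` would provide a linked edge of smaller slope, still descending because `s <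
0`. So the local minimum is the global one and does not depend on the starting edge. -/
theorem exists_link_min (hP : IsConvexPolyhedron P) {v : Vertex P} {h η : E3}
    (hη : ∀ y ∈ P, y ≠ v → 0 < inner ℝ η (y - v)) {a : Vertex P} (hva : (skeleton P).Adj v a)
    (ha : inner ℝ h ((a : E3) - v) < 0) :
    ∃ (c : Vertex P) (s : ℝ), Relation.ReflTransGen (Link v h) a c ∧ (skeleton P).Adj v c ∧
      inner ℝ h ((c : E3) - v) < 0 ∧ inner ℝ h ((c : E3) - v) = s * inner ℝ η ((c : E3) - v) ∧
      ∀ x ∈ P, 0 ≤ inner ℝ (h - s • η) (x - v) := by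
  have hfin := hP.finite_vertex
  have hpos : ∀ c : Vertex P, (skeleton P).Adj v c → 0 < inner ℝ η ((c : E3) - v) := fun c hc =>
    hη c c.2.1 fun h => hc.1 (Subtype.ext h.symm)
  set A : Set (Vertex P) := {c | Relation.ReflTransGen (Link v h) a c ∧ (skeleton P).Adj v c ∧
    inner ℝ h ((c : E3) - v) < 0}
  obtain ⟨c, ⟨hac, hvc, hc⟩, hmin⟩ := Set.exists_min_image A
    (fun c => inner ℝ h ((c : E3) - v) / inner ℝ η ((c : E3) - v)) A.toFinite
    ⟨a, .refl, hva, ha⟩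
  set s := inner ℝ h ((c : E3) - v) / inner ℝ η ((c : E3) - v) with hs
  have hηc := hpos c hvc
  have hcs : inner ℝ h ((c : E3) - v) = s * inner ℝ η ((c : E3) - v) := by
    rw [hs, div_mul_cancel₀ _ hηc.ne']
  have hsneg : s < 0 := div_neg_of_neg_of_pos hc hηc
  refine ⟨c, s, hac, hvc, hc, hcs, fun x hx => ?_⟩
  by_contra hneg
  push Not at hneg
  obtain ⟨f, d, hfv, hfc, hfd, hvd, hd⟩ := exists_lower_neighbor hP hvc (k := h - s • η)
    (by rw [inner_sub_left, inner_smul_left, hcs]; simp) hx hneg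
  rw [inner_sub_left, inner_smul_left] at hd
  simp only [conj_trivial] at hd
  have hηd := hpos d hvd
  have hd0 : inner ℝ h ((d : E3) - v) < 0 := by nlinarith
  have hdc : c ≠ d := by rintro rfl; linarith
  have := hmin d ⟨hac.tail ⟨hdc, hvc, hvd, hc, hd0, f, hfv, hfc, hfd⟩, hvd, hd0⟩
  rw [le_div_iff₀ hηd] at this
  linarith

/-- A functional that exposes a vertex and is not a multiple of a given one. -/
theorem exists_exposing_not_parallel (hP : IsConvexPolyhedron P) (v : Vertex P) (h : E3)
    (hh : h ≠ 0) :
    ∃ η : E3, (∀ y ∈ P, y ≠ v → 0 < inner ℝ η (y - v)) ∧ ∀ s : ℝ, h ≠ s • η := by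
  have hfin := hP.finite_vertex
  obtain ⟨η, hη⟩ := exists_exposing hP v
  by_cases hpar : ∀ s : ℝ, h ≠ s • η
  · exact ⟨η, hη, hpar⟩
  push Not at hpar
  obtain ⟨s, rfl⟩ := hpar
  have hs : s ≠ 0 := by rintro rfl; simp at hh
  have hη0 : η ≠ 0 := by rintro rfl; simp at hh
  -- If `h` is parallel to `η`, tilt `η` by an orthogonal `q`; a large multiple `M` of `η` keeps the
  -- sum positive on all vertices other than `v`.
  obtain ⟨q, hq, hq0⟩ : ∃ q : E3, inner ℝ η q = 0 ∧ q ≠ 0 := by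
    have := finrank_orthogonal_singleton hη0
    have : Nontrivial (ℝ ∙ η)ᗮ := Module.nontrivial_of_finrank_pos (R := ℝ) (by omega)
    obtain ⟨q, hq⟩ := exists_ne (0 : (ℝ ∙ η)ᗮ)
    exact ⟨q, Submodule.mem_orthogonal_singleton_iff_inner_right.1 q.2,
      fun h => hq (Subtype.ext h)⟩
  obtain ⟨N, hN⟩ := (Set.finite_range fun s : Vertex P =>
    (-inner ℝ q ((s : E3) - v)) / inner ℝ η ((s : E3) - v)).bddAbove
  set M := |N| + 1
  have hM : 0 < M := by positivity
  have hNM : N < M := lt_of_le_of_lt (le_abs_self N) (by simp [M])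
  have hpos : ∀ s : Vertex P, s ≠ v → 0 < inner ℝ (M • η + q) ((s : E3) - v) := by
    intro s hs
    have hp := hη s s.2.1 fun h => hs (Subtype.ext h)
    have := hN ⟨s, rfl⟩
    simp only at this
    rw [div_le_iff₀ hp] at this
    rw [inner_add_left, inner_smul_left]
    simp only [conj_trivial]
    nlinarith
  refine ⟨M • η + q, fun y hy hyv => ?_, fun r hr => ?_⟩
  · have hle := inner_sub_le hP (n := -(M • η + q)) (v := (v : E3)) (fun s => by
      rw [inner_neg_left]
      by_cases hs : s = v
      · subst hs; simp
      · linarith [hpos s hs])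
    have hsup : (v : E3) ∈ support P (-(M • η + q)) := ⟨v.2.1, fun x hx => by
      have := hle x hx
      rw [inner_sub_right] at this; linarith⟩
    have h1 := hle y hy
    rw [inner_neg_left] at h1
    refine lt_of_le_of_ne (by linarith) fun h0 => hyv ?_
    have hys : y ∈ support P (-(M • η + q)) :=
      (mem_support_iff hsup).2 ⟨hy, by rw [inner_neg_left]; linarith⟩
    rw [support_eq_convexHull hP] at hys
    have hsub : support P (-(M • η + q)) ∩ P.extremePoints ℝ ⊆ {(v : E3)} := by
      rintro x ⟨hx, hxe⟩
      by_contra hne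
      have h2 := hpos ⟨x, hxe⟩ fun h => hne (congrArg Subtype.val h)
      have h3 := ((mem_support_iff hsup).1 hx).2
      rw [inner_neg_left] at h3
      simp only at h2
      linarith
    have := convexHull_mono hsub hys
    simpa using this
  · have h1 : inner ℝ q (s • η) = inner ℝ q (r • (M • η + q)) := by rw [hr]
    rw [inner_smul_right, inner_smul_right, inner_add_right, inner_smul_right,
      real_inner_comm η q, hq, real_inner_self_eq_norm_sq] at h1
    have hr0 : r = 0 := by simpa [hq0] using h1.symm
    rw [hr0, zero_smul] at hr
    exact hh hr

/-- The descending edges at a vertex are linked through faces. -/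
theorem linked (hP : IsConvexPolyhedron P) {v : Vertex P} {h : E3} {a b : Vertex P}
    (hva : (skeleton P).Adj v a) (hvb : (skeleton P).Adj v b)
    (ha : inner ℝ h ((a : E3) - v) < 0) (hb : inner ℝ h ((b : E3) - v) < 0) :
    Relation.ReflTransGen (Link v h) a b := by
  have hh : h ≠ 0 := by rintro rfl; simp at ha
  obtain ⟨η, hη, hpar⟩ := exists_exposing_not_parallel hP v h hh
  obtain ⟨c, s, hac, hvc, hc, hcs, hcm⟩ := exists_link_min hP hη hva ha
  obtain ⟨d, r, hbd, hvd, hd, hdr, hdm⟩ := exists_link_min hP hη hvb hb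
  have hηc := hη c c.2.1 fun h => hvc.1 (Subtype.ext h.symm)
  have hηd := hη d d.2.1 fun h => hvd.1 (Subtype.ext h.symm)
  -- Both end edges attain the global minimum of the same slope. If they differ, `h - s • η`
  -- vanishes at `v`, `c` and `d` and cuts out a common face; its normal is nonzero because `h` is
  -- not a multiple of `η`.
  have hsr : s = r := by
    have h1 := hcm d d.2.1
    have h2 := hdm c c.2.1
    rw [inner_sub_left, inner_smul_left] at h1 h2
    simp only [conj_trivial] at h1 h2
    rw [hdr] at h1
    rw [hcs] at h2
    apply le_antisymm <;> nlinarith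
  refine hac.trans (Relation.ReflTransGen.trans ?_
    (reflTransGen_symm (fun _ _ => Link.symm) hbd))
  by_cases hcd : c = d
  · rw [hcd]
  refine .single ⟨hcd, hvc, hvd, hc, hd, ?_⟩
  have hli : LinearIndependent ℝ ![(c : E3) - v, (d : E3) - v] := by
    rw [LinearIndependent.pair_iff' (adj_sub_ne_zero hvc)]
    intro x hx
    exact hcd (vertex_eq_of_collinear v c d hvc.1.symm hvd.1.symm hx.symm).symm
  obtain ⟨f, -, hf⟩ := exists_face (n := -(h - s • η)) (v := (v : E3)) (P := P)
    (neg_ne_zero.2 (sub_ne_zero.2 (hpar s))) (fun x hx => by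
      rw [inner_neg_left]; linarith [hcm x hx]) v.2.1 c.2.1 d.2.1
    (by rw [inner_neg_left, inner_sub_left, inner_smul_left, hcs]; simp)
    (by rw [inner_neg_left, inner_sub_left, inner_smul_left, hdr, hsr]; simp) hli
  refine ⟨f, (hf v).2 ⟨v.2.1, by simp⟩, (hf c).2 ⟨c.2.1, ?_⟩, (hf d).2 ⟨d.2.1, ?_⟩⟩
  · rw [inner_neg_left, inner_sub_left, inner_smul_left, hcs]; simp
  · rw [inner_neg_left, inner_sub_left, inner_smul_left, hdr, hsr]; simp

open Classical in
/-- Incidence of a face with the pair `u, w`, mod 2. -/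
noncomputable def inc (f : Face P) (u w : Vertex P) : ZMod 2 :=
  if (skeleton P).Adj u w ∧ (u : E3) ∈ f.carrier ∧ (w : E3) ∈ f.carrier then 1 else 0

/-- The boundary, mod 2, of a chain of faces. -/
noncomputable def bd [Fintype (Face P)] (c : Face P → ZMod 2) (u w : Vertex P) : ZMod 2 :=
  ∑ f, c f * inc f u w

theorem inc_comm (f : Face P) (u w : Vertex P) : inc f u w = inc f w u := by
  classical
  have : ((skeleton P).Adj u w ∧ (u : E3) ∈ f.carrier ∧ (w : E3) ∈ f.carrier) ↔
      ((skeleton P).Adj w u ∧ (w : E3) ∈ f.carrier ∧ (u : E3) ∈ f.carrier) := by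
    rw [(skeleton P).adj_comm u w]; tauto
  simp only [inc, this]

theorem zmod2_add_self (x : ZMod 2) : x + x = 0 := by
  revert x; decide

theorem zmod2_add_eq_zero {x y : ZMod 2} : x + y = 0 ↔ x = y := by
  revert x y; decide

section

variable [Fintype (Face P)]

theorem bd_comm (c : Face P → ZMod 2) (u w : Vertex P) : bd c u w = bd c w u := by
  simp only [bd, inc_comm _ u w]

theorem bd_add (c d : Face P → ZMod 2) (u w : Vertex P) :
    bd (c + d) u w = bd c u w + bd d u w := by
  simp [bd, add_mul, Finset.sum_add_distrib]

theorem bd_sum_smul {ι : Type*} (s : Finset ι) (z : ι → ZMod 2) (c : ι → Face P → ZMod 2)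
    (u w : Vertex P) : bd (∑ i ∈ s, z i • c i) u w = ∑ i ∈ s, z i * bd (c i) u w := by
  simp only [bd, Finset.sum_apply, Pi.smul_apply, smul_eq_mul, Finset.sum_mul, Finset.mul_sum]
  rw [Finset.sum_comm]
  simp only [mul_assoc]

theorem bd_eq_zero_of_not_adj (c : Face P → ZMod 2) {u w : Vertex P}
    (h : ¬ (skeleton P).Adj u w) : bd c u w = 0 := by
  simp [bd, inc, h]

theorem bd_edge (c : Face P → ZMod 2) {u w : Vertex P} (h : (skeleton P).Adj u w) {f g : Face P}
    (hfg : f ≠ g) (hfu : (u : E3) ∈ f.carrier) (hfw : (w : E3) ∈ f.carrier)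
    (hgu : (u : E3) ∈ g.carrier) (hgw : (w : E3) ∈ g.carrier)
    (honly : ∀ k : Face P, (u : E3) ∈ k.carrier → (w : E3) ∈ k.carrier → k = f ∨ k = g) :
    bd c u w = c f + c g := by
  classical
  rw [bd, ← Finset.sum_subset (Finset.subset_univ {f, g}), Finset.sum_pair hfg]
  · simp [inc, h, hfu, hfw, hgu, hgw]
  · intro k _ hk
    simp only [Finset.mem_insert, Finset.mem_singleton] at hk
    rw [inc, if_neg, mul_zero]
    exact fun hc => hk (honly k hc.2.1 hc.2.2)

end

/-- The boundary of a boundary is zero: a face has exactly two edges at each of its vertices and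
none at other vertices. -/
theorem sum_inc (hP : IsConvexPolyhedron P) [Fintype (Vertex P)] (f : Face P) (u : Vertex P) :
    ∑ w, inc f u w = 0 := by
  classical
  by_cases hu : (u : E3) ∈ f.carrier
  · obtain ⟨a, b, hab, hua, hub, ha, hb, -, -, honly⟩ := face_corner hP f hu
    rw [← Finset.sum_subset (Finset.subset_univ {a, b}), Finset.sum_pair hab]
    · simp [inc, hua, hub, hu, ha, hb]; decide
    · intro k _ hk
      simp only [Finset.mem_insert, Finset.mem_singleton] at hk
      rw [inc, if_neg]
      exact fun hc => hk (honly k hc.1 hc.2.2)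
  · simp [inc, hu]

theorem sum_bd (hP : IsConvexPolyhedron P) [Fintype (Face P)] [Fintype (Vertex P)]
    (c : Face P → ZMod 2) (u : Vertex P) : ∑ w, bd c u w = 0 := by
  simp only [bd]
  rw [Finset.sum_comm]
  simp [← Finset.mul_sum, sum_inc hP]

-- The faces along a chain of links form a fan at `v`. Its boundary at `v` telescopes to the first
-- and last edge. Every face of the fan stays below `v`, since it lies in the sector of two
-- descending edges; this keeps the later sweep from disturbing vertices already treated.
open Classical in
theorem exists_chain_of_linked (hP : IsConvexPolyhedron P) [Fintype (Face P)] {v : Vertex P}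
    {h : E3} {a b : Vertex P} (hl : Relation.ReflTransGen (Link v h) a b) :
    ∃ c : Face P → ZMod 2, (∀ f, c f ≠ 0 → ∀ x ∈ f.carrier, inner ℝ h (x - v) ≤ 0) ∧
      ∀ w, bd c v w = (if w = a then 1 else 0) + (if w = b then 1 else 0) := by
  induction hl with
  | refl => exact ⟨0, by simp, fun w => by rw [zmod2_add_self]; simp [bd]⟩
  | @tail b d _ hl ih =>
    obtain ⟨c, hc, hcb⟩ := ih
    obtain ⟨hbd, hvb, hvd, hb, hd, f, hfv, hfb, hfd⟩ := hl
    obtain ⟨p, q, -, -, -, -, -, -, hcone, honly⟩ := face_corner hP f hfv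
    have hp := honly b hvb hfb
    have hq := honly d hvd hfd
    refine ⟨c + Pi.single f 1, fun g hg x hx => ?_, fun w => ?_⟩
    · by_cases hgf : g = f
      · subst hgf
        obtain ⟨α, β, hα, hβ, hxe⟩ := hcone x hx
        rw [hxe, inner_add_right, inner_smul_right, inner_smul_right]
        rcases hp with rfl | rfl <;> rcases hq with rfl | rfl
        · exact absurd rfl hbd
        · nlinarith
        · nlinarith
        · exact absurd rfl hbd
      · exact hc g (by simpa [Pi.single_eq_of_ne hgf] using hg) x hx
    · have hsingle : bd (Pi.single f 1) v w = inc f v w := by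
        rw [bd, Finset.sum_eq_single f]
        · simp
        · intro g _ hg; rw [Pi.single_eq_of_ne hg, zero_mul]
        · simp
      rw [bd_add, hcb, hsingle]
      have hinc : inc f v w = (if w = b then 1 else 0) + (if w = d then 1 else 0) := by
        by_cases hwb : w = b
        · subst hwb; simp [inc, hvb, hfv, hfb, hbd]
        by_cases hwd : w = d
        · subst hwd; simp [inc, hvd, hfv, hfd, hwb]
        rw [inc, if_neg, if_neg hwb, if_neg hwd, add_zero]
        rintro ⟨h1, -, h2⟩
        have hw := honly w h1 h2
        rcases hp with rfl | rfl <;> rcases hq with rfl | rfl <;> rcases hw with rfl | rfl <;>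
          simp_all
      rw [hinc, add_assoc, ← add_assoc (if w = b then (1 : ZMod 2) else 0), zmod2_add_self,
        zero_add]

/-- A functional that separates the vertices. -/
theorem exists_height (hP : IsConvexPolyhedron P) :
    ∃ h : E3, ∀ u v : Vertex P, u ≠ v → inner ℝ h ((u : E3) - v) ≠ 0 := by
  have := hP.finite_vertex
  obtain ⟨l, hl⟩ := Module.exists_dual_forall_apply_ne_zero (K := ℝ)
    (fun p : {p : Vertex P × Vertex P // p.1 ≠ p.2} => (p.1.1 : E3) - p.1.2)
    (fun p => vertex_sub_ne_zero (Ne.symm p.2))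
  refine ⟨(InnerProductSpace.toDual ℝ E3).symm l.toContinuousLinearMap, fun u v huv => ?_⟩
  rw [InnerProductSpace.toDual_symm_apply]
  exact hl ⟨(u, v), huv⟩

/-- Every mod 2 cycle of edges of `P` bounds. -/
theorem exists_bd_eq (hP : IsConvexPolyhedron P) [Fintype (Face P)] [Fintype (Vertex P)]
    (z : Vertex P → Vertex P → ZMod 2) (hsymm : ∀ u w, z u w = z w u)
    (hadj : ∀ u w, z u w ≠ 0 → (skeleton P).Adj u w) (hcyc : ∀ u, ∑ w, z u w = 0) :
    ∃ c : Face P → ZMod 2, ∀ u w, bd c u w = z u w := by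
  classical
  obtain ⟨h, hh⟩ := exists_height hP
  -- The sweep goes downwards. `L` is the set of vertices still to be treated, all lower than the
  -- others, and the cycle is supported on edges inside `L`. Each step removes the top vertex of
  -- `L`.
  suffices H : ∀ (L : Finset (Vertex P)) (z : Vertex P → Vertex P → ZMod 2),
      (∀ u w, z u w = z w u) → (∀ u w, z u w ≠ 0 → (skeleton P).Adj u w) →
      (∀ u, ∑ w, z u w = 0) → (∀ u ∉ L, ∀ w ∈ L, inner ℝ h ((w : E3) - u) < 0) →
      (∀ u ∉ L, ∀ w, z u w = 0) → ∃ c : Face P → ZMod 2, ∀ u w, bd c u w = z u w from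
    H Finset.univ z hsymm hadj hcyc (by simp) (by simp)
  intro L
  induction L using Finset.strongInduction with
  | H L ih =>
  intro z hsymm hadj hcyc hL hz
  rcases L.eq_empty_or_nonempty with rfl | hne
  · exact ⟨0, fun u w => by rw [hz u (by simp)]; simp [bd]⟩
  obtain ⟨v, hvL, hmax⟩ := L.exists_max_image (fun u => inner ℝ h (u : E3)) hne
  have hmax' : ∀ w ∈ L, w ≠ v → inner ℝ h ((w : E3) - v) < 0 := by
    intro w hw hwv
    have h1 := hmax w hw
    have h2 := hh w v hwv
    rw [inner_sub_right] at h2 ⊢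
    exact lt_of_le_of_ne (by linarith) h2
  obtain ⟨c1, hc1, hc1v⟩ : ∃ c : Face P → ZMod 2,
      (∀ f, c f ≠ 0 → ∀ x ∈ f.carrier, inner ℝ h (x - v) ≤ 0) ∧ ∀ w, bd c v w = z v w := by
    by_cases hzv : ∃ a, z v a ≠ 0
    · obtain ⟨a, ha⟩ := hzv
      have hdown : ∀ w, z v w ≠ 0 → (skeleton P).Adj v w ∧ inner ℝ h ((w : E3) - v) < 0 := by
        intro w hw
        refine ⟨hadj v w hw, hmax' w ?_ (hadj v w hw).1.symm⟩
        by_contra hwL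
        exact hw (by rw [hsymm]; exact hz w hwL v)
      have hex : ∀ w, ∃ c : Face P → ZMod 2, z v w ≠ 0 →
          (∀ f, c f ≠ 0 → ∀ x ∈ f.carrier, inner ℝ h (x - v) ≤ 0) ∧
          ∀ x, bd c v x = (if x = a then 1 else 0) + (if x = w then 1 else 0) := by
        intro w
        by_cases hw : z v w = 0
        · exact ⟨0, fun h => absurd hw h⟩
        · obtain ⟨c, hc⟩ := exists_chain_of_linked hP
            (linked hP (hdown a ha).1 (hdown w hw).1 (hdown a ha).2 (hdown w hw).2)
          exact ⟨c, fun _ => hc⟩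
      choose c hc using hex
      -- Each edge of `z` at `v` is joined by a fan to one fixed edge `v a`. The contributions at
      -- `a` cancel because `z` has even degree at `v`, and the other ends reproduce `z v`.
      refine ⟨∑ w, z v w • c w, fun f hf x hx => ?_, fun x => ?_⟩
      · rw [Finset.sum_apply] at hf
        obtain ⟨w, -, hw⟩ := Finset.exists_ne_zero_of_sum_ne_zero hf
        rw [Pi.smul_apply, smul_eq_mul] at hw
        exact (hc w (left_ne_zero_of_mul hw)).1 f (right_ne_zero_of_mul hw) x hx
      · rw [bd_sum_smul]
        have : ∀ w, z v w * bd (c w) v x =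
            z v w * (if x = a then 1 else 0) + (if x = w then z v w else 0) := by
          intro w
          by_cases hw : z v w = 0
          · simp [hw]
          · rw [(hc w hw).2 x, mul_add]; simp
        rw [Finset.sum_congr rfl fun w _ => this w, Finset.sum_add_distrib, ← Finset.sum_mul,
          hcyc v]
        simp
    · push Not at hzv
      exact ⟨0, by simp, fun w => by rw [hzv]; simp [bd]⟩
  -- The faces used lie no higher than `v`, so they contain none of the strictly higher vertices
  -- outside `L`.
  have htop : ∀ u ∉ L, ∀ w, bd c1 u w = 0 := by
    intro u hu w
    refine Finset.sum_eq_zero fun f _ => ?_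
    by_cases hf : c1 f = 0
    · rw [hf, zero_mul]
    rw [inc, if_neg, mul_zero]
    rintro ⟨-, hfu, -⟩
    have h1 := hc1 f hf u hfu
    have h2 := hL u hu v hvL
    rw [inner_sub_right] at h1 h2
    linarith
  obtain ⟨c2, hc2⟩ := ih (L.erase v) (Finset.erase_ssubset hvL) (fun u w => z u w + bd c1 u w)
    (fun u w => by rw [hsymm, bd_comm]) (fun u w huw => by
      by_contra hna
      apply huw
      rw [bd_eq_zero_of_not_adj c1 hna, add_zero]
      by_contra h0
      exact hna (hadj u w h0))
    (fun u => by rw [Finset.sum_add_distrib, hcyc, sum_bd hP, add_zero])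
    (fun u hu w hw => by
      rw [Finset.mem_erase] at hw
      by_cases huv : u = v
      · rw [huv]; exact hmax' w hw.2 hw.1
      · exact hL u (fun h => hu (Finset.mem_erase.2 ⟨huv, h⟩)) w hw.2)
    (fun u hu w => by
      by_cases huv : u = v
      · rw [huv, hc1v, zmod2_add_self]
      · have : u ∉ L := fun h => hu (Finset.mem_erase.2 ⟨huv, h⟩)
        rw [hz u this, htop u this, add_zero])
  refine ⟨c1 + c2, fun u w => ?_⟩
  rw [bd_add, hc2, add_comm (z u w), ← add_assoc, zmod2_add_self, zero_add]

end Polyhedron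

end

/-! ### Chains without boundary, forests, and separation of the surface -/

section

namespace Polyhedron

variable {P : Set E3}

/-- Faces with a common vertex get the same value under a chain without boundary. -/
theorem eq_of_bd_eq_zero_at (hP : IsConvexPolyhedron P) [Fintype (Face P)] {c : Face P → ZMod 2}
    (hc : ∀ u w, bd c u w = 0) (v : Vertex P) {f g : Face P} (hf : (v : E3) ∈ f.carrier)
    (hg : (v : E3) ∈ g.carrier) : c f = c g := by
  have hedge : ∀ {a : Vertex P} {f g : Face P}, (skeleton P).Adj v a → (v : E3) ∈ f.carrier →
      (a : E3) ∈ f.carrier → (v : E3) ∈ g.carrier → (a : E3) ∈ g.carrier → c f = c g := by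
    intro a f g hva hfv hfa hgv hga
    by_cases hfg : f = g
    · rw [hfg]
    obtain ⟨k, l, hkl, hk, hl, honly, -⟩ := edge_faces hP hva
    have honly' : ∀ m : Face P, (v : E3) ∈ m.carrier → (a : E3) ∈ m.carrier → m = f ∨ m = g := by
      intro m hmv hma
      have h1 := honly m (m.segment_subset hP hmv hma)
      have h2 := honly f (f.segment_subset hP hfv hfa)
      have h3 := honly g (g.segment_subset hP hgv hga)
      grind
    have := hc v a
    rw [bd_edge c hva hfg hfv hfa hgv hga honly'] at this
    exact zmod2_add_eq_zero.1 this
  -- For the height `-η` every edge at `v` is descending, so `linked` runs through all faces around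
  -- `v`.
  obtain ⟨η, hη⟩ := exists_exposing hP v
  obtain ⟨a, -, -, hva, -, hfa, -⟩ := face_corner hP f hf
  obtain ⟨b, -, -, hvb, -, hgb, -⟩ := face_corner hP g hg
  have hdown : ∀ w : Vertex P, (skeleton P).Adj v w → inner ℝ (-η) ((w : E3) - v) < 0 := by
    intro w hw
    rw [inner_neg_left]
    linarith [hη w w.2.1 fun h => hw.1 (Subtype.ext h.symm)]
  have hl := linked hP hva hvb (hdown a hva) (hdown b hvb)
  have key : ∀ d : Vertex P, Relation.ReflTransGen (Link v (-η)) a d →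
      ∀ k : Face P, (v : E3) ∈ k.carrier → (d : E3) ∈ k.carrier → c f = c k := by
    intro d hd
    induction hd with
    | refl => intro k hkv hka; exact hedge hva hf hfa hkv hka
    | tail _ hl ih =>
      obtain ⟨-, h1, h2, -, -, m, hmv, hma, hmb⟩ := hl
      intro k hkv hkb
      rw [ih m hmv hma]
      exact hedge h2 hmv hmb hkv hkb
  exact key b hl g hg hgb

/-- Every face has a vertex. -/
theorem Face.exists_vertex (hP : IsConvexPolyhedron P) (f : Face P) :
    ∃ v : Vertex P, (v : E3) ∈ f.carrier := by
  by_contra hcon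
  push Not at hcon
  have hs : f.carrier = convexHull ℝ (f.carrier ∩ P.extremePoints ℝ) :=
    support_eq_convexHull hP f.normal
  have : f.carrier ∩ P.extremePoints ℝ = ∅ := by
    ext x
    simp only [Set.mem_inter_iff, Set.mem_empty_iff_false, iff_false, not_and]
    exact fun hx hxe => hcon ⟨x, hxe⟩ hx
  rw [this, convexHull_empty] at hs
  exact f.not_collinear 0 0 fun x hx => by rw [hs] at hx; exact hx.elim

theorem exists_face_of_adj (hP : IsConvexPolyhedron P) {u v : Vertex P}
    (h : (skeleton P).Adj u v) : ∃ f : Face P, (u : E3) ∈ f.carrier ∧ (v : E3) ∈ f.carrier := by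
  obtain ⟨f, -, -, hf, -⟩ := edge_faces hP h
  exact ⟨f, (f.edge_subset_iff hP).1 hf⟩

/-- The surface of `P` is connected: a chain of faces without boundary is constant. -/
theorem eq_of_bd_eq_zero (hP : IsConvexPolyhedron P) [Fintype (Face P)]
    (hconn : (skeleton P).Preconnected) {c : Face P → ZMod 2} (hc : ∀ u w, bd c u w = 0)
    (f g : Face P) : c f = c g := by
  obtain ⟨u, hu⟩ := f.exists_vertex hP
  obtain ⟨w, hw⟩ := g.exists_vertex hP
  obtain ⟨p⟩ := hconn u w
  induction p generalizing f with
  | nil => exact eq_of_bd_eq_zero_at hP hc _ hu hw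
  | cons h p ih =>
    obtain ⟨k, hk1, hk2⟩ := exists_face_of_adj hP h
    rw [eq_of_bd_eq_zero_at hP hc _ hu hk1]
    exact ih k hk2 hw

end Polyhedron

section Graph

open Polyhedron

variable {V : Type*} [Fintype V]

open Classical in
/-- The mod 2 chain of a single edge. -/
noncomputable def edgeChain (a b u w : V) : ZMod 2 :=
  if s(u, w) = s(a, b) then 1 else 0

open Classical in
theorem sum_edgeChain {a b : V} (hab : a ≠ b) (u : V) :
    ∑ w, edgeChain a b u w = (if u = a then 1 else 0) + (if u = b then 1 else 0) := by
  by_cases hua : u = a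
  · subst hua
    rw [Finset.sum_eq_single b]
    · simp [edgeChain, hab]
    · intro w _ hw; simp [edgeChain, hab]; exact hw
    · simp
  by_cases hub : u = b
  · subst hub
    rw [Finset.sum_eq_single a]
    · simp [edgeChain, hua, Sym2.eq_swap]
    · intro w _ hw; simp [edgeChain, hua]; exact hw
    · simp
  simp [edgeChain, hua, hub]

open Classical in
/-- A path in `T` gives a mod 2 chain with boundary its two ends. -/
theorem exists_pathChain {T : SimpleGraph V} {a b : V} (h : T.Reachable a b) :
    ∃ z : V → V → ZMod 2, (∀ u w, z u w = z w u) ∧ (∀ u w, z u w ≠ 0 → T.Adj u w) ∧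
      ∀ u, ∑ w, z u w = (if u = a then 1 else 0) + (if u = b then 1 else 0) := by
  obtain ⟨p⟩ := h
  induction p with
  | nil => exact ⟨0, by simp, by simp, fun u => by rw [zmod2_add_self]; simp⟩
  | @cons a c b h p ih =>
    obtain ⟨z, h1, h2, h3⟩ := ih
    refine ⟨fun u w => edgeChain a c u w + z u w, fun u w => ?_, fun u w huw => ?_, fun u => ?_⟩
    · change edgeChain a c u w + z u w = edgeChain a c w u + z w u
      rw [h1 u w, edgeChain, edgeChain, Sym2.eq_swap]
    · by_cases he : s(u, w) = s(a, c)
      · rwa [← SimpleGraph.mem_edgeSet, he, SimpleGraph.mem_edgeSet]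
      · apply h2
        simpa [edgeChain, he] using huw
    · rw [Finset.sum_add_distrib, sum_edgeChain h.ne, h3, add_assoc,
        ← add_assoc (if u = c then (1 : ZMod 2) else 0), zmod2_add_self, zero_add]

/-- A mod 2 cycle in a forest vanishes. -/
theorem eq_zero_of_isAcyclic {T : SimpleGraph V} (hT : T.IsAcyclic) {z : V → V → ZMod 2}
    (hsymm : ∀ u w, z u w = z w u) (hadj : ∀ u w, z u w ≠ 0 → T.Adj u w)
    (hcyc : ∀ u, ∑ w, z u w = 0) (u w : V) : z u w = 0 := by
  classical
  by_contra hne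
  have huw := hadj u w hne
  have hb := SimpleGraph.isAcyclic_iff_forall_adj_isBridge.1 hT huw
  rw [SimpleGraph.isBridge_iff] at hb
  set G := T.deleteEdges {s(u, w)} with hG
  -- `W` is the side of the bridge `u w` that contains `u`. Summing the cycle condition over `W`,
  -- the edges inside `W` cancel in pairs, and `u w` is the only edge leaving `W`.
  set W : Finset V := Finset.univ.filter fun x => G.Reachable u x with hW
  have huW : u ∈ W := by simp [hW]
  have hwW : w ∉ W := by simpa [hW] using hb
  have h0 : ∑ x ∈ W, ∑ y, z x y = 0 := Finset.sum_eq_zero fun x _ => hcyc x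
  have hsplit : ∀ x, ∑ y, z x y = ∑ y ∈ W, z x y + ∑ y ∈ Wᶜ, z x y := fun x =>
    (Finset.sum_add_sum_compl W _).symm
  simp only [hsplit, Finset.sum_add_distrib] at h0
  have h1 : ∑ x ∈ W, ∑ y ∈ W, z x y = 0 := by
    rw [← Finset.sum_product']
    refine Finset.sum_involution (fun p _ => p.swap) ?_ ?_ ?_ ?_
    · intro p _
      simp only [Prod.fst_swap, Prod.snd_swap]
      rw [hsymm p.2 p.1, zmod2_add_self]
    · intro p _ hp heq
      have : p.1 = p.2 := (congrArg Prod.snd heq)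
      exact (hadj _ _ hp).ne this
    · intro p hp
      simp only [Finset.mem_product] at hp ⊢
      exact ⟨hp.2, hp.1⟩
    · intro p _; simp
  have hcross : ∀ x ∈ W, ∀ y ∉ W, z x y ≠ 0 → x = u ∧ y = w := by
    intro x hx y hy hxy
    by_cases he : s(x, y) = s(u, w)
    · rcases Sym2.eq_iff.1 he with h | h
      · exact h
      · rw [h.1] at hx; exact absurd hx hwW
    · exfalso
      apply hy
      simp only [hW, Finset.mem_filter, Finset.mem_univ, true_and] at hx ⊢
      refine hx.trans (SimpleGraph.Adj.reachable ?_)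
      rw [hG, SimpleGraph.deleteEdges_adj]
      exact ⟨hadj x y hxy, fun h => he h⟩
  have h2 : ∑ x ∈ W, ∑ y ∈ Wᶜ, z x y = z u w := by
    rw [Finset.sum_eq_single u, Finset.sum_eq_single w]
    · intro y hy hyw
      by_contra hne
      exact hyw (hcross u huW y (by simpa using hy) hne).2
    · intro h; simp [hwW] at h
    · intro x hx hxu
      refine Finset.sum_eq_zero fun y hy => ?_
      by_contra hne
      exact hxu (hcross x hx y (by simpa using hy) hne).1
    · intro h; exact absurd huW h
  rw [h1, h2, zero_add] at h0
  exact hne h0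

end Graph

namespace Polyhedron

variable {P : Set E3}

/-- Cutting the surface along a spanning connected set of edges and one more edge `ab` separates
the two sides of `ab`. -/
theorem exists_separating (hP : IsConvexPolyhedron P) [Fintype (Face P)] [Fintype (Vertex P)]
    {T : SimpleGraph (Vertex P)} (hT : T ≤ skeleton P) (hconn : T.Preconnected) {a b : Vertex P}
    (hab : (skeleton P).Adj a b) (habT : ¬ T.Adj a b) :
    ∃ c : Face P → ZMod 2, bd c a b = 1 ∧
      ∀ u w, ¬ T.Adj u w → s(u, w) ≠ s(a, b) → bd c u w = 0 := by
  classical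
  -- The edge `a b`, closed up by a path in `T`, is a cycle. A chain of faces bounding it is one
  -- side of that closed curve.
  obtain ⟨z, h1, h2, h3⟩ := exists_pathChain (hconn a b)
  have hz : ∀ u w, ¬ T.Adj u w → z u w = 0 := fun u w h => by
    by_contra h0; exact h (h2 u w h0)
  obtain ⟨c, hc⟩ := exists_bd_eq hP (fun u w => edgeChain a b u w + z u w)
    (fun u w => by rw [h1 u w, edgeChain, edgeChain, Sym2.eq_swap])
    (fun u w huw => by
      by_cases he : s(u, w) = s(a, b)
      · rwa [← SimpleGraph.mem_edgeSet, he, SimpleGraph.mem_edgeSet]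
      · apply hT
        apply h2
        simpa [edgeChain, he] using huw)
    (fun u => by rw [Finset.sum_add_distrib, sum_edgeChain hab.ne, h3, zmod2_add_self])
  refine ⟨c, ?_, fun u w huw he => ?_⟩
  · rw [hc, hz a b habT]; simp [edgeChain]
  · rw [hc, hz u w huw]; simp [edgeChain, he]

end Polyhedron

end

/-! ### Angles of faces, and angle sums in the plane -/

section

namespace Polyhedron

open InnerProductGeometry

section Angle

variable {E : Type*} [NormedAddCommGroup E] [InnerProductSpace ℝ E]

theorem angle_add_of_cone {x y z : E} (hy : y ≠ 0) {p q : ℝ} (hp : 0 ≤ p) (hq : 0 ≤ q)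
    (h : y = p • x + q • z) : angle x z = angle x y + angle y z := by
  apply angle_eq_angle_add_add_angle_add_of_mem_span hy
  rw [Submodule.mem_span_pair]
  exact ⟨⟨p, hp⟩, ⟨q, hq⟩, h.symm⟩

/-- Two vectors in the cone over `a, b` make at most the angle between `a` and `b`. -/
theorem angle_le_of_cone {a b x y : E} (hx : x ≠ 0) (hy : y ≠ 0) {α β γ δ : ℝ} (hα : 0 ≤ α)
    (hβ : 0 ≤ β) (hγ : 0 ≤ γ) (hδ : 0 ≤ δ) (hxe : x = α • a + β • b) (hye : y = γ • a + δ • b) :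
    angle x y ≤ angle a b := by
  -- The inequality says that, turning from `a` to `b`, one meets `x` no later than `y`. Then the
  -- angle from `a` to `b` splits additively at `x` and at `y`.
  wlog h : β * γ ≤ α * δ generalizing x y α β γ δ
  · rw [angle_comm]
    exact this hy hx hγ hδ hα hβ hye hxe (by nlinarith)
  have h1 := angle_add_of_cone hx hα hβ hxe
  have h2 : angle x b = angle x y + angle y b := by
    rcases hα.eq_or_lt with h0 | h0
    · subst h0
      have hβ0 : 0 < β := by
        refine lt_of_le_of_ne hβ fun h0 => hx ?_
        rw [hxe, ← h0]; simp
      have hγ0 : γ = 0 := by nlinarith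
      refine angle_add_of_cone hy le_rfl hδ ?_
      rw [hye, hγ0]; simp
    · refine angle_add_of_cone hy (div_nonneg hγ hα) (q := (α * δ - β * γ) / α)
        (div_nonneg (by linarith) hα) ?_
      rw [hye, hxe, smul_add, smul_smul, smul_smul, add_assoc, ← add_smul]
      congr 2
      · field_simp
      · field_simp; ring
  linarith [angle_nonneg a x, angle_nonneg y b]

end Angle

variable {P : Set E3}

theorem Face.angle_nonneg (f : Face P) (v : Vertex P) : 0 ≤ f.angle v := by
  apply Real.sSup_nonneg
  rintro θ ⟨a, b, -, -, -, -, rfl⟩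
  exact EuclideanGeometry.angle_nonneg _ _ _

theorem Face.angle_eq (hP : IsConvexPolyhedron P) (f : Face P) {v a b : Vertex P}
    (hv : (v : E3) ∈ f.carrier) (ha : (a : E3) ∈ f.carrier) (hb : (b : E3) ∈ f.carrier)
    (hva : (skeleton P).Adj v a) (hvb : (skeleton P).Adj v b) (hab : a ≠ b) :
    f.angle v = EuclideanGeometry.angle (a : E3) v b := by
  obtain ⟨p, q, -, -, -, -, -, -, -, honly⟩ := face_corner hP f hv
  have h1 := honly a hva ha
  have h2 := honly b hvb hb
  apply IsGreatest.csSup_eq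
  refine ⟨⟨a, b, hva, hvb, f.segment_subset hP hv ha, f.segment_subset hP hv hb, rfl⟩, ?_⟩
  rintro θ ⟨c, d, hvc, hvd, hc, hd, rfl⟩
  have h3 := honly c hvc (hc (right_mem_segment ℝ _ _))
  have h4 := honly d hvd (hd (right_mem_segment ℝ _ _))
  have h0 : ∀ x : Vertex P, (skeleton P).Adj v x →
      EuclideanGeometry.angle (x : E3) v x ≤ EuclideanGeometry.angle (a : E3) v b := by
    intro x hx
    rw [EuclideanGeometry.angle_self_of_ne fun h => hx.1 (Subtype.ext h.symm)]
    exact EuclideanGeometry.angle_nonneg _ _ _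
  by_cases hcd : c = d
  · subst hcd; exact h0 c hvc
  have : (c = a ∧ d = b) ∨ (c = b ∧ d = a) := by grind
  rcases this with ⟨rfl, rfl⟩ | ⟨rfl, rfl⟩
  · exact le_rfl
  · rw [EuclideanGeometry.angle_comm]

theorem Face.angle_le (hP : IsConvexPolyhedron P) (f : Face P) {v : Vertex P}
    (hv : (v : E3) ∈ f.carrier) {x y : E3} (hx : x ∈ f.carrier) (hy : y ∈ f.carrier)
    (hxv : x ≠ v) (hyv : y ≠ v) : EuclideanGeometry.angle x v y ≤ f.angle v := by
  obtain ⟨a, b, hab, hva, hvb, ha, hb, -, hcone, -⟩ := face_corner hP f hv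
  rw [f.angle_eq hP hv ha hb hva hvb hab]
  obtain ⟨α, β, hα, hβ, hxe⟩ := hcone x hx
  obtain ⟨γ, δ, hγ, hδ, hye⟩ := hcone y hy
  exact angle_le_of_cone (sub_ne_zero.2 hxv) (sub_ne_zero.2 hyv) hα hβ hγ hδ hxe hye

theorem Face.angle_pos (hP : IsConvexPolyhedron P) (f : Face P) {v : Vertex P}
    (hv : (v : E3) ∈ f.carrier) : 0 < f.angle v := by
  obtain ⟨a, b, hab, hva, hvb, ha, hb, hli, -, -⟩ := face_corner hP f hv
  rw [f.angle_eq hP hv ha hb hva hvb hab]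
  refine lt_of_le_of_ne (EuclideanGeometry.angle_nonneg _ _ _) fun h => ?_
  obtain ⟨-, r, -, hr⟩ := angle_eq_zero_iff.1 h.symm
  exact (LinearIndependent.pair_iff' (adj_sub_ne_zero hva)).1 hli r hr.symm

theorem Face.angle_lt_pi (hP : IsConvexPolyhedron P) (f : Face P) {v : Vertex P}
    (hv : (v : E3) ∈ f.carrier) : f.angle v < Real.pi := by
  obtain ⟨a, b, hab, hva, hvb, ha, hb, hli, -, -⟩ := face_corner hP f hv
  rw [f.angle_eq hP hv ha hb hva hvb hab]
  refine lt_of_le_of_ne (EuclideanGeometry.angle_le_pi _ _ _) fun h => ?_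
  obtain ⟨-, r, -, hr⟩ := angle_eq_pi_iff.1 h
  exact (LinearIndependent.pair_iff' (adj_sub_ne_zero hva)).1 hli r hr.symm

/-- A unit vector `p` in the plane orthogonal to `n` extends to an orthonormal frame of it. -/
theorem exists_frame {n p : E3} (hn : n ≠ 0) (hp : ‖p‖ = 1) (hnp : inner ℝ n p = 0) :
    ∃ q : E3, ‖q‖ = 1 ∧ inner ℝ n q = 0 ∧ inner ℝ p q = 0 ∧
      ∀ x : E3, inner ℝ n x = 0 → x = inner ℝ p x • p + inner ℝ q x • q := by
  have hp0 : p ≠ 0 := by rintro rfl; simp at hp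
  obtain ⟨q, hq, hqn, hqp, hdet⟩ := exists_unit_normal n p
    (linearIndependent_pair_of_inner_eq_zero hn hp0 hnp)
  refine ⟨q, hq, by rwa [real_inner_comm], by rwa [real_inner_comm], fun x hx => ?_⟩
  rw [← sub_eq_zero]
  apply hdet
  · rw [inner_sub_right, inner_add_right, inner_smul_right, inner_smul_right, hx, hnp,
      real_inner_comm q n, hqn]; simp
  · rw [inner_sub_right, inner_add_right, inner_smul_right, inner_smul_right,
      real_inner_self_eq_norm_sq, hp, real_inner_comm q p, hqp]; simp
  · rw [inner_sub_right, inner_add_right, inner_smul_right, inner_smul_right,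
      real_inner_self_eq_norm_sq, hq, hqp]; simp

theorem exists_unit_orthogonal {n : E3} (hn : n ≠ 0) : ∃ p : E3, ‖p‖ = 1 ∧ inner ℝ n p = 0 := by
  have h2 := finrank_orthogonal_singleton hn
  have : Nontrivial (ℝ ∙ n)ᗮ := Module.nontrivial_of_finrank_pos (R := ℝ) (by omega)
  obtain ⟨q, hq⟩ := exists_ne (0 : (ℝ ∙ n)ᗮ)
  have hq0 : (q : E3) ≠ 0 := fun h => hq (Subtype.ext h)
  refine ⟨‖(q : E3)‖⁻¹ • (q : E3), ?_, ?_⟩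
  · rw [norm_smul, norm_inv, norm_norm, inv_mul_cancel₀ (norm_ne_zero_iff.2 hq0)]
  · rw [inner_smul_right, Submodule.mem_orthogonal_singleton_iff_inner_right.1 q.2, mul_zero]

/-- The cross product of complex numbers. -/
def cross (z w : ℂ) : ℝ := z.re * w.im - z.im * w.re

/-- A counterclockwise turn by `d < π` raises `Complex.arg` by `d`, unless it passes the branch cut,
where 2π is lost. This makes sums of turns telescope up to the number of passages. -/
theorem arg_of_cross_pos {z w : ℂ} (h : 0 < cross z w) :
    ∃ d : ℝ, 0 < d ∧ d < Real.pi ∧ angle z w = d ∧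
      (w.arg - z.arg = d ∨ w.arg - z.arg = d - 2 * Real.pi) := by
  have hz : z ≠ 0 := by rintro rfl; simp [cross] at h
  have hw : w ≠ 0 := by rintro rfl; simp [cross] at h
  have him : 0 < (w / z).im := by
    rw [Complex.div_im, ← sub_div]
    have := Complex.normSq_pos.2 hz
    apply div_pos _ this
    unfold cross at h
    linarith
  have hd0 : 0 < (w / z).arg := by
    refine lt_of_le_of_ne (Complex.arg_nonneg_iff.2 him.le) fun h0 => ?_
    have := (Complex.arg_eq_zero_iff.1 h0.symm).2
    linarith
  have hdpi : (w / z).arg < Real.pi := by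
    refine lt_of_le_of_ne (Complex.arg_le_pi _) fun h0 => ?_
    have := (Complex.arg_eq_pi_iff.1 h0).2
    linarith
  refine ⟨(w / z).arg, hd0, hdpi, ?_, ?_⟩
  · rw [angle_comm, Complex.angle_eq_abs_arg hw hz, abs_of_pos hd0]
  · have hmod := Complex.arg_div_coe_angle hw hz
    rw [← Real.Angle.coe_sub, eq_comm, Real.Angle.angle_eq_iff_two_pi_dvd_sub] at hmod
    obtain ⟨k, hk⟩ := hmod
    have h1 := Complex.arg_le_pi w
    have h2 := Complex.neg_pi_lt_arg w
    have h3 := Complex.arg_le_pi z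
    have h4 := Complex.neg_pi_lt_arg z
    have hpi := Real.pi_pos
    have hk1 : (-2 : ℝ) < k := by nlinarith
    have hk2 : (k : ℝ) < 1 := by nlinarith
    have hk1' : -2 < k := by exact_mod_cast hk1
    have hk2' : k < 1 := by exact_mod_cast hk2
    have : k = 0 ∨ k = -1 := by omega
    rcases this with rfl | rfl
    · left; simp at hk; linarith
    · right; simp at hk; linarith

theorem crossing_of_wrap {z w : ℂ} (h : 0 < cross z w) (hw : w.arg < z.arg) :
    0 ≤ z.im ∧ w.im < 0 := by
  obtain ⟨d, hd0, hd, -, h1 | h1⟩ := arg_of_cross_pos h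
  · linarith
  · have h2 := Complex.arg_le_pi z
    have h3 := Complex.neg_pi_lt_arg w
    exact ⟨Complex.arg_nonneg_iff.1 (by linarith), Complex.arg_neg_iff.1 (by linarith)⟩

/-- The angles subtended at the origin by a positively oriented cycle of segments of which at most
one crosses the cut of `Complex.arg` sum to at most `2π`. -/
theorem sum_angle_le_two_pi {F E : Type*} [Fintype F] [Fintype E] (o i : F ≃ E) (ζ : E → ℂ)
    (hpos : ∀ f, 0 < cross (ζ (o f)) (ζ (i f)))
    (hwrap : ∀ f g, (ζ (i f)).arg < (ζ (o f)).arg → (ζ (i g)).arg < (ζ (o g)).arg → f = g) :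
    ∑ f, angle (ζ (o f)) (ζ (i f)) ≤ 2 * Real.pi := by
  classical
  have h1 : ∀ f, angle (ζ (o f)) (ζ (i f)) = (ζ (i f)).arg - (ζ (o f)).arg +
      (if (ζ (i f)).arg < (ζ (o f)).arg then 2 * Real.pi else 0) := by
    intro f
    obtain ⟨d, hd0, hd, hang, h1 | h1⟩ := arg_of_cross_pos (hpos f)
    · rw [hang, if_neg (by linarith), ← h1, add_zero]
    · rw [hang, if_pos (by linarith [Real.pi_pos]), h1]; ring
  -- Every index is the start of exactly one segment and the end of exactly one, so the differences
  -- of arguments cancel; only the corrections of 2π remain.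
  have h2 : ∑ f, ((ζ (i f)).arg - (ζ (o f)).arg) = 0 := by
    rw [Finset.sum_sub_distrib, Equiv.sum_comp i fun a => (ζ a).arg,
      Equiv.sum_comp o fun a => (ζ a).arg, sub_self]
  rw [Finset.sum_congr rfl fun f _ => h1 f, Finset.sum_add_distrib, h2, zero_add,
    ← Finset.sum_filter, Finset.sum_const, nsmul_eq_mul]
  have hcard : (Finset.univ.filter fun f => (ζ (i f)).arg < (ζ (o f)).arg).card ≤ 1 := by
    rw [Finset.card_le_one]
    intro f hf g hg
    simp only [Finset.mem_filter, Finset.mem_univ, true_and] at hf hg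
    exact hwrap f g hf hg
  have : ((Finset.univ.filter fun f => (ζ (i f)).arg < (ζ (o f)).arg).card : ℝ) ≤ 1 := by
    exact_mod_cast hcard
  nlinarith [Real.pi_pos]

/-- Comparison of the angles at the apex of a pyramid with those at a point `ω` of its base. -/
theorem sum_angle_lt_of_pyramid {V F E : Type*} [NormedAddCommGroup V] [InnerProductSpace ℝ V]
    [Fintype F] [Fintype E] [Nonempty E] (o i : F ≃ E) (β : E → V) (ω : V)
    (h0 : ∀ a, β a ≠ 0) (hω : ∀ a, β a ≠ ω)
    (hlt : ∀ a, angle (ω - β a) (β (i (o.symm a)) - β a) +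
        angle (ω - β a) (β (o (i.symm a)) - β a) <
      angle (-β a) (β (i (o.symm a)) - β a) + angle (-β a) (β (o (i.symm a)) - β a)) :
    ∑ f, angle (β (o f)) (β (i f)) < ∑ f, angle (β (o f) - ω) (β (i f) - ω) := by
  have hs := Finset.sum_lt_sum_of_nonempty (s := Finset.univ) Finset.univ_nonempty
    fun a _ => hlt a
  -- The base angles are regrouped from base vertices to side triangles. The angle sum π of each
  -- triangle then converts the inequality between base angles into the opposite one between the
  -- angles at the apex `0` and at `ω`.
  have hre : ∀ D : V → V → V → ℝ, ∑ a, (D ω (β a) (β (i (o.symm a))) + D ω (β a) (β (o (i.symm a))))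
      = ∑ f, (D ω (β (o f)) (β (i f)) + D ω (β (i f)) (β (o f))) := by
    intro D
    rw [Finset.sum_add_distrib, Finset.sum_add_distrib,
      ← Equiv.sum_comp o fun a => D ω (β a) (β (i (o.symm a))),
      ← Equiv.sum_comp i fun a => D ω (β a) (β (o (i.symm a)))]
    simp
  rw [hre fun w x y => angle (w - x) (y - x), hre fun _ x y => angle (-x) (y - x)] at hs
  have tri : ∀ (w x y : V), x ≠ w → angle (w - x) (y - x) + angle (w - y) (x - y) =
      Real.pi - angle (x - w) (y - w) := by
    intro w x y hxw
    have := EuclideanGeometry.angle_add_angle_add_angle_eq_pi (p₁ := w) (p₂ := x) y hxw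
    unfold EuclideanGeometry.angle at this
    simp only [vsub_eq_sub] at this
    rw [angle_comm (x - y), angle_comm (y - w)] at this
    linarith
  have t1 : ∀ f, angle (ω - β (o f)) (β (i f) - β (o f)) + angle (ω - β (i f)) (β (o f) - β (i f)) =
      Real.pi - angle (β (o f) - ω) (β (i f) - ω) := fun f => tri _ _ _ (hω _)
  have t2 : ∀ f, angle (-β (o f)) (β (i f) - β (o f)) + angle (-β (i f)) (β (o f) - β (i f)) =
      Real.pi - angle (β (o f)) (β (i f)) := fun f => by
    have := tri 0 (β (o f)) (β (i f)) (h0 _)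
    simpa using this
  rw [Finset.sum_congr rfl fun f _ => t1 f, Finset.sum_congr rfl fun f _ => t2 f,
    Finset.sum_sub_distrib, Finset.sum_sub_distrib] at hs
  linarith

end Polyhedron

end

/-! ### The surface angle at a vertex is less than 2π -/

section

namespace Polyhedron

open InnerProductGeometry

variable {P : Set E3}

/-- Planar coordinates with respect to a pair of vectors. -/
noncomputable def planeCoord (p q x : E3) : ℂ := ⟨inner ℝ p x, inner ℝ q x⟩

theorem planeCoord_sub (p q x y : E3) :
    planeCoord p q (x - y) = planeCoord p q x - planeCoord p q y := by
  apply Complex.ext <;> simp [planeCoord, inner_sub_right]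

theorem planeCoord_add (p q x y : E3) :
    planeCoord p q (x + y) = planeCoord p q x + planeCoord p q y := by
  apply Complex.ext <;> simp [planeCoord, inner_add_right]

theorem planeCoord_smul (p q x : E3) (r : ℝ) :
    planeCoord p q (r • x) = (r : ℂ) * planeCoord p q x := by
  apply Complex.ext <;> simp [planeCoord, inner_smul_right]

theorem angle_planeCoord {η p q : E3}
    (hfr : ∀ x : E3, inner ℝ η x = 0 → x = inner ℝ p x • p + inner ℝ q x • q) {x y : E3}
    (hx : inner ℝ η x = 0) (hy : inner ℝ η y = 0) :
    angle (planeCoord p q x) (planeCoord p q y) = angle x y := by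
  have hin : ∀ x y : E3, inner ℝ η x = 0 → inner ℝ η y = 0 →
      inner ℝ (planeCoord p q x) (planeCoord p q y) = inner ℝ x y := by
    intro x y hx _
    conv_rhs => rw [hfr x hx]
    rw [inner_add_left, inner_smul_left, inner_smul_left, Complex.inner]
    simp [planeCoord]
    ring
  have hno : ∀ x : E3, inner ℝ η x = 0 → ‖planeCoord p q x‖ = ‖x‖ := by
    intro x hx
    rw [← sq_eq_sq₀ (norm_nonneg _) (norm_nonneg _), ← real_inner_self_eq_norm_sq,
      ← real_inner_self_eq_norm_sq, hin x x hx hx]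
  unfold angle
  rw [hin x y hx hy, hno x hx, hno y hy]

theorem exists_smul_of_cross_eq_zero {η p q : E3}
    (hfr : ∀ x : E3, inner ℝ η x = 0 → x = inner ℝ p x • p + inner ℝ q x • q) {x y : E3}
    (hx : inner ℝ η x = 0) (hy : inner ℝ η y = 0) (hx0 : x ≠ 0)
    (hc : cross (planeCoord p q x) (planeCoord p q y) = 0) : ∃ s : ℝ, y = s • x := by
  simp only [cross, planeCoord] at hc
  by_cases h1 : inner ℝ p x = 0
  · have h2 : inner ℝ q x ≠ 0 := by
      intro h2
      apply hx0
      rw [hfr x hx, h1, h2]; simp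
    refine ⟨inner ℝ q y / inner ℝ q x, ?_⟩
    rw [h1, zero_mul, zero_sub, neg_eq_zero] at hc
    have h3 : inner ℝ p y = 0 := (mul_eq_zero.1 hc).resolve_left h2
    have hx' := hfr x hx
    have hy' := hfr y hy
    rw [h1, zero_smul, zero_add] at hx'
    rw [h3, zero_smul, zero_add] at hy'
    calc y = inner ℝ q y • q := hy'
      _ = (inner ℝ q y / inner ℝ q x) • (inner ℝ q x • q) := by
        rw [smul_smul, div_mul_cancel₀ _ h2]
      _ = (inner ℝ q y / inner ℝ q x) • x := by rw [← hx']
  · refine ⟨inner ℝ p y / inner ℝ p x, ?_⟩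
    have h3 : inner ℝ q y = inner ℝ p y / inner ℝ p x * inner ℝ q x := by
      field_simp; linarith
    calc y = inner ℝ p y • p + inner ℝ q y • q := hfr y hy
      _ = (inner ℝ p y / inner ℝ p x) • (inner ℝ p x • p + inner ℝ q x • q) := by
        rw [smul_add, smul_smul, smul_smul, div_mul_cancel₀ _ h1, ← h3]
      _ = (inner ℝ p y / inner ℝ p x) • x := by rw [← hfr x hx]

theorem pair_eq_of_mem {α : Type*} {a b c d : α} (hab : a ≠ b) (ha : a = c ∨ a = d)
    (hb : b = c ∨ b = d) : (c = a ∧ d = b) ∨ (c = b ∧ d = a) := by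
  grind

/-- The surface angle at a vertex of a flat polygon is less than `2π`. -/
theorem sum_angle_lt_of_flat (hP : IsConvexPolyhedron P) (v : Vertex P)
    [Fintype {g : Face P // (v : E3) ∈ g.carrier}] {f : Face P} (hf : (v : E3) ∈ f.carrier)
    (hflat : ∀ w : Vertex P, (skeleton P).Adj v w → (w : E3) ∈ f.carrier) :
    ∑ g : {g : Face P // (v : E3) ∈ g.carrier}, g.1.angle v < 2 * Real.pi := by
  classical
  obtain ⟨a, b, hab, hva, hvb, ha, hb, -, -, honly⟩ := face_corner hP f hf
  obtain ⟨k, l, hkl, hk, hl, hkl', -⟩ := edge_faces hP hva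
  -- All edges at `v` lie in `f`, so there are only two, and every face at `v` contains both. Hence
  -- only the two faces at the edge `v a` occur, each with angle below π.
  have hmem : ∀ g : Face P, (v : E3) ∈ g.carrier → g = k ∨ g = l := by
    intro g hg
    apply hkl'
    obtain ⟨c, d, hcd, hvc, hvd, hc, hd, -, -, -⟩ := face_corner hP g hg
    have h1 := honly c hvc (hflat c hvc)
    have h2 := honly d hvd (hflat d hvd)
    refine g.segment_subset hP hg ?_
    rcases h1 with rfl | rfl
    · exact hc
    · rcases h2 with rfl | rfl
      · exact hd
      · exact absurd rfl hcd
  have hkv := hk (left_mem_segment ℝ _ _)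
  have hlv := hl (left_mem_segment ℝ _ _)
  have huniv : (Finset.univ : Finset {g : Face P // (v : E3) ∈ g.carrier}) =
      {⟨k, hkv⟩, ⟨l, hlv⟩} := by
    ext ⟨g, hg⟩
    simpa using hmem g hg
  rw [huniv, Finset.sum_pair (by simpa using hkl)]
  linarith [k.angle_lt_pi hP hkv, l.angle_lt_pi hP hlv]

-- The plane at `η`-height 1 above `v` meets the edges at `v` in the points `β a`, with `v` moved to
-- the origin. They are the base of a pyramid with its apex at the origin, and their centroid `ω` is
-- strictly inside the base, as no face plane contains all edges. At each base vertex the two angles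
-- towards `ω` add up to the base angle, while the two angles towards the apex exceed it by the
-- strict spherical triangle inequality. So the angle sum at the apex is less than the one at `ω`,
-- which is at most 2π. Most of the work is to show that the faces arrange the edges in a
-- counterclockwise cycle (the bijections `o` and `i`) that winds around `ω` at most once.
set_option maxHeartbeats 800000 in
theorem sum_angle_lt_of_not_flat (hP : IsConvexPolyhedron P) [Fintype (Vertex P)] (v : Vertex P)
    [Fintype {g : Face P // (v : E3) ∈ g.carrier}]
    (hnf : ∀ f : Face P, (v : E3) ∈ f.carrier →
      ∃ w : Vertex P, (skeleton P).Adj v w ∧ (w : E3) ∉ f.carrier)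
    (hne : ∃ f : Face P, (v : E3) ∈ f.carrier) :
    ∑ g : {g : Face P // (v : E3) ∈ g.carrier}, g.1.angle v < 2 * Real.pi := by
  classical
  set E := {w : Vertex P // (skeleton P).Adj v w} with hE
  set F := {g : Face P // (v : E3) ∈ g.carrier} with hF
  obtain ⟨η, hη'⟩ := exists_exposing hP v
  have hη : ∀ a : E, 0 < inner ℝ η ((a.1 : E3) - v) := fun a =>
    hη' a.1 a.1.2.1 fun h => a.2.1 (Subtype.ext h.symm)
  obtain ⟨f0, hf0⟩ := hne
  have hEne : Nonempty E := by
    obtain ⟨w, hw, -⟩ := hnf f0 hf0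
    exact ⟨⟨w, hw⟩⟩
  have hη0 : η ≠ 0 := by
    rintro rfl
    have := hη hEne.some
    simp at this
  set β : E → E3 := fun a => (inner ℝ η ((a.1 : E3) - v))⁻¹ • ((a.1 : E3) - v) with hβ
  have hηβ : ∀ a, inner ℝ η (β a) = 1 := by
    intro a
    simp only [hβ, inner_smul_right]
    exact inv_mul_cancel₀ (hη a).ne'
  have hβk : ∀ (k : E3) (a : E), inner ℝ k ((a.1 : E3) - v) =
      inner ℝ η ((a.1 : E3) - v) * inner ℝ k (β a) := by
    intro k a
    simp only [hβ, inner_smul_right]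
    rw [mul_inv_cancel_left₀ (hη a).ne']
  have hβinj : ∀ a b : E, β a = β b → a = b := by
    intro a b hab
    apply Subtype.ext
    refine vertex_eq_of_collinear v b.1 a.1 b.2.1.symm a.2.1.symm
      (r := inner ℝ η ((a.1 : E3) - v) * (inner ℝ η ((b.1 : E3) - v))⁻¹) ?_
    have : (a.1 : E3) - v = inner ℝ η ((a.1 : E3) - v) • β a := by
      simp only [hβ, smul_smul, mul_inv_cancel₀ (hη a).ne', one_smul]
    calc (a.1 : E3) - v = inner ℝ η ((a.1 : E3) - v) • β b := by rw [← hab]; exact this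
      _ = _ := by simp only [hβ, smul_smul]
  set ω : E3 := (Fintype.card E : ℝ)⁻¹ • ∑ a, β a with hω
  have hcard : (0 : ℝ) < Fintype.card E := by
    exact_mod_cast Fintype.card_pos
  have hωk : ∀ k : E3, inner ℝ k ω = (Fintype.card E : ℝ)⁻¹ * ∑ a, inner ℝ k (β a) := by
    intro k
    rw [hω, inner_smul_right, inner_sum]
  have hηω : inner ℝ η ω = 1 := by
    rw [hωk]
    simp only [hηβ, Finset.sum_const, Finset.card_univ, nsmul_eq_mul, mul_one]
    exact inv_mul_cancel₀ hcard.ne'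
  have hηd : ∀ a, inner ℝ η (β a - ω) = 0 := fun a => by rw [inner_sub_right, hηβ, hηω, sub_self]
  have hnle : ∀ (f : F) (a : E), inner ℝ f.1.normal (β a) ≤ 0 := by
    intro f a
    have h1 := f.1.inner_le f.2 a.1.2.1
    rw [hβk] at h1
    have := hη a
    nlinarith
  have hnz : ∀ (f : F) (a : E), inner ℝ f.1.normal (β a) = 0 ↔ (a.1 : E3) ∈ f.1.carrier := by
    intro f a
    rw [f.1.mem_iff f.2, hβk]
    have := hη a
    constructor
    · intro h; exact ⟨a.1.2.1, by rw [h, mul_zero]⟩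
    · rintro ⟨-, h⟩; exact (mul_eq_zero.1 h).resolve_left this.ne'
  have hnω : ∀ f : F, inner ℝ f.1.normal ω < 0 := by
    intro f
    rw [hωk]
    refine mul_neg_of_pos_of_neg (inv_pos.2 hcard) ?_
    obtain ⟨w, hw, hwf⟩ := hnf f.1 f.2
    refine Finset.sum_neg' (fun a _ => hnle f a) ⟨⟨w, hw⟩, Finset.mem_univ _, ?_⟩
    exact lt_of_le_of_ne (hnle f _) fun h => hwf ((hnz f ⟨w, hw⟩).1 h)
  obtain ⟨p, hp, hηp⟩ := exists_unit_orthogonal hη0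
  obtain ⟨q, hq, hηq, hpq, hfr⟩ := exists_frame hη0 hp hηp
  set ζ : E → ℂ := fun a => planeCoord p q (β a - ω) with hζ
  have hβω : ∀ a, β a - ω ≠ 0 := by
    intro a h
    obtain ⟨f, -, -, hf, -⟩ := edge_faces hP a.2
    have hfv := hf (left_mem_segment ℝ _ _)
    have hfa := hf (right_mem_segment ℝ _ _)
    have h1 := (hnz ⟨f, hfv⟩ a).2 hfa
    rw [sub_eq_zero.1 h] at h1
    have := hnω ⟨f, hfv⟩
    linarith
  -- the functional computing the cross product with `ζ a`
  have hK : ∀ a : E, ∃ k : E3, inner ℝ k ω = 0 ∧ ∀ c, inner ℝ k (β c) = cross (ζ a) (ζ c) := by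
    intro a
    set k0 : E3 := (ζ a).re • q - (ζ a).im • p with hk0
    have h1 : ∀ x, inner ℝ k0 x = (ζ a).re * inner ℝ q x - (ζ a).im * inner ℝ p x := by
      intro x
      rw [hk0, inner_sub_left, inner_smul_left, inner_smul_left]; simp
    refine ⟨k0 - inner ℝ k0 ω • η, ?_, fun c => ?_⟩
    · rw [inner_sub_left, inner_smul_left, hηω]; simp
    · rw [inner_sub_left, inner_smul_left, hηβ]
      simp only [conj_trivial, mul_one]
      rw [← inner_sub_right, h1]
      simp [cross, hζ, planeCoord]
  have hcross_self : ∀ z : ℂ, cross z z = 0 := fun z => by simp [cross]; ring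
  have hcross_swap : ∀ z w : ℂ, cross z w = - cross w z := fun z w => by simp [cross]; ring
  have hcne : ∀ (f : F) (a b : E), a ≠ b → (a.1 : E3) ∈ f.1.carrier → (b.1 : E3) ∈ f.1.carrier →
      cross (ζ a) (ζ b) ≠ 0 := by
    intro f a b hab ha hb h0
    obtain ⟨s, hs⟩ := exists_smul_of_cross_eq_zero hfr (hηd a) (hηd b) (hβω a) h0
    have h1 : inner ℝ f.1.normal (β b - ω) = s * inner ℝ f.1.normal (β a - ω) := by
      rw [hs, inner_smul_right]
    rw [inner_sub_right, inner_sub_right, (hnz f a).2 ha, (hnz f b).2 hb] at h1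
    have h2 := hnω f
    have h3 : s = 1 := by
      have : (s - 1) * inner ℝ f.1.normal ω = 0 := by linarith
      rcases mul_eq_zero.1 this with h | h
      · linarith
      · linarith
    rw [h3, one_smul] at hs
    exact hab (hβinj a b (sub_left_injective hs).symm)
  -- The two faces at an edge lie on opposite sides of the line through `ω` and `β a`. Otherwise a
  -- functional vanishing at both points is nonnegative on the two faces, hence on `P` by the wedge
  -- property. Its values at the points `β c` are then nonnegative with average 0, its value at `ω`,
  -- yet it is positive at `β b`.
  have hopp : ∀ (f g : F) (a b b' : E), f ≠ g → a ≠ b → a ≠ b' → (a.1 : E3) ∈ f.1.carrier →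
      (b.1 : E3) ∈ f.1.carrier → (a.1 : E3) ∈ g.1.carrier → (b'.1 : E3) ∈ g.1.carrier →
      cross (ζ a) (ζ b) * cross (ζ a) (ζ b') < 0 := by
    intro f g a b b' hfg hab hab' haf hbf hag hbg
    have h1 := hcne f a b hab haf hbf
    have h2 := hcne g a b' hab' hag hbg
    by_contra hcon
    push Not at hcon
    obtain ⟨σ, hσ1, hσ2⟩ : ∃ σ : ℝ, 0 < σ * cross (ζ a) (ζ b) ∧ 0 < σ * cross (ζ a) (ζ b') := by
      refine ⟨cross (ζ a) (ζ b), mul_self_pos.2 h1, lt_of_le_of_ne hcon ?_⟩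
      exact (mul_ne_zero h1 h2).symm
    obtain ⟨k, hkω, hk⟩ := hK a
    obtain ⟨f', g', hfg', hf', hg', honly, hw⟩ := edge_faces hP a.2
    have hside : ∀ (f : F) (b : E), a ≠ b → (a.1 : E3) ∈ f.1.carrier → (b.1 : E3) ∈ f.1.carrier →
        0 < σ * cross (ζ a) (ζ b) → ∀ x ∈ f.1.carrier, 0 ≤ inner ℝ (σ • k) (x - v) := by
      intro f b hab ha hb hσ x hx
      obtain ⟨c, d, hcd, hvc, hvd, hc, hd, -, hcone, honly⟩ := face_corner hP f.1 f.2
      have hca := honly a.1 a.2 ha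
      have hcb := honly b.1 b.2 hb
      have hab' : a.1 ≠ b.1 := fun h => hab (Subtype.ext h)
      have ha0 : inner ℝ (σ • k) ((a.1 : E3) - v) = 0 := by
        rw [inner_smul_left, hβk, hk, hcross_self]; simp
      have hb0 : 0 < inner ℝ (σ • k) ((b.1 : E3) - v) := by
        rw [inner_smul_left, hβk, hk]
        have := mul_pos (hη b) hσ
        simp only [conj_trivial]
        linarith
      obtain ⟨s, t, hs, ht, hxe⟩ := hcone x hx
      rw [hxe, inner_add_right, inner_smul_right, inner_smul_right]
      have : (c = a.1 ∧ d = b.1) ∨ (c = b.1 ∧ d = a.1) :=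
        pair_eq_of_mem hab' hca hcb
      rcases this with ⟨rfl, rfl⟩ | ⟨rfl, rfl⟩
      · rw [ha0]; have := mul_nonneg ht hb0.le; linarith
      · rw [ha0]; have := mul_nonneg hs hb0.le; linarith
    have hf1 := honly f.1 (f.1.segment_subset hP f.2 haf)
    have hg1 := honly g.1 (g.1.segment_subset hP g.2 hag)
    have hfg1 : f.1 ≠ g.1 := fun h => hfg (Subtype.ext h)
    have hall : ∀ x ∈ P, 0 ≤ inner ℝ (σ • k) (x - v) := by
      have hsf := hside f b hab haf hbf hσ1
      have hsg := hside g b' hab' hag hbg hσ2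
      apply hw
      · rw [inner_smul_left, hβk, hk, hcross_self]; simp
      · rcases hf1 with h | h
        · rwa [← h]
        · rcases hg1 with h' | h'
          · rwa [← h']
          · exact absurd (h.trans h'.symm) hfg1
      · rcases hg1 with h | h
        · rcases hf1 with h' | h'
          · exact absurd (h'.trans h.symm) hfg1
          · rwa [← h']
        · rwa [← h]
    have hnn : ∀ c : E, 0 ≤ inner ℝ (σ • k) (β c) := by
      intro c
      have h3 := hall c.1 c.1.2.1
      rw [hβk] at h3
      exact nonneg_of_mul_nonneg_right h3 (hη c)
    have hsum : ∑ c, inner ℝ (σ • k) (β c) = 0 := by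
      have h3 := hωk (σ • k)
      rw [inner_smul_left, hkω, mul_zero] at h3
      exact (mul_eq_zero.1 h3.symm).resolve_left (inv_ne_zero hcard.ne')
    have := (Finset.sum_eq_zero_iff_of_nonneg fun c _ => hnn c).1 hsum b (Finset.mem_univ _)
    rw [inner_smul_left, hk] at this
    simp only [conj_trivial] at this
    linarith
  have hcorner : ∀ f : F, ∃ a b : E, a ≠ b ∧ (a.1 : E3) ∈ f.1.carrier ∧ (b.1 : E3) ∈ f.1.carrier ∧
      0 < cross (ζ a) (ζ b) ∧ ∀ c : E, (c.1 : E3) ∈ f.1.carrier → c = a ∨ c = b := by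
    intro f
    obtain ⟨c, d, hcd, hvc, hvd, hc, hd, -, -, honly⟩ := face_corner hP f.1 f.2
    have hcd' : (⟨c, hvc⟩ : E) ≠ ⟨d, hvd⟩ := fun h => hcd (congrArg Subtype.val h)
    have hon : ∀ e : E, (e.1 : E3) ∈ f.1.carrier → e = ⟨c, hvc⟩ ∨ e = ⟨d, hvd⟩ := by
      intro e he
      rcases honly e.1 e.2 he with h | h
      · left; exact Subtype.ext h
      · right; exact Subtype.ext h
    rcases lt_or_gt_of_ne (hcne f _ _ hcd' hc hd) with h | h
    · refine ⟨⟨d, hvd⟩, ⟨c, hvc⟩, hcd'.symm, hd, hc, ?_, fun e he => (hon e he).symm⟩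
      rw [hcross_swap]; linarith
    · exact ⟨_, _, hcd', hc, hd, h, hon⟩
  choose o i hoi ho hi hpos honly using hcorner
  have hoinj : Function.Injective o := by
    intro f g hfg
    by_contra hne
    have := hopp f g (o f) (i f) (i g) hne (hoi f) (hfg ▸ hoi g) (ho f) (hi f) (hfg ▸ ho g) (hi g)
    have h1 := hpos f
    have h2 := hpos g
    rw [← hfg] at h2
    nlinarith
  have hiinj : Function.Injective i := by
    intro f g hfg
    by_contra hne
    have := hopp f g (i f) (o f) (o g) hne (hoi f).symm (hfg ▸ (hoi g).symm) (hi f) (ho f)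
      (hfg ▸ hi g) (ho g)
    have h1 := hpos f
    have h2 := hpos g
    rw [← hfg] at h2
    rw [hcross_swap] at h1 h2
    nlinarith
  have hsurj : ∀ a : E, (∃ f, o f = a) ∧ ∃ f, i f = a := by
    intro a
    obtain ⟨f', g', hfg', hf', hg', -⟩ := edge_faces hP a.2
    set f : F := ⟨f', hf' (left_mem_segment ℝ _ _)⟩
    set g : F := ⟨g', hg' (left_mem_segment ℝ _ _)⟩
    have hfg : f ≠ g := fun h => hfg' (congrArg Subtype.val h)
    have haf : (a.1 : E3) ∈ f.1.carrier := hf' (right_mem_segment ℝ _ _)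
    have hag : (a.1 : E3) ∈ g.1.carrier := hg' (right_mem_segment ℝ _ _)
    rcases honly f a haf with h1 | h1 <;> rcases honly g a hag with h2 | h2
    · exact absurd (hoinj (h1.symm.trans h2)) hfg
    · exact ⟨⟨f, h1.symm⟩, ⟨g, h2.symm⟩⟩
    · exact ⟨⟨g, h2.symm⟩, ⟨f, h1.symm⟩⟩
    · exact absurd (hiinj (h1.symm.trans h2)) hfg
  set oe : F ≃ E := Equiv.ofBijective o ⟨hoinj, fun a => (hsurj a).1⟩ with hoe
  set ie : F ≃ E := Equiv.ofBijective i ⟨hiinj, fun a => (hsurj a).2⟩ with hie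
  have hang : ∀ f : F, f.1.angle v = angle (β (oe f)) (β (ie f)) := by
    intro f
    rw [f.1.angle_eq hP f.2 (ho f) (hi f) (o f).2 (i f).2 fun h => hoi f (Subtype.ext h)]
    change angle ((o f).1 - (v : E3)) ((i f).1 - (v : E3)) = angle (β (o f)) (β (i f))
    simp only [hβ]
    rw [angle_smul_left_of_pos _ _ (inv_pos.2 (hη (o f))),
      angle_smul_right_of_pos _ _ (inv_pos.2 (hη (i f)))]
  suffices hsuf : ∑ f : F, angle (β (oe f)) (β (ie f)) < 2 * Real.pi by
    rw [Finset.sum_congr rfl fun f _ => hang f]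
    convert hsuf
  refine (sum_angle_lt_of_pyramid oe ie β ω ?_ ?_ ?_).trans_le ?_
  · intro a h
    have := hηβ a
    rw [h] at this; simp at this
  · intro a h; exact hβω a (sub_eq_zero.2 h)
  · intro a
    obtain ⟨f, rfl⟩ := oe.surjective a
    rw [Equiv.symm_apply_apply]
    obtain ⟨g, hg⟩ := ie.surjective (oe f)
    rw [← hg, Equiv.symm_apply_apply, hg]
    change i g = o f at hg
    change angle (ω - β (o f)) (β (i f) - β (o f)) + angle (ω - β (o f)) (β (o g) - β (o f)) <
      angle (-β (o f)) (β (i f) - β (o f)) + angle (-β (o f)) (β (o g) - β (o f))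
    have hfg : f ≠ g := by
      rintro rfl; exact hoi f hg.symm
    have hogf : (o g).1.1 ∉ f.1.carrier := by
      intro hmem
      rcases honly f (o g) hmem with h | h
      · exact hfg (hoinj h.symm)
      · have h1 := hpos f
        have h2 := hpos g
        rw [h, hg, hcross_swap] at h2
        linarith
    set X := β (i f) - β (o f) with hX
    set Y := β (o g) - β (o f) with hY
    set W := ω - β (o f) with hW
    have hfX : inner ℝ f.1.normal X = 0 := by
      rw [hX, inner_sub_right, (hnz f _).2 (ho f), (hnz f _).2 (hi f), sub_self]
    have hfY : inner ℝ f.1.normal Y < 0 := by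
      rw [hY, inner_sub_right, (hnz f _).2 (ho f), sub_zero]
      exact lt_of_le_of_ne (hnle f _) fun h => hogf ((hnz f _).1 h)
    have hfW : inner ℝ f.1.normal W < 0 := by
      rw [hW, inner_sub_right, (hnz f _).2 (ho f), sub_zero]
      exact hnω f
    have hηX : inner ℝ η X = 0 := by rw [hX, inner_sub_right, hηβ, hηβ, sub_self]
    have hηY : inner ℝ η Y = 0 := by rw [hY, inner_sub_right, hηβ, hηβ, sub_self]
    set κ := cross (ζ (o f)) (ζ (i f)) with hκ
    set κ' := cross (ζ (o g)) (ζ (o f)) with hκ'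
    have hκ0 : 0 < κ := hpos f
    have hκ'0 : 0 < κ' := by rw [hκ', ← hg]; exact hpos g
    have hXc : planeCoord p q X = ζ (i f) - ζ (o f) := by
      simp only [hX, hζ, planeCoord_sub]; ring
    have hYc : planeCoord p q Y = ζ (o g) - ζ (o f) := by
      simp only [hY, hζ, planeCoord_sub]; ring
    -- `W` lies in the cone over `X` and `Y`: the weights `κ'` and `κ` make the combination parallel
    -- to `W`. The positive factor comes from the normal of `f`, which vanishes on `X` and is
    -- negative on `Y` and on `W`.
    obtain ⟨s, hs⟩ := exists_smul_of_cross_eq_zero hfr (x := β (o f) - ω) (y := κ' • X + κ • Y)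
      (hηd _) (by rw [inner_add_right, inner_smul_right, inner_smul_right, hηX, hηY]; simp) (hβω _)
      (by
        rw [planeCoord_add, planeCoord_smul, planeCoord_smul, hXc, hYc, hκ, hκ']
        change cross (ζ (o f)) _ = 0
        simp only [cross, Complex.add_re, Complex.add_im, Complex.mul_re, Complex.mul_im,
          Complex.ofReal_re, Complex.ofReal_im, Complex.sub_re, Complex.sub_im]
        ring)
    have hsW : κ' • X + κ • Y = (-s) • W := by
      rw [hs, hW]; module
    have hs0 : 0 < -s := by
      have h1 : inner ℝ f.1.normal (κ' • X + κ • Y) = -s * inner ℝ f.1.normal W := by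
        rw [hsW, inner_smul_right]
      rw [inner_add_right, inner_smul_right, inner_smul_right, hfX, mul_zero, zero_add] at h1
      have h2 : κ * inner ℝ f.1.normal Y < 0 := mul_neg_of_pos_of_neg hκ0 hfY
      by_contra hcon
      push Not at hcon
      nlinarith
    have hWe : W = (κ' / (-s)) • X + (κ / (-s)) • Y := by
      rw [div_eq_inv_mul, div_eq_inv_mul, mul_smul, mul_smul, ← smul_add, hsW, smul_smul,
        inv_mul_cancel₀ hs0.ne', one_smul]
    have hW0 : W ≠ 0 := by
      intro h; rw [h, inner_zero_right] at hfW; exact lt_irrefl _ hfW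
    have hadd := angle_add_of_cone hW0 (div_pos hκ'0 hs0).le (div_pos hκ0 hs0).le hWe
    have hZ0 : -β (o f) ≠ 0 := by
      intro h
      have := hηβ (o f)
      rw [neg_eq_zero.1 h] at this; simp at this
    have hle := InnerProductGeometry.angle_le_angle_add_angle X (-β (o f)) Y
    -- Equality would make `X` and `Y` opposite, which the normal of `f` excludes, or put the apex
    -- direction into the plane `η = 0` of `X` and `Y`, although `η` is `-1` on it.
    have hneq : angle X Y ≠ angle X (-β (o f)) + angle (-β (o f)) Y := by
      rw [Ne, angle_eq_angle_add_angle_iff hZ0]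
      rintro (h | h)
      · obtain ⟨-, r, -, hr⟩ := angle_eq_pi_iff.1 h
        rw [hr, inner_smul_right, hfX, mul_zero] at hfY
        exact lt_irrefl _ hfY
      · rw [Submodule.mem_span_pair] at h
        obtain ⟨x, y, hxy⟩ := h
        have h1 : inner ℝ η ((x : ℝ) • X + (y : ℝ) • Y) = inner ℝ η (-β (o f)) := by
          rw [← hxy]; rfl
        rw [inner_add_right, inner_smul_right, inner_smul_right, hηX, hηY, inner_neg_right,
          hηβ] at h1
        linarith
    rw [angle_comm W X, angle_comm (-β (o f)) X, ← hadd]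
    exact lt_of_le_of_ne hle hneq
  · have hζa : ∀ f : F, angle (β (oe f) - ω) (β (ie f) - ω) = angle (ζ (oe f)) (ζ (ie f)) :=
      fun f => (angle_planeCoord hfr (hηd _) (hηd _)).symm
    rw [Finset.sum_congr rfl fun f _ => hζa f]
    refine sum_angle_le_two_pi oe ie ζ hpos ?_
    -- A segment at which the argument wraps crosses the ray from `ω` in the direction `-p`, at a
    -- distance `r > 0`.
    have hcr : ∀ f : F, (ζ (i f)).arg < (ζ (o f)).arg → ∃ l m r : ℝ, 0 < l ∧ 0 ≤ m ∧ 0 < r ∧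
        l + m = 1 ∧ l • β (o f) + m • β (i f) = ω - r • p := by
      intro f hf
      obtain ⟨h1, h2⟩ := crossing_of_wrap (hpos f) hf
      set D := (ζ (o f)).im - (ζ (i f)).im with hD
      have hD0 : 0 < D := by linarith
      have h3 : -(ζ (i f)).im / D + (ζ (o f)).im / D = 1 := by
        rw [← add_div, div_eq_one_iff_eq hD0.ne', hD]; ring
      refine ⟨-(ζ (i f)).im / D, (ζ (o f)).im / D, cross (ζ (o f)) (ζ (i f)) / D,
        div_pos (by linarith) hD0, div_nonneg h1 hD0.le, div_pos (hpos f) hD0, h3, ?_⟩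
      set l := -(ζ (i f)).im / D with hl
      set m := (ζ (o f)).im / D with hm
      have h4 : l • β (o f) + m • β (i f) - ω = l • (β (o f) - ω) + m • (β (i f) - ω) := by
        rw [smul_sub, smul_sub]
        have : ω = l • ω + m • ω := by rw [← add_smul, h3, one_smul]
        nth_rw 1 [this]
        abel
      have h5 : inner ℝ η (l • (β (o f) - ω) + m • (β (i f) - ω)) = 0 := by
        rw [inner_add_right, inner_smul_right, inner_smul_right, hηd, hηd]; simp
      have h6 : inner ℝ q (l • (β (o f) - ω) + m • (β (i f) - ω)) = 0 := by
        rw [inner_add_right, inner_smul_right, inner_smul_right]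
        change l * (ζ (o f)).im + m * (ζ (i f)).im = 0
        rw [hl, hm]; ring
      have h7 : inner ℝ p (l • (β (o f) - ω) + m • (β (i f) - ω)) =
          -(cross (ζ (o f)) (ζ (i f)) / D) := by
        rw [inner_add_right, inner_smul_right, inner_smul_right]
        change l * (ζ (o f)).re + m * (ζ (i f)).re = _
        rw [hl, hm, cross]; ring
      rw [sub_eq_add_neg, ← sub_eq_iff_eq_add', h4, hfr _ h5, h6, h7]; simp
    choose! l m r hl hm hr hlm hx using hcr
    -- The plane of `f` supports all the points `β` and meets the ray at distance `r f`, so another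
    -- base segment cannot cross the ray farther out. Thus all crossings are at the same distance,
    -- and the start of the segment of `g` (of positive weight `l g`) lies in `f`.
    have hstep : ∀ f g : F, (ζ (i f)).arg < (ζ (o f)).arg → (ζ (i g)).arg < (ζ (o g)).arg →
        r f ≤ r g → r g ≤ r f ∧ ((o g).1 : E3) ∈ f.1.carrier := by
      intro f g hf hg hfg
      have h1 : inner ℝ f.1.normal ω = r f * inner ℝ f.1.normal p := by
        have := congrArg (fun x => inner ℝ f.1.normal x) (hx f hf)
        simp only [inner_add_right, inner_sub_right, inner_smul_right, (hnz f _).2 (ho f),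
          (hnz f _).2 (hi f)] at this
        linarith
      have h2 : l g * inner ℝ f.1.normal (β (o g)) + m g * inner ℝ f.1.normal (β (i g)) =
          inner ℝ f.1.normal ω - r g * inner ℝ f.1.normal p := by
        have := congrArg (fun x => inner ℝ f.1.normal x) (hx g hg)
        simpa only [inner_add_right, inner_sub_right, inner_smul_right] using this
      have h3 := hnω f
      have h4 := hr f hf
      have h5 : inner ℝ f.1.normal p < 0 := by
        by_contra hcon
        push Not at hcon
        have := mul_nonneg h4.le hcon
        linarith
      have h6 := hl g hg
      have h7 := hm g hg
      have h8 : l g * inner ℝ f.1.normal (β (o g)) ≤ 0 :=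
        mul_nonpos_of_nonneg_of_nonpos h6.le (hnle f _)
      have h9 : m g * inner ℝ f.1.normal (β (i g)) ≤ 0 :=
        mul_nonpos_of_nonneg_of_nonpos h7 (hnle f _)
      have h10 : (r g - r f) * inner ℝ f.1.normal p ≤ 0 :=
        mul_nonpos_of_nonneg_of_nonpos (by linarith) h5.le
      have h11 : (r g - r f) * inner ℝ f.1.normal p = 0 := by linarith
      have h12 : r g = r f := by
        rcases mul_eq_zero.1 h11 with h | h <;> linarith
      refine ⟨h12.le, (hnz f _).1 ?_⟩
      have h13 : l g * inner ℝ f.1.normal (β (o g)) = 0 := by linarith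
      exact (mul_eq_zero.1 h13).resolve_left h6.ne'
    intro f g hf hg
    change (ζ (i f)).arg < (ζ (o f)).arg at hf
    change (ζ (i g)).arg < (ζ (o g)).arg at hg
    have hboth : ((o g).1 : E3) ∈ f.1.carrier ∧ ((o f).1 : E3) ∈ g.1.carrier := by
      rcases le_total (r f) (r g) with h | h
      · obtain ⟨h1, h2⟩ := hstep f g hf hg h
        exact ⟨h2, (hstep g f hg hf h1).2⟩
      · obtain ⟨h1, h2⟩ := hstep g f hg hf h
        exact ⟨(hstep f g hf hg h1).2, h2⟩
    by_contra hne
    rcases honly f (o g) hboth.1 with h1 | h1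
    · exact hne (hoinj h1.symm)
    rcases honly g (o f) hboth.2 with h2 | h2
    · exact hne (hoinj h2)
    have h3 := hpos f
    have h4 := hpos g
    rw [h1, ← h2, hcross_swap] at h4
    linarith

/-- The total surface angle at a vertex of a convex polyhedron is less than `2π`. -/
theorem sum_angle_lt (hP : IsConvexPolyhedron P) (v : Vertex P)
    [Fintype {g : Face P // (v : E3) ∈ g.carrier}] :
    ∑ g : {g : Face P // (v : E3) ∈ g.carrier}, g.1.angle v < 2 * Real.pi := by
  have := hP.finite_vertex
  have := Fintype.ofFinite (Vertex P)
  by_cases hflat : ∃ f : Face P, (v : E3) ∈ f.carrier ∧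
      ∀ w : Vertex P, (skeleton P).Adj v w → (w : E3) ∈ f.carrier
  · obtain ⟨f, hf, hflat⟩ := hflat
    exact sum_angle_lt_of_flat hP v hf hflat
  · push Not at hflat
    by_cases hne : ∃ f : Face P, (v : E3) ∈ f.carrier
    · exact sum_angle_lt_of_not_flat hP v hflat hne
    · push Not at hne
      have : IsEmpty {g : Face P // (v : E3) ∈ g.carrier} := ⟨fun g => hne g.1 g.2⟩
      simp [Real.pi_pos]

end Polyhedron

end

/-! ### Simple polygonal arcs in the plane -/

section

namespace PlanarArc

open Polyhedron

/-- The cross product of plane vectors. -/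
def cr (x y : E2) : ℝ := x 0 * y 1 - x 1 * y 0

theorem cr_add_right (x y z : E2) : cr x (y + z) = cr x y + cr x z := by
  simp [cr]; ring

theorem cr_smul_right (x y : E2) (r : ℝ) : cr x (r • y) = r * cr x y := by
  simp [cr]; ring

theorem cr_swap (x y : E2) : cr x y = -cr y x := by
  simp [cr]; ring

theorem cr_self (x : E2) : cr x x = 0 := by
  simp [cr]; ring

theorem cr_zero (x : E2) : cr x 0 = 0 := by simp [cr]

theorem continuous_cr (x u : E2) : Continuous fun y => cr x (y - u) := by
  unfold cr
  simp only [PiLp.sub_apply]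
  fun_prop

theorem continuous_cr' (x u : E2) : Continuous fun y => cr (y - u) x := by
  unfold cr
  simp only [PiLp.sub_apply]
  fun_prop

theorem convex_cr_nonneg (d u : E2) : Convex ℝ {x : E2 | 0 ≤ cr d (x - u)} := by
  intro x hx y hy a b ha hb hab
  simp only [Set.mem_ofPred_eq] at *
  have : a • x + b • y - u = a • (x - u) + b • (y - u) := by
    have : u = (a + b) • u := by rw [hab, one_smul]
    nth_rw 1 [this]; module
  rw [this, cr_add_right, cr_smul_right, cr_smul_right]
  positivity

/-- Coordinates with respect to a triangle. -/
theorem eq_of_cr {p v w : E2} (h : cr (v - p) (w - p) ≠ 0) (x : E2) :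
    x = p + (cr (x - p) (w - p) / cr (v - p) (w - p)) • (v - p) +
      (cr (v - p) (x - p) / cr (v - p) (w - p)) • (w - p) := by
  have key : cr (v - p) (w - p) • x = cr (v - p) (w - p) • p + cr (x - p) (w - p) • (v - p) +
      cr (v - p) (x - p) • (w - p) := by
    ext i
    fin_cases i <;> simp [cr] <;> ring
  have := congrArg (fun y => (cr (v - p) (w - p))⁻¹ • y) key
  simpa only [smul_add, smul_smul, inv_mul_cancel₀ h, one_smul, inv_mul_eq_div] using this

theorem mem_triangle {p v w x : E2} {a b : ℝ} (ha : 0 ≤ a) (hb : 0 ≤ b) (hab : a + b ≤ 1)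
    (hx : x = p + a • (v - p) + b • (w - p)) : x ∈ convexHull ℝ {p, v, w} := by
  have hc := convex_convexHull ℝ ({p, v, w} : Set E2)
  have hp : p ∈ convexHull ℝ ({p, v, w} : Set E2) := subset_convexHull ℝ _ (by simp)
  have hv : v ∈ convexHull ℝ ({p, v, w} : Set E2) := subset_convexHull ℝ _ (by simp)
  have hw : w ∈ convexHull ℝ ({p, v, w} : Set E2) := subset_convexHull ℝ _ (by simp)
  have := hc.sum_mem (t := Finset.univ) (w := ![1 - a - b, a, b]) (z := ![p, v, w])
    (by intro i _; fin_cases i <;> simp <;> linarith)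
    (by simp [Fin.sum_univ_three]; ring) (by intro i _; fin_cases i <;> simp [hp, hv, hw])
  simp only [Fin.sum_univ_three, Matrix.cons_val_zero, Matrix.cons_val_one,
    Matrix.cons_val] at this
  rw [hx]
  convert this using 1
  module

/-- A point inside a common side of two triangles on opposite sides of it is an interior point of
their union. -/
theorem mem_interior_of_triangles {C : Set E2} {p v x₁ x₂ z : E2}
    (h₁ : convexHull ℝ {p, v, x₁} ⊆ C) (h₂ : convexHull ℝ {p, v, x₂} ⊆ C)
    (hx₁ : cr (v - p) (x₁ - p) < 0) (hx₂ : 0 < cr (v - p) (x₂ - p)) {t : ℝ} (ht0 : 0 < t)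
    (ht1 : t < 1) (hz : z = p + t • (v - p)) : z ∈ interior C := by
  rw [mem_interior_iff_mem_nhds]
  -- Of the barycentric conditions, these two are open and hold at `z` for both triangles. The sign
  -- of the remaining coordinate decides which triangle contains a nearby point.
  have key : ∀ w : E2, cr (v - p) (w - p) ≠ 0 → ∀ᶠ x in nhds z,
      0 < cr (x - p) (w - p) / cr (v - p) (w - p) ∧
      cr (x - p) (w - p) / cr (v - p) (w - p) + cr (v - p) (x - p) / cr (v - p) (w - p) < 1 := by
    intro w hw
    have hz1 : cr (z - p) (w - p) / cr (v - p) (w - p) = t := by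
      rw [hz, add_sub_cancel_left, cr_swap, cr_smul_right, cr_swap (w - p)]
      field_simp
    have hz2 : cr (v - p) (z - p) / cr (v - p) (w - p) = 0 := by
      rw [hz, add_sub_cancel_left, cr_smul_right, cr_self]; simp
    have c1 := (continuous_cr' (w - p) p).div_const (cr (v - p) (w - p))
    have c2 := (continuous_cr (v - p) p).div_const (cr (v - p) (w - p))
    refine Filter.Eventually.and ?_ ?_
    · exact c1.continuousAt.eventually_const_lt (by simpa [hz1] using ht0)
    · exact (c1.add c2).continuousAt.eventually_lt_const (by simpa [hz1, hz2] using ht1)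
  filter_upwards [key x₁ hx₁.ne, key x₂ hx₂.ne'] with x hk1 hk2
  rcases le_total 0 (cr (v - p) (x - p)) with h | h
  · exact h₂ (mem_triangle hk2.1.le (div_nonneg h hx₂.le) hk2.2.le (eq_of_cr hx₂.ne' x))
  · exact h₁ (mem_triangle hk1.1.le (div_nonneg_of_nonpos h hx₁.le) hk1.2.le (eq_of_cr hx₁.ne x))

/-- `A` is the trace of a simple polygonal arc from `u` to `v`. -/
inductive Arc : E2 → E2 → Set E2 → Prop
  | single {u v : E2} (h : u ≠ v) : Arc u v (segment ℝ u v)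
  | cons {u p v : E2} {A : Set E2} (hA : Arc p v A) (h : u ≠ p)
      (hi : segment ℝ u p ∩ A ⊆ {p}) : Arc u v (segment ℝ u p ∪ A)

theorem Arc.left_mem {u v : E2} {A : Set E2} (h : Arc u v A) : u ∈ A := by
  cases h with
  | single h => exact left_mem_segment ℝ _ _
  | cons hA h hi => exact Or.inl (left_mem_segment ℝ _ _)

theorem Arc.right_mem {u v : E2} {A : Set E2} (h : Arc u v A) : v ∈ A := by
  induction h with
  | single h => exact right_mem_segment ℝ _ _
  | cons hA h hi ih => exact Or.inr ih

theorem Arc.ne {u v : E2} {A : Set E2} (h : Arc u v A) : u ≠ v := by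
  cases h with
  | single h => exact h
  | cons hA h hi =>
    rintro rfl
    exact h (hi ⟨left_mem_segment ℝ _ _, hA.right_mem⟩)

theorem Arc.trans {u w v : E2} {A B : Set E2} (hA : Arc u w A) (hB : Arc w v B)
    (hAB : A ∩ B ⊆ {w}) : Arc u v (A ∪ B) := by
  induction hA with
  | single h => exact .cons hB h hAB
  | @cons u p w A hA h hi ih =>
    rw [Set.union_assoc]
    refine .cons (ih hB ((Set.inter_subset_inter_left _ Set.subset_union_right).trans hAB)) h ?_
    rintro x ⟨hx, hxA | hxB⟩
    · exact hi ⟨hx, hxA⟩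
    · have : x = w := hAB ⟨Or.inl hx, hxB⟩
      subst this
      exact hi ⟨hx, hA.right_mem⟩

/-- Passes from the inductive description to indexed vertices, as needed for `Polygon`. The
half-open edges avoid the last point `v`, which leaves it free to start the closing edge. -/
theorem Arc.exists_vertices {u v : E2} {A : Set E2} (h : Arc u v A) :
    ∃ (k : ℕ) (q : ℕ → E2), 1 ≤ k ∧ q 0 = u ∧ q k = v ∧
      (∀ x, x ∈ A ↔ ∃ i < k, x ∈ segment ℝ (q i) (q (i + 1))) ∧
      (∀ i < k, ∀ j < k, ∀ s ∈ Set.Ico (0 : ℝ) 1, ∀ t ∈ Set.Ico (0 : ℝ) 1,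
        AffineMap.lineMap (q i) (q (i + 1)) s = (AffineMap.lineMap (q j) (q (j + 1)) t : E2) →
          i = j ∧ s = t) ∧
      ∀ i < k, ∀ s ∈ Set.Ico (0 : ℝ) 1, (AffineMap.lineMap (q i) (q (i + 1)) s : E2) ≠ v := by
  induction h with
  | @single u v h =>
    refine ⟨1, fun i => if i = 0 then u else v, le_rfl, by simp, by simp, fun x => by simp, ?_, ?_⟩
    · intro i hi j hj s hs t ht hst
      obtain rfl : i = 0 := by omega
      obtain rfl : j = 0 := by omega
      simp only [if_true, zero_add, one_ne_zero, if_false] at hst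
      exact ⟨rfl, AffineMap.lineMap_injective ℝ h hst⟩
    · intro i hi s hs hsv
      obtain rfl : i = 0 := by omega
      simp only [if_true, zero_add, one_ne_zero, if_false] at hsv
      have : (AffineMap.lineMap u v s : E2) = AffineMap.lineMap u v (1 : ℝ) := by simpa using hsv
      exact hs.2.ne (AffineMap.lineMap_injective ℝ h this)
  | @cons u p v A hA h hi ih =>
    obtain ⟨k, q, hk, hq0, hqk, hqA, hqi, hqv⟩ := ih
    set r : ℕ → E2 := fun i => if i = 0 then u else q (i - 1) with hr
    have hr0 : r 0 = u := by simp [hr]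
    have hrs : ∀ i, r (i + 1) = q i := by intro i; simp [hr]
    have hmem : ∀ i < k, ∀ s ∈ Set.Ico (0 : ℝ) 1,
        (AffineMap.lineMap (q i) (q (i + 1)) s : E2) ∈ A := by
      intro i hi s hs
      rw [hqA]
      refine ⟨i, hi, ?_⟩
      rw [segment_eq_image_lineMap]
      exact ⟨s, ⟨hs.1, hs.2.le⟩, rfl⟩
    have hfirst : ∀ s ∈ Set.Ico (0 : ℝ) 1, (AffineMap.lineMap u p s : E2) ∉ A := by
      intro s hs hsA
      have h1 : (AffineMap.lineMap u p s : E2) ∈ segment ℝ u p := by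
        rw [segment_eq_image_lineMap]
        exact ⟨s, ⟨hs.1, hs.2.le⟩, rfl⟩
      have h2 : (AffineMap.lineMap u p s : E2) = p := hi ⟨h1, hsA⟩
      have : (AffineMap.lineMap u p s : E2) = AffineMap.lineMap u p (1 : ℝ) := by simpa using h2
      exact hs.2.ne (AffineMap.lineMap_injective ℝ h this)
    refine ⟨k + 1, r, by omega, hr0, by rw [hrs, hqk], fun x => ?_, ?_, ?_⟩
    · constructor
      · rintro (hx | hx)
        · exact ⟨0, by omega, by rw [hr0, hrs, hq0]; exact hx⟩
        · obtain ⟨i, hi, hxi⟩ := (hqA x).1 hx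
          exact ⟨i + 1, by omega, by rw [hrs, hrs]; exact hxi⟩
      · rintro ⟨i, hi, hxi⟩
        rcases i with _ | i
        · left; rwa [hr0, hrs, hq0] at hxi
        · right; rw [hrs, hrs] at hxi; exact (hqA x).2 ⟨i, by omega, hxi⟩
    · intro i hi j hj s hs t ht hst
      rcases i with _ | i <;> rcases j with _ | j
      · rw [hr0, hrs, hq0] at hst
        exact ⟨rfl, AffineMap.lineMap_injective ℝ h hst⟩
      · rw [hr0, hrs, hrs, hrs, hq0] at hst
        exact absurd (hst ▸ hmem j (by omega) t ht) (hfirst s hs)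
      · rw [hr0, hrs, hrs, hrs, hq0] at hst
        exact absurd (hst ▸ hmem i (by omega) s hs) (hfirst t ht)
      · rw [hrs, hrs, hrs, hrs] at hst
        obtain ⟨h1, h2⟩ := hqi i (by omega) j (by omega) s hs t ht hst
        exact ⟨by rw [h1], h2⟩
    · intro i hi s hs hsv
      rcases i with _ | i
      · rw [hr0, hrs, hq0] at hsv
        exact hfirst s hs (hsv ▸ hA.right_mem)
      · rw [hrs, hrs] at hsv
        exact hqv i (by omega) s hs hsv

theorem midpoint_notMem_pair {u v : E2} (h : u ≠ v) : midpoint ℝ u v ∉ ({u, v} : Set E2) := by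
  simp only [Set.mem_insert_iff, Set.mem_singleton_iff, midpoint_eq_left_iff, midpoint_eq_right_iff,
    not_or]
  exact ⟨h, h⟩

/-- A simple arc and the segment that closes it up form a simple polygon. -/
theorem Arc.exists_polygon_of_segment {u v : E2} {A : Set E2} (h : Arc u v A)
    (hi : segment ℝ v u ∩ A ⊆ {u, v}) :
    ∃ (n : ℕ) (p : Polygon E2 n), IsSimplePolygon p ∧ p.boundary ℝ = A ∪ segment ℝ v u := by
  obtain ⟨k, q, hk, hq0, hqk, hqA, hqi, hqv⟩ := h.exists_vertices
  -- An arc with a single edge would coincide with the closing segment, whose midpoint is not one of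
  -- its ends.
  have hk2 : 2 ≤ k := by
    by_contra hcon
    obtain rfl : k = 1 := by omega
    have hm : midpoint ℝ u v ∈ segment ℝ u v := midpoint_mem_segment u v
    refine midpoint_notMem_pair h.ne (hi ⟨by rwa [segment_symm], (hqA _).2 ⟨0, by omega, ?_⟩⟩)
    rw [hq0, zero_add, hqk]; exact hm
  set p : Polygon E2 (k + 1) := ⟨fun i => q i⟩ with hp
  have hmem : ∀ i < k, ∀ s ∈ Set.Ico (0 : ℝ) 1,
      (AffineMap.lineMap (q i) (q (i + 1)) s : E2) ∈ A := by
    intro i hi s hs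
    rw [hqA]
    refine ⟨i, hi, ?_⟩
    rw [segment_eq_image_lineMap]
    exact ⟨s, ⟨hs.1, hs.2.le⟩, rfl⟩
  have hpath : ∀ (i : Fin (k + 1)), (i : ℕ) < k → ∀ s : ℝ,
      p.edgePath ℝ i s = AffineMap.lineMap (q i) (q (i + 1)) s := by
    intro i hik s
    have : (finRotate (k + 1) i : Fin (k + 1)) = ⟨i + 1, by omega⟩ := by
      rw [← finRotate_of_lt hik]
    rw [Polygon.edgePath, this]
  have hlast : ∀ s : ℝ, p.edgePath ℝ (Fin.last k) s = AffineMap.lineMap v u s := by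
    intro s
    rw [Polygon.edgePath, finRotate_last]
    simp [hp, hq0, hqk]
  have hlastmem : ∀ i : Fin (k + 1), (i : ℕ) < k → ∀ s ∈ Set.Ico (0 : ℝ) 1,
      ∀ t ∈ Set.Ico (0 : ℝ) 1,
      p.edgePath ℝ i s ≠ p.edgePath ℝ (Fin.last k) t := by
    intro i hik s hs t ht hst
    rw [hpath i hik, hlast] at hst
    have h1 : (AffineMap.lineMap v u t : E2) ∈ segment ℝ v u := by
      rw [segment_eq_image_lineMap]
      exact ⟨t, ⟨ht.1, ht.2.le⟩, rfl⟩
    have h2 := hi ⟨h1, hst ▸ hmem i hik s hs⟩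
    rcases h2 with h2 | h2
    · have : (AffineMap.lineMap v u t : E2) = AffineMap.lineMap v u (1 : ℝ) := by simpa using h2
      exact ht.2.ne (AffineMap.lineMap_injective ℝ h.ne.symm this)
    · exact hqv i hik s hs (hst.trans h2)
  refine ⟨k + 1, p, ⟨by omega, ?_⟩, ?_⟩
  · intro i j s hs t ht hst
    rcases lt_or_ge (i : ℕ) k with hik | hik <;> rcases lt_or_ge (j : ℕ) k with hjk | hjk
    · rw [hpath i hik, hpath j hjk] at hst
      obtain ⟨h1, h2⟩ := hqi i hik j hjk s hs t ht hst
      exact ⟨Fin.ext h1, h2⟩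
    · obtain rfl : j = Fin.last k := Fin.ext (by simp; omega)
      exact absurd hst (hlastmem i hik s hs t ht)
    · obtain rfl : i = Fin.last k := Fin.ext (by simp; omega)
      exact absurd hst.symm (hlastmem j hjk t ht s hs)
    · obtain rfl : j = Fin.last k := Fin.ext (by simp; omega)
      obtain rfl : i = Fin.last k := Fin.ext (by simp; omega)
      rw [hlast, hlast] at hst
      exact ⟨rfl, AffineMap.lineMap_injective ℝ h.ne.symm hst⟩
  · have hseg : ∀ i : Fin (k + 1), (i : ℕ) < k → p.edgeSet ℝ i = segment ℝ (q i) (q (i + 1)) := by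
      intro i hik
      rw [Polygon.edgeSet_eq_image_edgePath, segment_eq_image_lineMap]
      exact Set.image_congr fun s _ => hpath i hik s
    have hsegl : p.edgeSet ℝ (Fin.last k) = segment ℝ v u := by
      rw [Polygon.edgeSet_eq_image_edgePath, segment_eq_image_lineMap]
      exact Set.image_congr fun s _ => hlast s
    ext x
    simp only [Polygon.boundary, Set.mem_iUnion, Set.mem_union]
    constructor
    · rintro ⟨i, hx⟩
      rcases lt_or_ge (i : ℕ) k with hik | hik
      · left; rw [hseg i hik] at hx; exact (hqA x).2 ⟨i, hik, hx⟩
      · obtain rfl : i = Fin.last k := Fin.ext (by simp; omega)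
        right; rwa [hsegl] at hx
    · rintro (hx | hx)
      · obtain ⟨i, hik, hx⟩ := (hqA x).1 hx
        exact ⟨⟨i, by omega⟩, by rw [hseg _ hik]; exact hx⟩
      · exact ⟨Fin.last k, by rwa [hsegl]⟩

/-- Two simple arcs with common ends, otherwise disjoint, form a simple polygon. -/
theorem Arc.exists_polygon {u v : E2} {A B : Set E2} (hA : Arc u v A) (hB : Arc v u B)
    (hi : A ∩ B ⊆ {u, v}) :
    ∃ (n : ℕ) (p : Polygon E2 n), IsSimplePolygon p ∧ p.boundary ℝ = A ∪ B := by
  cases hB with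
  | single h => exact hA.exists_polygon_of_segment (by rwa [Set.inter_comm])
  -- The first segment of the second arc becomes the closing edge of the arc made of its remainder
  -- followed by `A`.
  | @cons _ p _ B hB h hpB =>
    have hvB : v ∉ B := fun hv => h (hpB ⟨left_mem_segment ℝ _ _, hv⟩)
    have hBA : B ∩ A ⊆ {u} := by
      rintro x ⟨hxB, hxA⟩
      rcases hi ⟨hxA, Or.inr hxB⟩ with h | h
      · exact h
      · rw [h] at hxB; exact absurd hxB hvB
    obtain ⟨n, r, hr, hrb⟩ := (hB.trans hA hBA).exists_polygon_of_segment (by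
      rintro x ⟨hx, hxB | hxA⟩
      · left; exact hpB ⟨hx, hxB⟩
      · rcases hi ⟨hxA, Or.inl hx⟩ with rfl | h'
        · left; exact hpB ⟨hx, hB.right_mem⟩
        · right; exact h')
    exact ⟨n, r, hr, by rw [hrb, Set.union_comm B A, Set.union_assoc, Set.union_comm B]⟩

end PlanarArc

end

/-! ### The boundary of a convex polygon without one side -/

section

namespace PlanarArc

open Polyhedron

/-- The barycentric coordinates for the triangle `u v p` add up to 1; the third one is expressed by
the other two. -/
theorem cr_sub_eq (u v p x : E2) :
    cr (v - p) (x - p) = cr (x - u) (p - u) + cr (v - u) (x - u) - cr (v - u) (p - u) := by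
  simp [cr]; ring

theorem convex_cr_nonneg' (d u : E2) : Convex ℝ {x : E2 | 0 ≤ cr (x - u) d} := by
  have := convex_cr_nonneg (-d) u
  convert this using 3
  simp [cr]; ring_nf

theorem isCompact_hull (S : Finset E2) : IsCompact (convexHull ℝ (S : Set E2)) :=
  S.finite_toSet.isCompact_convexHull ℝ

/-- The minimiser of a cotangent. -/
theorem exists_last (u d : E2) (T : Finset E2) (hT : T.Nonempty)
    (h : ∀ s ∈ T, 0 < cr d (s - u)) : ∃ p ∈ T, ∀ s ∈ T, 0 ≤ cr (s - u) (p - u) := by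
  obtain ⟨p, hp, hmin⟩ := T.exists_min_image
    (fun s => (d 0 * (s - u) 0 + d 1 * (s - u) 1) / cr d (s - u)) hT
  refine ⟨p, hp, fun s hs => ?_⟩
  have h1 := hmin s hs
  rw [div_le_div_iff₀ (h p hp) (h s hs)] at h1
  have hd : 0 < d 0 * d 0 + d 1 * d 1 := by
    have h3 : d 0 ≠ 0 ∨ d 1 ≠ 0 := by
      by_contra hc
      push Not at hc
      have := h p hp
      simp [cr, hc.1, hc.2] at this
    rcases h3 with h3 | h3
    · have := mul_self_pos.2 h3; nlinarith [mul_self_nonneg (d 1)]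
    · have := mul_self_pos.2 h3; nlinarith [mul_self_nonneg (d 0)]
  have h2 : (d 0 * d 0 + d 1 * d 1) * cr (s - u) (p - u) =
      (d 0 * (s - u) 0 + d 1 * (s - u) 1) * cr d (p - u) -
        (d 0 * (p - u) 0 + d 1 * (p - u) 1) * cr d (s - u) := by
    simp only [cr]; ring
  by_contra hneg
  push Not at hneg
  nlinarith

/-- On a ray from `u` that passes `q` and then `y`, the points between `q` and `y` belong to `C`.
When the vertex `u` is removed, this shows that points beyond the new side stay in the hull of the
remaining vertices. -/
theorem mem_hull_of_beyond {C : Set E2} (hC : Convex ℝ C) {u y q : E2} {t σ : ℝ} (hq : q ∈ C)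
    (hy : y ∈ C) (hyq : y - u = σ • (q - u)) (ht1 : t ≤ 1) (hσ : 1 ≤ t * σ) (hσ0 : 0 < σ) :
    u + t • (y - u) ∈ C := by
  have hσ1 : t * σ ≤ σ := by nlinarith
  rcases eq_or_lt_of_le (hσ.trans hσ1) with h1 | h1
  · have : t = 1 := by rw [← h1] at hσ; linarith
    rw [this, one_smul, add_sub_cancel]; exact hy
  · have h2 : σ - 1 ≠ 0 := by linarith
    have hy' : y = u + σ • (q - u) := by rw [← hyq]; abel
    refine hC.segment_subset hq hy ⟨1 - (t * σ - 1) / (σ - 1), (t * σ - 1) / (σ - 1), ?_,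
      div_nonneg (by linarith) (by linarith), by ring, ?_⟩
    · rw [sub_nonneg, div_le_one (by linarith)]; linarith
    · rw [hyq, hy']
      have : (t * σ - 1) / (σ - 1) * σ = t * σ - 1 + (t * σ - 1) / (σ - 1) := by
        field_simp; ring
      match_scalars <;> linarith

/-- The part of the boundary of a convex polygon complementary to one of its sides. -/
theorem exists_arc_of_side (S : Finset E2) : ∀ u v : E2,
    (∀ s ∈ S, s ∉ convexHull ℝ ((S : Set E2) \ {s})) → u ∈ S → v ∈ S → u ≠ v →
    (∀ s ∈ S, s ≠ u → s ≠ v → 0 < cr (v - u) (s - u)) →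
    ∃ A, Arc u v A ∧ A ⊆ convexHull ℝ (S : Set E2) ∧
      frontier (convexHull ℝ (S : Set E2)) ⊆ A ∪ segment ℝ u v ∧
      ((S : Set E2) = {u, v} → A = segment ℝ u v) ∧
      ((S : Set E2) ≠ {u, v} → A ∩ segment ℝ u v ⊆ {u, v}) := by
  classical
  induction hn : S.card generalizing S with
  | zero => intro u v _ hu; simp [Finset.card_eq_zero.1 hn] at hu
  | succ n ih =>
  intro u v hind hu hv huv hpos
  have hsubS : (S : Set E2) ⊆ convexHull ℝ (S : Set E2) := subset_convexHull ℝ _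
  have hcl := (isCompact_hull S).isClosed
  by_cases hS : (S : Set E2) = {u, v}
  · have hh : convexHull ℝ (S : Set E2) = segment ℝ u v := by rw [hS, convexHull_pair]
    refine ⟨segment ℝ u v, .single huv, hh.ge, ?_, fun _ => rfl, fun h => absurd hS h⟩
    rw [← hh]
    exact (hcl.frontier_subset).trans Set.subset_union_left
  -- Turning about `u` from the direction of `v`, the vertex `p` is seen last, so `u p` is the other
  -- side at `u`. Removing `u` splits off the triangle `u v p`, and induction supplies the arc from
  -- `p` to `v` for the side `p v` of the rest.
  obtain ⟨p, hp, hlast⟩ := exists_last u (v - u) ((S.erase u).erase v) (by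
    by_contra hne
    rw [Finset.not_nonempty_iff_eq_empty] at hne
    refine hS (Set.Subset.antisymm (fun s hs => ?_) ?_)
    · by_contra hcon
      simp only [Set.mem_insert_iff, Set.mem_singleton_iff, not_or] at hcon
      have : s ∈ (S.erase u).erase v := by simp [hcon.1, hcon.2, Finset.mem_coe.1 hs]
      simp [hne] at this
    · rintro s (rfl | rfl)
      exacts [hu, hv])
    (fun s hs => by
      simp only [Finset.mem_erase] at hs
      exact hpos s hs.2.2 hs.2.1 hs.1)
  simp only [Finset.mem_erase] at hp hlast
  obtain ⟨hpv, hpu, hpS⟩ := hp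
  set D := cr (v - u) (p - u) with hD
  have hD0 : 0 < D := hpos p hpS hpu hpv
  have hb : ∀ x ∈ convexHull ℝ (S : Set E2), 0 ≤ cr (v - u) (x - u) := by
    refine fun x hx => convexHull_min (fun s hs => ?_) (convex_cr_nonneg (v - u) u) hx
    simp only [Set.mem_ofPred_eq]
    by_cases h1 : s = u
    · rw [h1, sub_self, cr_zero]
    by_cases h2 : s = v
    · rw [h2, cr_self]
    exact (hpos s hs h1 h2).le
  have ha : ∀ x ∈ convexHull ℝ (S : Set E2), 0 ≤ cr (x - u) (p - u) := by
    refine fun x hx => convexHull_min (fun s hs => ?_) (convex_cr_nonneg' (p - u) u) hx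
    simp only [Set.mem_ofPred_eq]
    by_cases h1 : s = u
    · rw [h1, sub_self, cr_swap, cr_zero, neg_zero]
    by_cases h2 : s = v
    · rw [h2]; exact hD0.le
    exact hlast s ⟨h2, h1, hs⟩
  have hg : ∀ x, cr (v - p) (x - p) = cr (x - u) (p - u) + cr (v - u) (x - u) - D :=
    fun x => cr_sub_eq u v p x
  have hco : ∀ x, x = u + (cr (x - u) (p - u) / D) • (v - u) +
      (cr (v - u) (x - u) / D) • (p - u) := eq_of_cr hD0.ne'
  -- A vertex on the wrong side of `p v` would lie in the triangle `u v p`, against the independence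
  -- `hind`.
  have hgp : ∀ s ∈ S.erase u, s ≠ p → s ≠ v → 0 < cr (v - p) (s - p) := by
    intro s hs hsp hsv
    obtain ⟨hsu, hsS⟩ := Finset.mem_erase.1 hs
    by_contra hcon
    push Not at hcon
    refine hind s hsS (convexHull_mono ?_ (mem_triangle (div_nonneg (ha s (hsubS hsS)) hD0.le)
      (div_nonneg (hb s (hsubS hsS)) hD0.le) ?_ (hco s)))
    · rintro y (rfl | rfl | rfl)
      exacts [⟨hu, fun h => hsu h.symm⟩, ⟨hv, fun h => hsv h.symm⟩, ⟨hpS, fun h => hsp h.symm⟩]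
    · rw [← add_div, div_le_one hD0]; linarith [hg s]
  have hsub : ((S.erase u : Finset E2) : Set E2) ⊆ S := by simp
  have hpS' : p ∈ S.erase u := Finset.mem_erase.2 ⟨hpu, hpS⟩
  have hvS' : v ∈ S.erase u := Finset.mem_erase.2 ⟨huv.symm, hv⟩
  obtain ⟨A, hA, hAS, hAf, hA1, hA2⟩ := ih (S.erase u)
    (by rw [Finset.card_erase_of_mem hu, hn]; rfl) p v
    (fun s hs hsm => hind s (Finset.mem_of_mem_erase hs)
      (convexHull_mono (Set.sdiff_subset_sdiff_left hsub) hsm)) hpS' hvS' hpv hgp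
  have hS'S := convexHull_mono (𝕜 := ℝ) hsub
  have hg0 : ∀ x ∈ convexHull ℝ ((S.erase u : Finset E2) : Set E2), 0 ≤ cr (v - p) (x - p) := by
    refine fun x hx => convexHull_min (fun s hs => ?_) (convex_cr_nonneg (v - p) p) hx
    simp only [Set.mem_ofPred_eq]
    by_cases h1 : s = p
    · rw [h1, sub_self, cr_zero]
    by_cases h2 : s = v
    · rw [h2, cr_self]
    exact (hgp s hs h1 h2).le
  have hsegp : ∀ x ∈ segment ℝ u p, ∃ t : ℝ, 0 ≤ t ∧ t ≤ 1 ∧ x = u + t • (p - u) := by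
    intro x hx
    rw [segment_eq_image'] at hx
    obtain ⟨t, ht, rfl⟩ := hx
    exact ⟨t, ht.1, ht.2, rfl⟩
  have hsegv : ∀ x ∈ segment ℝ u v, ∃ t : ℝ, 0 ≤ t ∧ t ≤ 1 ∧ x = u + t • (v - u) := by
    intro x hx
    rw [segment_eq_image'] at hx
    obtain ⟨t, ht, rfl⟩ := hx
    exact ⟨t, ht.1, ht.2, rfl⟩
  refine ⟨segment ℝ u p ∪ A, .cons hA hpu.symm ?_, ?_, ?_, fun h => absurd h hS, fun _ => ?_⟩
  · rintro x ⟨hx, hxA⟩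
    obtain ⟨t, ht0, ht1, rfl⟩ := hsegp x hx
    have h1 := hg0 _ (hAS hxA)
    rw [hg] at h1
    have h2 : cr (u + t • (p - u) - u) (p - u) = 0 := by
      rw [add_sub_cancel_left, cr_swap, cr_smul_right, cr_self]; simp
    have h3 : cr (v - u) (u + t • (p - u) - u) = t * D := by
      rw [add_sub_cancel_left, cr_smul_right]
    rw [h2, h3] at h1
    obtain rfl : t = 1 := by nlinarith
    simp
  · exact Set.union_subset ((convex_convexHull ℝ _).segment_subset (hsubS hu) (hsubS hpS))
      (hAS.trans hS'S)
  · intro x hx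
    have hxS : x ∈ convexHull ℝ (S : Set E2) := hcl.frontier_subset hx
    have hxi : x ∉ interior (convexHull ℝ (S : Set E2)) := hx.2
    -- The line `p v` cuts the hull into two parts. On the side of `u`, a frontier point lies on `u
    -- p` or `u v`, because a point with positive coordinates is interior to the triangle. On the
    -- other side it is a frontier point of the smaller hull, where induction applies.
    rcases lt_or_ge (cr (v - p) (x - p)) 0 with hneg | hnn
    · have hsum : cr (x - u) (p - u) / D + cr (v - u) (x - u) / D < 1 := by
        rw [← add_div, div_lt_one hD0]; linarith [hg x]
      rcases (ha x hxS).eq_or_lt with ha0 | ha0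
      · left; left
        rw [segment_eq_image']
        refine ⟨cr (v - u) (x - u) / D, ⟨div_nonneg (hb x hxS) hD0.le, ?_⟩, ?_⟩
        · rw [← ha0] at hsum; simp at hsum; exact hsum.le
        · have := hco x
          rw [← ha0, zero_div, zero_smul, add_zero] at this
          exact this.symm
      rcases (hb x hxS).eq_or_lt with hb0 | hb0
      · right
        rw [segment_eq_image']
        refine ⟨cr (x - u) (p - u) / D, ⟨div_nonneg (ha x hxS) hD0.le, ?_⟩, ?_⟩
        · rw [← hb0] at hsum; simp at hsum; exact hsum.le
        · have := hco x
          rw [← hb0, zero_div, zero_smul, add_zero] at this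
          exact this.symm
      · refine absurd ?_ hxi
        rw [mem_interior_iff_mem_nhds]
        have c1 := continuous_cr' (p - u) u
        have c2 := continuous_cr (v - u) u
        filter_upwards [c1.continuousAt.eventually_const_lt ha0,
          c2.continuousAt.eventually_const_lt hb0,
          ((c1.div_const D).add (c2.div_const D)).continuousAt.eventually_lt_const hsum]
          with y hy1 hy2 hy3
        refine convexHull_mono ?_ (mem_triangle (div_nonneg hy1.le hD0.le)
          (div_nonneg hy2.le hD0.le) hy3.le (hco y))
        rintro z (rfl | rfl | rfl)
        exacts [hu, hv, hpS]
    · have hxS' : x ∈ convexHull ℝ ((S.erase u : Finset E2) : Set E2) := by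
        have hins : (S : Set E2) = insert u ((S.erase u : Finset E2) : Set E2) := by
          rw [← Finset.coe_insert, Finset.insert_erase hu]
        have hx2 := hxS
        rw [hins, convexHull_insert ⟨p, hpS'⟩, mem_convexJoin] at hx2
        obtain ⟨u', rfl, y, hy, hxy⟩ := hx2
        rw [segment_eq_image'] at hxy
        obtain ⟨t, ht, rfl⟩ := hxy
        have hgy := hg0 y hy
        rw [hg] at hgy
        have e1 : cr (u' + t • (y - u') - u') (p - u') = t * cr (y - u') (p - u') := by
          rw [add_sub_cancel_left, cr_swap, cr_smul_right, cr_swap (p - u')]; ring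
        have e2 : cr (v - u') (u' + t • (y - u') - u') = t * cr (v - u') (y - u') := by
          rw [add_sub_cancel_left, cr_smul_right]
        simp only [hg, e1, e2] at hnn
        set a := cr (y - u') (p - u') with had
        set b := cr (v - u') (y - u') with hbd
        have ha' : 0 ≤ a := ha y (hS'S hy)
        have hb' : 0 ≤ b := hb y (hS'S hy)
        have hab : 0 < a + b := by linarith
        refine mem_hull_of_beyond (convex_convexHull ℝ _) (σ := (a + b) / D)
          (q := u' + (a / (a + b)) • (v - u') + (b / (a + b)) • (p - u')) ?_ hy ?_ ht.2 ?_
          (by positivity)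
        · refine (convex_convexHull ℝ _).segment_subset (subset_convexHull ℝ _ hvS')
            (subset_convexHull ℝ _ hpS') ⟨a / (a + b), b / (a + b), by positivity, by positivity,
            by field_simp, ?_⟩
          have : a / (a + b) + b / (a + b) = 1 := by field_simp
          match_scalars <;> linarith
        · nth_rw 1 [hco y]
          rw [← had, ← hbd]
          match_scalars <;> field_simp
          ring
        · rw [mul_div_assoc', le_div_iff₀ hD0]; linarith
      have hxf : x ∈ frontier (convexHull ℝ ((S.erase u : Finset E2) : Set E2)) :=
        ⟨subset_closure hxS', fun h => hxi (interior_mono hS'S h)⟩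
      rcases hAf hxf with h | h
      · exact Or.inl (Or.inr h)
      by_cases hS' : ((S.erase u : Finset E2) : Set E2) = {p, v}
      · left; right; rw [hA1 hS']; exact h
      rw [segment_eq_image'] at h
      obtain ⟨t, ht, rfl⟩ := h
      rcases ht.1.eq_or_lt with h0 | h0
      · left; right
        simp only [← h0, zero_smul, add_zero]; exact hA.left_mem
      rcases ht.2.eq_or_lt with h1 | h1
      · left; right
        simp only [h1, one_smul, add_sub_cancel]; exact hA.right_mem
      obtain ⟨w, hw, hwp, hwv⟩ : ∃ w ∈ S.erase u, w ≠ p ∧ w ≠ v := by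
        by_contra hcon
        push Not at hcon
        refine hS' (Set.Subset.antisymm (fun s hs => ?_) ?_)
        · by_cases hsp : s = p
          · exact Or.inl hsp
          · exact Or.inr (hcon s hs hsp)
        · rintro s (rfl | rfl)
          exacts [hpS', hvS']
      -- A point strictly inside the diagonal `p v` has a triangle on each side and is interior,
      -- hence not on the frontier.
      refine absurd (mem_interior_of_triangles (x₁ := u) (x₂ := w) (p := p) (v := v)
        (convexHull_mono ?_) (convexHull_mono ?_) ?_ (hgp w hw hwp hwv) h0 h1 rfl) hxi
      · rintro z (rfl | rfl | rfl)
        exacts [hpS, hv, hu]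
      · rintro z (rfl | rfl | rfl)
        exacts [hpS, hv, hsub hw]
      · rw [hg, sub_self, cr_zero, cr_swap, cr_zero]; linarith
  · rintro x ⟨hx | hx, hxv⟩
    · obtain ⟨t, ht0, ht1, rfl⟩ := hsegp x hx
      obtain ⟨s, hs0, hs1, hst⟩ := hsegv _ hxv
      have h1 : cr (v - u) (t • (p - u)) = cr (v - u) (s • (v - u)) := by
        rw [add_left_cancel hst]
      rw [cr_smul_right, cr_smul_right, cr_self, mul_zero] at h1
      left
      rcases mul_eq_zero.1 h1 with h | h
      · simp [h]
      · exact absurd h hD0.ne'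
    · obtain ⟨t, ht0, ht1, rfl⟩ := hsegv x hxv
      have h1 := hg0 _ (hAS hx)
      rw [hg, add_sub_cancel_left, cr_smul_right, cr_self, cr_swap, cr_smul_right, cr_swap,
        ← hD] at h1
      obtain rfl : t = 1 := by nlinarith
      right; simp

end PlanarArc

end

/-! ### Two convex polygons glued along a segment -/

section

namespace PlanarArc

open Polyhedron

theorem eq_smul_of_cr_eq_zero {d y : E2} (hd : d ≠ 0) (h : cr d y = 0) : ∃ t : ℝ, y = t • d := by
  have h3 : d 0 ≠ 0 ∨ d 1 ≠ 0 := by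
    by_contra hc
    push Not at hc
    exact hd (by ext i; fin_cases i <;> simp [hc.1, hc.2])
  unfold cr at h
  rcases h3 with h3 | h3
  · refine ⟨y 0 / d 0, ?_⟩
    ext i; fin_cases i
    · simp; field_simp
    · simp; field_simp; linarith
  · refine ⟨y 1 / d 1, ?_⟩
    ext i; fin_cases i
    · simp; field_simp; linarith
    · simp; field_simp

theorem Arc.cons_of_le {u p v : E2} {A : Set E2} (hA : Arc p v A)
    (hi : segment ℝ u p ∩ A ⊆ {p}) : Arc u v (segment ℝ u p ∪ A) := by
  by_cases h : u = p
  · subst h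
    rw [segment_same, Set.singleton_union, Set.insert_eq_self.2 hA.left_mem]
    exact hA
  · exact .cons hA h hi

theorem Arc.concat_of_le {u p v : E2} {A : Set E2} (hA : Arc u p A)
    (hi : A ∩ segment ℝ p v ⊆ {p}) : Arc u v (A ∪ segment ℝ p v) := by
  by_cases h : p = v
  · subst h
    rw [segment_same, Set.union_singleton, Set.insert_eq_self.2 hA.right_mem]
    exact hA
  · exact hA.trans (.single h) hi

theorem notMem_convexHull_extremePoints {U : Set E2} {s : E2}
    (hU : Convex ℝ U) (hs : s ∈ U.extremePoints ℝ) :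
    s ∉ convexHull ℝ (U.extremePoints ℝ \ {s}) := by
  intro h
  have hc := (hU.mem_extremePoints_iff_convex_sdiff.1 hs).2
  exact (convexHull_min (Set.sdiff_subset_sdiff_left extremePoints_subset) hc h).2 rfl

/-- The boundary arc of a convex polygon on one side of a segment that lies on a supporting
line. -/
theorem exists_arc {T : Set E2} (hT : T.Finite) {u v : E2} (huv : u ≠ v)
    (hu : u ∈ convexHull ℝ T) (hv : v ∈ convexHull ℝ T)
    (hpos : ∀ x ∈ convexHull ℝ T, 0 ≤ cr (v - u) (x - u))
    (hex : ∃ x ∈ convexHull ℝ T, 0 < cr (v - u) (x - u)) :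
    ∃ A, Arc u v A ∧ A ⊆ convexHull ℝ T ∧ frontier (convexHull ℝ T) ⊆ A ∪ segment ℝ u v ∧
      A ∩ segment ℝ u v ⊆ {u, v} := by
  set U := convexHull ℝ T with hU
  have hUc : Convex ℝ U := convex_convexHull ℝ T
  have hUk : IsCompact U := hT.isCompact_convexHull ℝ
  have hd : v - u ≠ 0 := sub_ne_zero.2 huv.symm
  have hSfin : (U.extremePoints ℝ).Finite := hT.subset extremePoints_convexHull_subset
  have hSU : convexHull ℝ (U.extremePoints ℝ) = U := by
    have h := closure_convexHull_extremePoints hUk hUc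
    rwa [(hSfin.isClosed_convexHull ℝ).closure_eq] at h
  set ℓ : ℝ →ᵃ[ℝ] E2 := AffineMap.lineMap u v with hℓ
  have hℓa : ∀ t, ℓ t = u + t • (v - u) := fun t => by
    rw [hℓ, AffineMap.lineMap_apply, vsub_eq_sub, vadd_eq_add, add_comm]
  have hℓ0 : ℓ 0 = u := by simp [hℓ]
  have hℓ1 : ℓ 1 = v := by simp [hℓ]
  have hinj : Function.Injective ℓ := AffineMap.lineMap_injective ℝ huv
  have hℓc : Continuous ℓ := ℓ.continuous_of_finiteDimensional
  have hcrℓ : ∀ t, cr (v - u) (ℓ t - u) = 0 := fun t => by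
    rw [hℓa, add_sub_cancel_left, cr_smul_right, cr_self, mul_zero]
  have hline : ∀ x, cr (v - u) (x - u) = 0 → ∃ t, x = ℓ t := fun x hx => by
    obtain ⟨t, ht⟩ := eq_smul_of_cr_eq_zero hd hx
    exact ⟨t, by rw [hℓa, ← ht, add_sub_cancel]⟩
  have hseg : ∀ a b : ℝ, a ≤ b → segment ℝ (ℓ a) (ℓ b) = ℓ '' Set.Icc a b := fun a b hab => by
    rw [← segment_eq_Icc hab, image_segment]
  have hIk : IsCompact (ℓ ⁻¹' U) := by
    have hgl : Function.LeftInverse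
        (fun x => inner ℝ (v - u) (x - u) / inner ℝ (v - u) (v - u)) ℓ := fun t => by
      have : inner ℝ (v - u) (v - u) ≠ 0 := inner_self_ne_zero.2 hd
      simp only [hℓa, add_sub_cancel_left, inner_smul_right]
      field_simp
    exact (hgl.isClosedEmbedding (by fun_prop) hℓc).isCompact_preimage hUk
  have h0I : (0 : ℝ) ∈ ℓ ⁻¹' U := by rw [Set.mem_preimage, hℓ0]; exact hu
  have h1I : (1 : ℝ) ∈ ℓ ⁻¹' U := by rw [Set.mem_preimage, hℓ1]; exact hv
  -- `u` and `v` need not be extreme points: the supporting line may meet `U` in a longer segment,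
  -- with parameters from `α ≤ 0` to `β ≥ 1`. Its ends are extreme, so the arc for that side exists,
  -- and the two overhanging pieces are added to it.
  obtain ⟨α, hαU, hα⟩ := hIk.exists_isLeast ⟨0, h0I⟩
  obtain ⟨β, hβU, hβ⟩ := hIk.exists_isGreatest ⟨0, h0I⟩
  have hα0 : α ≤ 0 := hα h0I
  have hβ1 : 1 ≤ β := hβ h1I
  have hext : ∀ γ, ℓ γ ∈ U → ((∀ t, ℓ t ∈ U → t ≤ γ) ∨ (∀ t, ℓ t ∈ U → γ ≤ t)) →
      ℓ γ ∈ U.extremePoints ℝ := by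
    intro γ hγ hm
    refine ⟨hγ, ?_⟩
    rintro x hx y hy ⟨a, b, ha, hb, hab, hxy⟩
    have hsum : a * cr (v - u) (x - u) + b * cr (v - u) (y - u) = 0 := by
      rw [← cr_smul_right, ← cr_smul_right, ← cr_add_right, ← hcrℓ γ, ← hxy]
      congr 1
      have : b = 1 - a := by linarith
      subst this
      module
    have hx0 := hpos x hx
    have hy0 := hpos y hy
    have hxz : cr (v - u) (x - u) = 0 := by nlinarith [mul_nonneg ha.le hx0, mul_nonneg hb.le hy0]
    have hyz : cr (v - u) (y - u) = 0 := by nlinarith [mul_nonneg ha.le hx0, mul_nonneg hb.le hy0]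
    obtain ⟨s, rfl⟩ := hline x hxz
    obtain ⟨t, rfl⟩ := hline y hyz
    have hγe : a * s + b * t = γ := by
      apply hinj
      rw [← hxy, hℓa, hℓa, hℓa]
      have : b = 1 - a := by linarith
      subst this
      module
    congr 1
    rcases hm with hm | hm
    · have h1 := hm s hx
      have h2 := hm t hy
      have : a * (γ - s) + b * (γ - t) = 0 := by linear_combination γ * hab - hγe
      nlinarith [mul_nonneg ha.le (sub_nonneg.2 h1), mul_nonneg hb.le (sub_nonneg.2 h2)]
    · have h1 := hm s hx
      have h2 := hm t hy
      have : a * (s - γ) + b * (t - γ) = 0 := by linear_combination -γ * hab + hγe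
      nlinarith [mul_nonneg ha.le (sub_nonneg.2 h1), mul_nonneg hb.le (sub_nonneg.2 h2)]
  have hαe := hext α hαU (Or.inr fun t ht => hα ht)
  have hβe := hext β hβU (Or.inl fun t ht => hβ ht)
  have hαβ : ℓ α ≠ ℓ β := fun h => by have := hinj h; linarith
  have hdir : ∀ x, cr (ℓ β - ℓ α) (x - ℓ α) = (β - α) * cr (v - u) (x - u) := by
    intro x
    rw [hℓa, hℓa]; simp [cr]; ring
  obtain ⟨A, hA, hAU, hAf, -, hA2⟩ := exists_arc_of_side hSfin.toFinset (ℓ α) (ℓ β)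
    (fun s hs => by
      rw [Set.Finite.coe_toFinset]
      exact notMem_convexHull_extremePoints hUc (hSfin.mem_toFinset.1 hs))
    (hSfin.mem_toFinset.2 hαe) (hSfin.mem_toFinset.2 hβe) hαβ (by
      intro s hs hsα hsβ
      have hs' := hSfin.mem_toFinset.1 hs
      rw [hdir]
      refine mul_pos (by linarith) ((hpos s hs'.1).lt_of_ne fun h0 => ?_)
      obtain ⟨t, rfl⟩ := hline s h0.symm
      refine notMem_convexHull_extremePoints hUc hs' (convexHull_mono (s := {ℓ α, ℓ β}) ?_ ?_)
      · rintro z (rfl | rfl)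
        exacts [⟨hαe, fun h => hsα h.symm⟩, ⟨hβe, fun h => hsβ h.symm⟩]
      · rw [convexHull_pair, hseg α β (by linarith)]
        exact ⟨t, ⟨hα hs'.1, hβ hs'.1⟩, rfl⟩)
  rw [Set.Finite.coe_toFinset] at hAU hAf hA2
  rw [hSU] at hAU hAf
  have hA2 := hA2 (by
    intro h
    obtain ⟨x, hx, hxp⟩ := hex
    have : x ∈ segment ℝ (ℓ α) (ℓ β) := by rw [← convexHull_pair, ← h, hSU]; exact hx
    rw [hseg α β (by linarith)] at this
    obtain ⟨t, -, rfl⟩ := this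
    exact hxp.ne' (hcrℓ t))
  have hAt : ∀ t, α ≤ t → t ≤ β → ℓ t ∈ A → t = α ∨ t = β := by
    intro t h1 h2 ht
    rcases hA2 ⟨ht, by rw [hseg α β (by linarith)]; exact ⟨t, ⟨h1, h2⟩, rfl⟩⟩ with h | h
    · exact Or.inl (hinj h)
    · exact Or.inr (hinj h)
  have hs1 : segment ℝ u (ℓ α) = ℓ '' Set.Icc α 0 := by
    rw [segment_symm]; nth_rw 1 [← hℓ0]; exact hseg α 0 hα0
  have hs2 : segment ℝ (ℓ β) v = ℓ '' Set.Icc 1 β := by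
    rw [segment_symm]; nth_rw 1 [← hℓ1]; exact hseg 1 β hβ1
  have hs3 : segment ℝ u v = ℓ '' Set.Icc 0 1 := by
    nth_rw 1 [← hℓ0, ← hℓ1]; exact hseg 0 1 zero_le_one
  have hB : Arc u (ℓ β) (segment ℝ u (ℓ α) ∪ A) := by
    refine hA.cons_of_le ?_
    rw [hs1]
    rintro x ⟨⟨t, ht, rfl⟩, hx⟩
    rcases hAt t ht.1 (by linarith [ht.2]) hx with rfl | rfl
    · rfl
    · linarith [ht.2]
  refine ⟨segment ℝ u (ℓ α) ∪ A ∪ segment ℝ (ℓ β) v, hB.concat_of_le ?_, ?_, ?_, ?_⟩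
  · rw [hs1, hs2]
    rintro x ⟨⟨t, ht, rfl⟩ | hx, ⟨t', ht', h'⟩⟩
    · have := hinj h'; linarith [ht.2, ht'.1]
    · subst h'
      rcases hAt t' (by linarith [ht'.1]) ht'.2 hx with rfl | rfl
      · linarith [ht'.1]
      · rfl
  · exact Set.union_subset (Set.union_subset (hUc.segment_subset hu hαU) hAU)
      (hUc.segment_subset hβU hv)
  · intro x hx
    rcases hAf hx with h | h
    · exact Or.inl (Or.inl (Or.inr h))
    rw [hseg α β (by linarith)] at h
    obtain ⟨t, ht, rfl⟩ := h
    rw [hs1, hs2, hs3]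
    rcases le_total t 0 with h0 | h0
    · exact Or.inl (Or.inl (Or.inl ⟨t, ⟨ht.1, h0⟩, rfl⟩))
    rcases le_total t 1 with h1 | h1
    · exact Or.inr ⟨t, ⟨h0, h1⟩, rfl⟩
    · exact Or.inl (Or.inr ⟨t, ⟨h1, ht.2⟩, rfl⟩)
  · rw [hs1, hs2, hs3]
    rintro x ⟨(⟨t', ht', h'⟩ | hx) | ⟨t', ht', h'⟩, ⟨t, ht, rfl⟩⟩
    · obtain rfl := hinj h'
      left; rw [← hℓ0]; congr 1; linarith [ht.1, ht'.2]
    · rcases hAt t (by linarith [ht.1]) (by linarith [ht.2]) hx with rfl | rfl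
      · left; rw [← hℓ0]; congr 1; linarith [ht.1]
      · right; rw [Set.mem_singleton_iff, ← hℓ1]; congr 1; linarith [ht.2]
    · obtain rfl := hinj h'
      right; rw [Set.mem_singleton_iff, ← hℓ1]; congr 1; linarith [ht.2, ht'.1]

/-- A closed bounded set that is star-shaped and whose frontier lies on a polygonal curve inside
it is the region enclosed by the curve. -/
theorem eq_enclosedRegion {U : Set E2} {n : ℕ} (p : Polygon E2 n) (hc : IsClosed U)
    (hb : Bornology.IsBounded U) {m : E2} (hm : m ∈ U) (hstar : ∀ x ∈ U, segment ℝ m x ⊆ U)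
    (hfr : frontier U ⊆ p.boundary ℝ) (hp : p.boundary ℝ ⊆ U) : U = enclosedRegion p := by
  apply Set.Subset.antisymm
  · intro x hx
    by_cases hxp : x ∈ p.boundary ℝ
    · exact Or.inl hxp
    refine Or.inr ⟨hxp, hb.subset ?_⟩
    have hxi : x ∈ interior U := by
      by_contra hcon
      exact hxp (hfr ⟨subset_closure hx, hcon⟩)
    -- Off the curve there are no frontier points of `U`, so a component that meets the interior
    -- cannot leave it, and it is bounded.
    have h1 : connectedComponentIn (p.boundary ℝ)ᶜ x ⊆ interior U := by
      refine isPreconnected_connectedComponentIn.subset_left_of_subset_union isOpen_interior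
        hc.isOpen_compl ?_ ?_ ⟨x, mem_connectedComponentIn hxp, hxi⟩
      · exact Set.disjoint_left.2 fun y hy hy' => hy' (interior_subset hy)
      · intro y hy
        have hyp := connectedComponentIn_subset _ _ hy
        by_cases hyU : y ∈ U
        · left
          by_contra hcon
          exact hyp (hfr ⟨subset_closure hyU, hcon⟩)
        · exact Or.inr hyU
    exact h1.trans interior_subset
  · rintro x (hx | ⟨hxp, hxb⟩)
    · exact hp hx
    by_contra hxU
    have hxm : x - m ≠ 0 := fun h => hxU (by rw [sub_eq_zero.1 h]; exact hm)
    -- For `x` outside `U`, the ray from `x` away from `m` stays outside by star-shapedness. It thus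
    -- avoids the curve and makes the component of `x` unbounded.
    set R : Set E2 := (fun t : ℝ => m + t • (x - m)) '' Set.Ici 1 with hR
    have hRc : IsPreconnected R :=
      isPreconnected_Ici.image _ (by fun_prop)
    have hRU : R ⊆ (p.boundary ℝ)ᶜ := by
      rintro _ ⟨t, ht, rfl⟩ hy
      have ht' : (1 : ℝ) ≤ t := ht
      refine hxU (hstar _ (hp hy) ?_)
      rw [segment_eq_image']
      refine ⟨1 / t, ⟨by positivity, by rw [div_le_one (by linarith)]; exact ht'⟩, ?_⟩
      have : 1 / t * t = 1 := by field_simp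
      simp only [add_sub_cancel_left, smul_smul, this, one_smul, add_sub_cancel]
    have hxR : x ∈ R := ⟨1, Set.mem_Ici.2 le_rfl, by simp⟩
    have hRb := hxb.subset (hRc.subset_connectedComponentIn hxR hRU)
    obtain ⟨M, hM⟩ := hRb.exists_norm_le
    have hpos : 0 < ‖x - m‖ := norm_pos_iff.2 hxm
    have := hM (m + ((|M| + ‖m‖) / ‖x - m‖ + 1) • (x - m)) ⟨_, by
      simp only [Set.mem_Ici]; have : 0 ≤ (|M| + ‖m‖) / ‖x - m‖ := by positivity
      linarith, rfl⟩
    have h2 : ‖((|M| + ‖m‖) / ‖x - m‖ + 1) • (x - m)‖ = |M| + ‖m‖ + ‖x - m‖ := by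
      rw [norm_smul, Real.norm_of_nonneg (by positivity)]; field_simp
    have h3 := norm_sub_le (m + ((|M| + ‖m‖) / ‖x - m‖ + 1) • (x - m)) m
    rw [add_sub_cancel_left, h2] at h3
    linarith [le_abs_self M]

/-- Two convex polygons on opposite sides of a line that meet exactly in a segment form a region
bounded by a simple polygon. -/
theorem exists_simplePolygon {T₁ T₂ : Set E2} (hT₁ : T₁.Finite) (hT₂ : T₂.Finite) {u v : E2}
    (huv : u ≠ v) (hpos : ∀ x ∈ convexHull ℝ T₁, 0 ≤ cr (v - u) (x - u))
    (hneg : ∀ x ∈ convexHull ℝ T₂, cr (v - u) (x - u) ≤ 0)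
    (hex₁ : ∃ x ∈ convexHull ℝ T₁, 0 < cr (v - u) (x - u))
    (hex₂ : ∃ x ∈ convexHull ℝ T₂, cr (v - u) (x - u) < 0)
    (hi : convexHull ℝ T₁ ∩ convexHull ℝ T₂ = segment ℝ u v) :
    ∃ (n : ℕ) (p : Polygon E2 n), IsSimplePolygon p ∧
      convexHull ℝ T₁ ∪ convexHull ℝ T₂ = enclosedRegion p := by
  have hu : u ∈ convexHull ℝ T₁ ∩ convexHull ℝ T₂ := by rw [hi]; exact left_mem_segment ℝ _ _
  have hv : v ∈ convexHull ℝ T₁ ∩ convexHull ℝ T₂ := by rw [hi]; exact right_mem_segment ℝ _ _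
  have hrev : ∀ x, cr (u - v) (x - v) = -cr (v - u) (x - u) := fun x => by simp [cr]; ring
  obtain ⟨A, hA, hAU, hAf, hAi⟩ := exists_arc hT₁ huv hu.1 hv.1 hpos hex₁
  obtain ⟨B, hB, hBU, hBf, -⟩ := exists_arc hT₂ huv.symm hv.2 hu.2
    (fun x hx => by rw [hrev]; linarith [hneg x hx])
    (by obtain ⟨x, hx, h⟩ := hex₂; exact ⟨x, hx, by rw [hrev]; linarith⟩)
  obtain ⟨n, p, hp, hpb⟩ := hA.exists_polygon hB
    (fun x hx => hAi ⟨hx.1, by rw [← hi]; exact ⟨hAU hx.1, hBU hx.2⟩⟩)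
  have hk₁ := hT₁.isCompact_convexHull ℝ
  have hk₂ := hT₂.isCompact_convexHull ℝ
  refine ⟨n, p, hp, eq_enclosedRegion p (hk₁.union hk₂).isClosed (hk₁.union hk₂).isBounded
    (Or.inl hu.1) ?_ ?_ ?_⟩
  · rintro x (hx | hx)
    · exact ((convex_convexHull ℝ _).segment_subset hu.1 hx).trans Set.subset_union_left
    · exact ((convex_convexHull ℝ _).segment_subset hu.2 hx).trans Set.subset_union_right
  · intro x hx
    rw [hpb]
    have hx' : x ∈ A ∪ B ∪ segment ℝ u v := by
      rcases (frontier_union_subset _ _ hx) with h | h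
      · rcases hAf h.1 with h | h
        exacts [Or.inl (Or.inl h), Or.inr h]
      · rcases hBf h.2 with h | h
        exacts [Or.inl (Or.inr h), Or.inr (by rwa [segment_symm])]
    rcases hx' with h | h
    · exact h
    rw [segment_eq_image'] at h
    obtain ⟨t, ht, rfl⟩ := h
    rcases ht.1.eq_or_lt with h0 | h0
    · simp only [← h0, zero_smul, add_zero]; exact Or.inl hA.left_mem
    rcases ht.2.eq_or_lt with h1 | h1
    · simp only [h1, one_smul, add_sub_cancel]; exact Or.inl hA.right_mem
    obtain ⟨x₁, hx₁, hx₁p⟩ := hex₁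
    obtain ⟨x₂, hx₂, hx₂p⟩ := hex₂
    -- Points strictly inside the common segment are interior to the union, so the frontier needs
    -- only the two arcs.
    refine absurd (mem_interior_of_triangles (C := convexHull ℝ T₁ ∪ convexHull ℝ T₂)
      ((convexHull_min ?_ (convex_convexHull ℝ T₂)).trans Set.subset_union_right)
      ((convexHull_min ?_ (convex_convexHull ℝ T₁)).trans Set.subset_union_left)
      hx₂p hx₁p h0 h1 rfl) hx.2
    · rintro z (rfl | rfl | rfl)
      exacts [hu.2, hv.2, hx₂]
    · rintro z (rfl | rfl | rfl)
      exacts [hu.1, hv.1, hx₁]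
  · rw [hpb]
    exact Set.union_subset_union hAU hBU

end PlanarArc

end

/-! ### Placing faces in the plane; segments crossing the line of an edge -/

section

namespace Polyhedron

open InnerProductGeometry PlanarArc

variable {P : Set E3}

/-- Orthonormal coordinates in the plane of a face adapted to one of its edges. -/
theorem Face.edge_frame (f : Face P) {u v : Vertex P}
    (h : (skeleton P).Adj u v) (hf : segment ℝ (u : E3) (v : E3) ⊆ f.carrier) :
    ∃ i j : E3, ‖i‖ = 1 ∧ ‖j‖ = 1 ∧ inner ℝ i j = 0 ∧ (v : E3) - u = dist (u : E3) v • i ∧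
      (∀ x ∈ f.carrier, x - u = inner ℝ i (x - u) • i + inner ℝ j (x - u) • j) ∧
      (∀ x ∈ f.carrier, 0 ≤ inner ℝ j (x - u)) ∧
      (∀ x ∈ f.carrier, inner ℝ j (x - u) = 0 → x ∈ segment ℝ (u : E3) (v : E3)) ∧
      ∃ x ∈ f.carrier, 0 < inner ℝ j (x - u) := by
  have hd := adj_sub_ne_zero h
  have hd' : 0 < ‖(v : E3) - u‖ := norm_pos_iff.2 hd
  have huf : (u : E3) ∈ f.carrier := hf (left_mem_segment ℝ _ _)
  have hvf : (v : E3) ∈ f.carrier := hf (right_mem_segment ℝ _ _)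
  set i : E3 := ‖(v : E3) - u‖⁻¹ • ((v : E3) - u) with hi
  have hi1 : ‖i‖ = 1 := by
    rw [hi, norm_smul, norm_inv, norm_norm, inv_mul_cancel₀ hd'.ne']
  have hvi : (v : E3) - u = dist (u : E3) v • i := by
    rw [hi, dist_comm, dist_eq_norm, smul_smul, mul_inv_cancel₀ hd'.ne', one_smul]
  obtain ⟨q, hq1, -, hiq, hframe⟩ := exists_frame (n := f.normal) f.normal_ne_zero hi1
    (by rw [hi, inner_smul_right, ((f.mem_iff huf).1 hvf).2, mul_zero])
  obtain ⟨m, hm, hm0⟩ := exists_edge_functional h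
  have hmi : inner ℝ m i = 0 := by
    rw [hi, inner_smul_right, (hm0 v v.2.1).2 (right_mem_segment ℝ _ _), mul_zero]
  clear_value i
  have hfr : ∀ x ∈ f.carrier, x - u = inner ℝ i (x - u) • i + inner ℝ q (x - u) • q :=
    fun x hx => hframe _ ((f.mem_iff huf).1 hx).2
  have hmq : ∀ x ∈ f.carrier, inner ℝ m (x - u) = inner ℝ q (x - u) * inner ℝ m q := by
    intro x hx
    nth_rw 1 [hfr x hx]
    rw [inner_add_right, inner_smul_right, inner_smul_right, hmi]; ring
  have hκ : inner ℝ m q ≠ 0 := by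
    intro h0
    refine f.not_collinear (u : E3) ((v : E3) - u) fun x hx => ?_
    have := (hm0 x hx.1).1 (by rw [hmq x hx, h0, mul_zero])
    rw [segment_eq_image'] at this
    obtain ⟨t, -, rfl⟩ := this
    exact ⟨t, by simp⟩
  obtain ⟨j, hj1, hij, hfrj, hmj, hκj⟩ : ∃ j : E3, ‖j‖ = 1 ∧ inner ℝ i j = 0 ∧
      (∀ x ∈ f.carrier, x - u = inner ℝ i (x - u) • i + inner ℝ j (x - u) • j) ∧
      (∀ x ∈ f.carrier, inner ℝ m (x - u) = inner ℝ j (x - u) * inner ℝ m j) ∧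
      inner ℝ m j < 0 := by
    rcases lt_or_gt_of_ne hκ with h0 | h0
    · exact ⟨q, hq1, hiq, hfr, hmq, h0⟩
    · refine ⟨-q, by rwa [norm_neg], by rw [inner_neg_right, hiq, neg_zero], fun x hx => ?_,
        fun x hx => ?_, by rw [inner_neg_right]; linarith⟩
      · nth_rw 1 [hfr x hx]
        rw [inner_neg_left]; module
      · rw [hmq x hx, inner_neg_left, inner_neg_right]; ring
  have hnn : ∀ x ∈ f.carrier, 0 ≤ inner ℝ j (x - u) := by
    intro x hx
    have := hm x hx.1
    rw [hmj x hx] at this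
    by_contra hcon
    push Not at hcon
    nlinarith
  have hz : ∀ x ∈ f.carrier, inner ℝ j (x - u) = 0 → x ∈ segment ℝ (u : E3) (v : E3) :=
    fun x hx h0 => (hm0 x hx.1).1 (by rw [hmj x hx, h0, zero_mul])
  refine ⟨i, j, hi1, hj1, hij, hvi, hfrj, hnn, hz, ?_⟩
  by_contra hcon
  push Not at hcon
  refine f.not_collinear (u : E3) ((v : E3) - u) fun x hx => ?_
  have := hz x hx (le_antisymm (hcon x hx) (hnn x hx))
  rw [segment_eq_image'] at this
  obtain ⟨t, -, rfl⟩ := this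
  exact ⟨t, by simp⟩

/-- A face can be placed in the plane with a given position of one edge, on a given side of it. -/
theorem Face.exists_placement (f : Face P) {u v : Vertex P}
    (h : (skeleton P).Adj u v) (hf : segment ℝ (u : E3) (v : E3) ⊆ f.carrier) {p q : E2}
    (hpq : dist p q = dist (u : E3) v) {σ : ℝ} (hσ : σ ≠ 0) :
    ∃ ψ : E3 →ᵃ[ℝ] E2, (∀ x ∈ f.carrier, ∀ y ∈ f.carrier, dist (ψ x) (ψ y) = dist x y) ∧
      ψ u = p ∧ ψ v = q ∧ (∀ x ∈ f.carrier, σ * cr (q - p) (ψ x - p) ≤ 0) ∧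
      (∀ x ∈ f.carrier, cr (q - p) (ψ x - p) = 0 → x ∈ segment ℝ (u : E3) (v : E3)) ∧
      ∃ x ∈ f.carrier, σ * cr (q - p) (ψ x - p) < 0 := by
  obtain ⟨i, j, hi, hj, hij, hvi, hfr, hnn, hz, x₀, hx₀, hx₀p⟩ := f.edge_frame h hf
  set L := dist (u : E3) v with hL
  have hL0 : 0 < L := dist_pos.2 fun h0 => h.1 (Subtype.ext h0)
  -- The sign `s` decides whether the frame of the face is placed directly or reflected, and thereby
  -- on which side of the line the face lands.
  obtain ⟨s, hs, hσs⟩ : ∃ s : ℝ, s ^ 2 = 1 ∧ σ * s < 0 := by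
    rcases lt_or_gt_of_ne hσ with h0 | h0
    · exact ⟨1, by norm_num, by linarith⟩
    · exact ⟨-1, by norm_num, by linarith⟩
  have hs0 : s ≠ 0 := by rintro rfl; norm_num at hs
  have haux : ∀ {a b : E3}, a = inner ℝ i a • i + inner ℝ j a • j →
      b = inner ℝ i b • i + inner ℝ j b • j →
      a - b = inner ℝ i (a - b) • i + inner ℝ j (a - b) • j := by
    intro a b ha hb
    rw [inner_sub_right, inner_sub_right, sub_smul, sub_smul]
    nth_rw 1 [ha, hb]
    abel
  set I : E2 := L⁻¹ • (q - p) with hI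
  set J : E2 := !₂[-I 1, I 0] with hJ
  have hqp : q - p = L • I := by rw [hI, smul_smul, mul_inv_cancel₀ hL0.ne', one_smul]
  have hI1 : I 0 ^ 2 + I 1 ^ 2 = 1 := by
    have h1 : ‖I‖ = 1 := by
      rw [hI, norm_smul, norm_inv, Real.norm_of_nonneg hL0.le, ← dist_eq_norm, dist_comm, hpq,
        inv_mul_cancel₀ hL0.ne']
    have h2 := EuclideanSpace.norm_sq_eq I
    rw [h1] at h2
    simpa using h2.symm
  have hcr : ∀ α β : ℝ, cr (q - p) (α • I + β • J) = L * β := by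
    intro α β
    rw [hqp]
    simp [cr, hJ]
    linear_combination L * β * hI1
  have hnorm : ∀ α β : ℝ, ‖α • I + β • J‖ ^ 2 = α ^ 2 + β ^ 2 := by
    intro α β
    rw [EuclideanSpace.norm_sq_eq]
    simp [hJ]
    linear_combination (α ^ 2 + β ^ 2) * hI1
  set A : E3 →ₗ[ℝ] E2 := (innerₛₗ ℝ i).smulRight I + (s • innerₛₗ ℝ j).smulRight J with hA
  have hAx : ∀ x, A x = inner ℝ i x • I + (s * inner ℝ j x) • J := fun x => by
    simp [hA]
  set ψ : E3 →ᵃ[ℝ] E2 := AffineMap.const ℝ E3 (p - A u) + A.toAffineMap with hψ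
  have hψx : ∀ x, ψ x - p = A (x - u) := fun x => by
    simp [hψ]; abel
  have hψu : ψ u = p := by have := hψx u; rw [sub_self, map_zero, sub_eq_zero] at this; exact this
  have hcrψ : ∀ x, cr (q - p) (ψ x - p) = L * (s * inner ℝ j (x - u)) := fun x => by
    rw [hψx, hAx, hcr]
  refine ⟨ψ, fun x hx y hy => ?_, hψu, ?_, fun x hx => ?_, fun x hx h0 => ?_, x₀, hx₀, ?_⟩
  · have h1 : ψ x - ψ y = A (x - y) := by
      rw [← sub_sub_sub_cancel_right _ _ p, hψx, hψx, ← map_sub, sub_sub_sub_cancel_right]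
    have h2 : x - y = inner ℝ i (x - y) • i + inner ℝ j (x - y) • j := by
      have e : x - y = (x - u) - (y - u) := by abel
      rw [e]
      exact haux (hfr x hx) (hfr y hy)
    rw [dist_eq_norm, dist_eq_norm, h1, hAx]
    rw [← sq_eq_sq₀ (norm_nonneg _) (norm_nonneg _), hnorm]
    nth_rw 3 [h2]
    rw [norm_add_sq_real, norm_smul, norm_smul, hi, hj, inner_smul_left, inner_smul_right, hij]
    simp only [mul_one, Real.norm_eq_abs, sq_abs, mul_zero, add_zero]
    linear_combination (inner ℝ j (x - y)) ^ 2 * hs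
  · have h1 : ψ v - p = q - p := by
      rw [hψx, hAx, hvi, hqp, inner_smul_right, inner_smul_right, real_inner_self_eq_norm_sq, hi,
        real_inner_comm, hij]
      simp
    exact sub_left_injective h1
  · rw [hcrψ]
    have := mul_nonneg hL0.le (hnn x hx)
    nlinarith
  · rw [hcrψ] at h0
    refine hz x hx ?_
    simpa [hL0.ne', hs0] using h0
  · rw [hcrψ]
    have := mul_pos hL0 hx₀p
    nlinarith

/-- An affine image of a face lies on one side of the image of an edge. -/
theorem Face.exists_side (f : Face P) {u v : Vertex P}
    (h : (skeleton P).Adj u v) (hf : segment ℝ (u : E3) (v : E3) ⊆ f.carrier)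
    (ψ : E3 →ᵃ[ℝ] E2) :
    ∃ σ : ℝ, σ ≠ 0 ∧ ∀ x ∈ f.carrier, 0 ≤ σ * cr (ψ v - ψ u) (ψ x - ψ u) := by
  obtain ⟨i, j, -, -, -, hvi, hfr, hnn, -, -⟩ := f.edge_frame h hf
  have hψ : ∀ x y, ψ x - ψ y = ψ.linear (x - y) := fun x y => (ψ.linearMap_vsub x y).symm
  have hcr : ∀ x ∈ f.carrier, cr (ψ v - ψ u) (ψ x - ψ u) =
      inner ℝ j (x - u) * cr (ψ v - ψ u) (ψ.linear j) := by
    intro x hx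
    rw [hψ x u]
    nth_rw 1 [hfr x hx]
    rw [map_add, map_smul, map_smul, cr_add_right, cr_smul_right, cr_smul_right, hψ, hvi, map_smul,
      cr_swap _ (ψ.linear i), cr_smul_right, cr_self]
    ring
  by_cases h0 : cr (ψ v - ψ u) (ψ.linear j) = 0
  · exact ⟨1, one_ne_zero, fun x hx => by rw [hcr x hx, h0]; simp⟩
  · refine ⟨_, h0, fun x hx => ?_⟩
    rw [hcr x hx]
    have := hnn x hx
    have := mul_self_nonneg (cr (ψ v - ψ u) (ψ.linear j))
    nlinarith [mul_nonneg (hnn x hx) this]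

end Polyhedron

namespace PlanarArc

open InnerProductGeometry

/-- A segment that crosses the line of a side within the angle at its end crosses it on the right
side of that end. -/
theorem crossing_param_nonneg {p q x y : E2} (hpq : p ≠ q) {σ : ℝ}
    (hx : 0 ≤ σ * cr (q - p) (x - p)) (hy : σ * cr (q - p) (y - p) < 0)
    (hang : x ≠ p → EuclideanGeometry.angle x p q < Real.pi ∧
      EuclideanGeometry.angle x p q + EuclideanGeometry.angle q p y ≤ Real.pi)
    {t s : ℝ} (ht0 : 0 ≤ t) (ht1 : t ≤ 1) (hz : x + t • (y - x) = p + s • (q - p)) : 0 ≤ s := by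
  by_contra hs
  push Not at hs
  simp only [EuclideanGeometry.angle, vsub_eq_sub] at hang
  have hd : q - p ≠ 0 := sub_ne_zero.2 hpq.symm
  have hxp : x ≠ p ↔ x - p ≠ 0 := sub_ne_zero.symm
  rw [hxp] at hang
  have hXY : s • (q - p) = (1 - t) • (x - p) + t • (y - p) := by
    have : s • (q - p) = x + t • (y - x) - p := by rw [hz]; abel
    rw [this]; module
  clear hz hxp
  generalize x - p = X at *
  generalize y - p = Y at *
  generalize q - p = d at *
  have hcr : (1 - t) * (σ * cr d X) + t * (σ * cr d Y) = 0 := by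
    have := congrArg (fun z => σ * cr d z) hXY
    simp only [cr_add_right, cr_smul_right, cr_self] at this
    linarith
  have hsd : s • d ≠ 0 := smul_ne_zero hs.ne hd
  have hX0 : X ≠ 0 := by
    rintro rfl
    rw [cr_zero, mul_zero, mul_zero, zero_add, mul_eq_zero] at hcr
    rcases hcr with rfl | h0
    · simp at hXY; exact hsd (by simpa using hXY)
    · exact hy.ne h0
  obtain ⟨hlt, hle⟩ := hang hX0
  rcases hx.eq_or_lt with h0 | h0
  · rw [← h0, mul_zero, zero_add, mul_eq_zero] at hcr
    rcases hcr with rfl | hcr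
    · rw [sub_zero, one_smul, zero_smul, add_zero] at hXY
      refine hlt.ne ?_
      rw [angle_comm, angle_eq_pi_iff]
      exact ⟨hd, s, hs, hXY.symm⟩
    · exact hy.ne hcr
  -- A crossing at `s < 0` has direction `-d` from `p`. The angles of `X` and `Y` with `-d` are the
  -- supplements of those with `d`, which add up to at most π, so the angle from `X` to `Y` is π.
  -- Then `X` and `Y` are opposite and the crossing would be at `p` itself.
  · have hneg : ∀ Z : E2, angle (s • d) Z = Real.pi - angle d Z := fun Z => by
      rw [angle_smul_left_of_neg _ _ hs, angle_neg_left]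
    have hadd := Polyhedron.angle_add_of_cone hsd (sub_nonneg.2 ht1) ht0 hXY
    rw [angle_comm X (s • d), hneg, hneg, angle_comm d X] at hadd
    have hpi : angle X Y = Real.pi := le_antisymm (angle_le_pi _ _) (by linarith)
    obtain ⟨-, r, -, rfl⟩ := angle_eq_pi_iff.1 hpi
    rw [cr_smul_right] at hcr
    have h1 : ((1 - t) + t * r) * (σ * cr d X) = 0 := by linarith
    have h2 : (1 - t) + t * r = 0 := by simpa [h0.ne'] using h1
    refine hsd ?_
    rw [hXY, smul_smul, ← add_smul, h2, zero_smul]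

theorem wOppSide_of_cr {p q x y : E2} (hpq : p ≠ q) {σ : ℝ} (hσ : σ ≠ 0)
    (hx : 0 ≤ σ * cr (q - p) (x - p)) (hy : σ * cr (q - p) (y - p) ≤ 0) :
    (affineSpan ℝ {p, q}).WOppSide x y := by
  have hd : q - p ≠ 0 := sub_ne_zero.2 hpq.symm
  have hline : ∀ z, cr (q - p) (z - p) = 0 → z ∈ affineSpan ℝ {p, q} := by
    intro z hz
    obtain ⟨t, ht⟩ := eq_smul_of_cr_eq_zero hd hz
    rw [← AffineSubspace.vsub_right_mem_direction_iff_mem (left_mem_affineSpan_pair ℝ p q),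
      vsub_eq_sub, ht, direction_affineSpan]
    exact Submodule.smul_mem _ _ (vsub_mem_vectorSpan ℝ (by simp) (by simp))
  set J : E2 := !₂[-(q - p) 1, (q - p) 0] with hJ
  have hcJ : 0 < cr (q - p) J := by
    have h2 := EuclideanSpace.norm_sq_eq (q - p)
    have h3 : 0 < ‖q - p‖ ^ 2 := by positivity
    rw [h2] at h3
    have : cr (q - p) J = ∑ i, ‖(q - p) i‖ ^ 2 := by
      simp [cr, hJ, Fin.sum_univ_two]; ring
    rw [this]; exact h3
  have hproj : ∀ z, z - (cr (q - p) (z - p) / cr (q - p) J) • J ∈ affineSpan ℝ {p, q} := by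
    intro z
    apply hline
    have : z - (cr (q - p) (z - p) / cr (q - p) J) • J - p =
      (z - p) + (-(cr (q - p) (z - p) / cr (q - p) J)) • J := by module
    rw [this, cr_add_right, cr_smul_right]
    field_simp; ring
  refine ⟨_, hproj x, _, hproj y, ?_⟩
  rw [vsub_eq_sub, vsub_eq_sub, sub_sub_cancel, sub_sub_cancel_left, ← neg_smul]
  rcases lt_or_gt_of_ne hσ with h0 | h0
  · have h1 : cr (q - p) (x - p) ≤ 0 := by by_contra hc; push Not at hc; nlinarith
    have h2 : 0 ≤ cr (q - p) (y - p) := by by_contra hc; push Not at hc; nlinarith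
    have e1 : cr (q - p) (x - p) / cr (q - p) J ≤ 0 := div_nonpos_of_nonpos_of_nonneg h1 hcJ.le
    have e2 : 0 ≤ cr (q - p) (y - p) / cr (q - p) J := div_nonneg h2 hcJ.le
    rw [← sameRay_neg_iff, ← neg_smul, ← neg_smul]
    exact ((SameRay.refl J).nonneg_smul_left (by linarith)).nonneg_smul_right (by linarith)
  · have h1 : 0 ≤ cr (q - p) (x - p) := by by_contra hc; push Not at hc; nlinarith
    have h2 : cr (q - p) (y - p) ≤ 0 := by by_contra hc; push Not at hc; nlinarith
    have e1 : 0 ≤ cr (q - p) (x - p) / cr (q - p) J := div_nonneg h1 hcJ.le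
    have e2 : cr (q - p) (y - p) / cr (q - p) J ≤ 0 := div_nonpos_of_nonpos_of_nonneg h2 hcJ.le
    exact ((SameRay.refl J).nonneg_smul_left (by linarith)).nonneg_smul_right (by linarith)

end PlanarArc

end

/-! ### Convex layouts and the attachment of one face -/

section

namespace Polyhedron

open PlanarArc

variable {P : Set E3}

theorem JoinedAt.symm {K : Set (Sym2 (Vertex P))} {x : E3} {f g : Face P} (h : JoinedAt K x f g) :
    JoinedAt K x g f := by
  obtain ⟨u, v, huv, hK, hx, hf, hg⟩ := h
  exact ⟨u, v, huv, hK, hx, hg, hf⟩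

theorem ConnectedAt.symm {K : Set (Sym2 (Vertex P))} {x : E3} {f g : Face P}
    (h : ConnectedAt K x f g) : ConnectedAt K x g f :=
  reflTransGen_symm (fun _ _ => JoinedAt.symm) h

theorem ConnectedAt.mono {K K' : Set (Sym2 (Vertex P))} (hK : K' ⊆ K) {x : E3} {f g : Face P}
    (h : ConnectedAt K x f g) : ConnectedAt K' x f g := by
  induction h with
  | refl => exact .refl
  | tail _ h ih =>
    obtain ⟨u, v, huv, hK', hx, hf, hg⟩ := h
    exact ih.tail ⟨u, v, huv, fun h => hK' (hK h), hx, hf, hg⟩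

theorem ConnectedAt.mem {K : Set (Sym2 (Vertex P))} {x : E3} {f g : Face P}
    (h : ConnectedAt K x f g) (hx : x ∈ f.carrier) : x ∈ g.carrier := by
  induction h with
  | refl => exact hx
  | tail _ h _ =>
    obtain ⟨u, v, -, -, hx, -, hg⟩ := h
    exact hg hx

open Classical in
/-- The total angle at `w` of the faces of `S` that are joined to `f` around `w`. -/
noncomputable def fan (K : Set (Sym2 (Vertex P))) (S : Finset (Face P)) (w : Vertex P)
    (f : Face P) : ℝ :=
  ∑ g ∈ S with ConnectedAt K (w : E3) f g, g.angle w

theorem fan_congr {K : Set (Sym2 (Vertex P))} (S : Finset (Face P)) {w : Vertex P} {f g : Face P}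
    (h : ConnectedAt K (w : E3) f g) : fan K S w f = fan K S w g := by
  classical
  unfold fan
  congr 1
  ext k
  simp only [Finset.mem_filter, and_congr_right_iff]
  exact fun _ => ⟨fun hk => h.symm.trans hk, fun hk => h.trans hk⟩

theorem fan_mono {K : Set (Sym2 (Vertex P))} {S S' : Finset (Face P)} (hS : S ⊆ S')
    (w : Vertex P) (f : Face P) : fan K S w f ≤ fan K S' w f := by
  classical
  exact Finset.sum_le_sum_of_subset_of_nonneg (Finset.filter_subset_filter _ hS)
    fun g _ _ => g.angle_nonneg w

theorem angle_le_fan {K : Set (Sym2 (Vertex P))} {S : Finset (Face P)} (w : Vertex P) {f g : Face P}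
    (hg : g ∈ S) (h : ConnectedAt K (w : E3) f g) : g.angle w ≤ fan K S w f := by
  classical
  exact Finset.single_le_sum (f := fun g : Face P => g.angle w) (fun g _ => g.angle_nonneg w)
    (Finset.mem_filter.2 ⟨hg, h⟩)

open Classical in
theorem fan_insert {K : Set (Sym2 (Vertex P))} {S : Finset (Face P)} {w : Vertex P} {f g : Face P}
    (hg : g ∉ S) (h : ConnectedAt K (w : E3) f g) :
    fan K (insert g S) w f = g.angle w + fan K S w f := by
  unfold fan
  rw [Finset.filter_insert, if_pos h, Finset.sum_insert]
  simp [hg]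

theorem fan_le_sideAngle [Finite (Face P)] (K : Set (Sym2 (Vertex P))) (S : Finset (Face P))
    (w : Vertex P) (f : Face P) : fan K S w f ≤ sideAngle K w f := by
  classical
  have := Fintype.ofFinite (Face P)
  refine (fan_mono S.subset_univ w f).trans (le_of_eq ?_)
  unfold fan sideAngle
  rw [finsum_mem_eq_finite_toFinset_sum _ (Set.toFinite _)]
  congr 1
  ext g
  simp

/-- The plane set covered by the faces in `S`. -/
def region (S : Finset (Face P)) (φ : Face P → E3 →ᵃ[ℝ] E2) : Set E2 :=
  ⋃ f ∈ S, φ f '' f.carrier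

theorem mem_region {S : Finset (Face P)} {φ : Face P → E3 →ᵃ[ℝ] E2} {y : E2} :
    y ∈ region S φ ↔ ∃ f ∈ S, ∃ x ∈ f.carrier, φ f x = y := by
  simp [region]

/-- The faces in `S` are laid out by `φ` as a convex plane region, attached to each other along
the edges outside `K`. -/
structure Layout (K : Set (Sym2 (Vertex P))) (S : Finset (Face P))
    (φ : Face P → E3 →ᵃ[ℝ] E2) : Prop where
  isometry : ∀ f ∈ S, ∀ x ∈ f.carrier, ∀ y ∈ f.carrier, dist (φ f x) (φ f y) = dist x y
  -- Connectedness of the layout across uncut edges, phrased so that it can be applied directly to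
  -- mod 2 chains.
  connected : ∀ c : Face P → ZMod 2, (∀ f ∈ S, ∀ g ∈ S, ∀ u v : Vertex P, (skeleton P).Adj u v →
    s(u, v) ∉ K → segment ℝ (u : E3) (v : E3) ⊆ f.carrier →
    segment ℝ (u : E3) (v : E3) ⊆ g.carrier → c f = c g) → ∀ f ∈ S, ∀ g ∈ S, c f = c g
  attached : ∀ f ∈ S, ∀ g ∈ S, ∀ u v : Vertex P, (skeleton P).Adj u v → s(u, v) ∉ K →
    segment ℝ (u : E3) (v : E3) ⊆ f.carrier → segment ℝ (u : E3) (v : E3) ⊆ g.carrier →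
    φ f u = φ g u
  opposite : ∀ f ∈ S, ∀ g ∈ S, f ≠ g → ∀ u v : Vertex P, (skeleton P).Adj u v → s(u, v) ∉ K →
    segment ℝ (u : E3) (v : E3) ⊆ f.carrier → segment ℝ (u : E3) (v : E3) ⊆ g.carrier →
    ∀ x ∈ f.carrier, ∀ y ∈ g.carrier,
      (affineSpan ℝ {φ f u, φ f v}).WOppSide (φ f x) (φ g y)
  convex : Convex ℝ (region S φ)
  angle_le : ∀ f ∈ S, ∀ w : Vertex P, (w : E3) ∈ f.carrier → ∀ x ∈ region S φ, ∀ y ∈ region S φ,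
    x ≠ φ f w → y ≠ φ f w → EuclideanGeometry.angle x (φ f w) y ≤ fan K S w f
  -- Edges on the rim are those that are cut and those that only one placed face contains. The cut
  -- case is needed for gluing the two halves, the other one for attaching the next face.
  side : ∀ f ∈ S, ∀ u v : Vertex P, (skeleton P).Adj u v →
    segment ℝ (u : E3) (v : E3) ⊆ f.carrier →
    (s(u, v) ∈ K ∨ ∀ g ∈ S, segment ℝ (u : E3) (v : E3) ⊆ g.carrier → g = f) →
    ∃ σ : ℝ, σ ≠ 0 ∧ ∀ y ∈ region S φ, 0 ≤ σ * cr (φ f v - φ f u) (y - φ f u)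
  injective : ∀ f ∈ S, ∀ g ∈ S, ∀ x ∈ f.carrier, ∀ y ∈ g.carrier, φ f x = φ g y →
    x = y ∧ ConnectedAt K x f g

theorem angle_eq_of_dist_eq {V₁ V₂ : Type*} [NormedAddCommGroup V₁] [InnerProductSpace ℝ V₁]
    [NormedAddCommGroup V₂] [InnerProductSpace ℝ V₂] {a b c : V₁} {a' b' c' : V₂}
    (hab : dist a' b' = dist a b) (hcb : dist c' b' = dist c b) (hac : dist a' c' = dist a c) :
    EuclideanGeometry.angle a' b' c' = EuclideanGeometry.angle a b c := by
  simp only [EuclideanGeometry.angle, vsub_eq_sub, InnerProductGeometry.angle]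
  simp only [dist_eq_norm] at hab hcb hac
  have h1 : inner ℝ (a' - b') (c' - b') = inner ℝ (a - b) (c - b) := by
    rw [real_inner_eq_norm_mul_self_add_norm_mul_self_sub_norm_sub_mul_self_div_two,
      real_inner_eq_norm_mul_self_add_norm_mul_self_sub_norm_sub_mul_self_div_two]
    simp only [sub_sub_sub_cancel_right, hab, hcb, hac]
  rw [h1, hab, hcb]

theorem affineMap_eq_on_segment {φ ψ : E3 →ᵃ[ℝ] E2} {u v x : E3} (hu : φ u = ψ u) (hv : φ v = ψ v)
    (hx : x ∈ segment ℝ u v) : φ x = ψ x := by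
  rw [segment_eq_image_lineMap] at hx
  obtain ⟨t, -, rfl⟩ := hx
  rw [AffineMap.apply_lineMap, AffineMap.apply_lineMap, hu, hv]

/-- A functional exposing the edge `u v` is nonpositive at `a` and `b` and vanishes at their
midpoint, hence at both. Midpoints can therefore serve to identify edges. -/
theorem edge_eq_of_midpoint_mem {u v a b : Vertex P} (huv : (skeleton P).Adj u v)
    (hab : (skeleton P).Adj a b) (h : midpoint ℝ (a : E3) (b : E3) ∈ segment ℝ (u : E3) (v : E3)) :
    s(a, b) = s(u, v) := by
  obtain ⟨m, hm, hm0⟩ := exists_edge_functional huv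
  have hmid : midpoint ℝ (a : E3) (b : E3) ∈ P :=
    huv.2.subset h
  have h1 := (hm0 _ hmid).2 h
  have h2 : inner ℝ m (midpoint ℝ (a : E3) (b : E3) - u) =
      2⁻¹ * inner ℝ m ((a : E3) - u) + 2⁻¹ * inner ℝ m ((b : E3) - u) := by
    rw [← inner_smul_right, ← inner_smul_right, ← inner_add_right, midpoint_eq_smul_add]
    congr 1
    simp only [invOf_eq_inv]
    module
  have ha := hm a a.2.1
  have hb := hm b b.2.1
  have ha' := vertex_mem_segment ((hm0 a a.2.1).1 (by linarith))
  have hb' := vertex_mem_segment ((hm0 b b.2.1).1 (by linarith))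
  have hne := hab.1
  rcases ha' with rfl | rfl <;> rcases hb' with rfl | rfl
  · exact absurd rfl hne
  · rfl
  · exact Sym2.eq_swap
  · exact absurd rfl hne

/-- Localisation: angles at `c` do not change when points are drawn towards `c` (`angle_near`), so
where `c` is off the closed set `C`, only the rest of the region matters. -/
theorem exists_near {C : Set E2} (hC : IsClosed C) {c : E2} (hc : c ∉ C) (x : E2) :
    ∃ ε : ℝ, 0 < ε ∧ ε ≤ 1 ∧ c + ε • (x - c) ∉ C := by
  have h1 : ∀ᶠ ε : ℝ in nhds 0, c + ε • (x - c) ∉ C := by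
    have : Continuous fun ε : ℝ => c + ε • (x - c) := by fun_prop
    exact this.continuousAt.eventually_mem (hC.isOpen_compl.mem_nhds (by simpa using hc))
  obtain ⟨δ, hδ, h⟩ := Metric.eventually_nhds_iff.1 h1
  refine ⟨min (δ / 2) 1, by positivity, min_le_right _ _, h ?_⟩
  rw [Real.dist_eq, sub_zero, abs_of_pos (by positivity)]
  linarith [min_le_left (δ / 2) 1]

theorem mem_of_near {U : Set E2} (hU : Convex ℝ U) {c x : E2} (hc : c ∈ U) (hx : x ∈ U) {ε : ℝ}
    (h0 : 0 < ε) (h1 : ε ≤ 1) : c + ε • (x - c) ∈ U :=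
  hU.segment_subset hc hx (by rw [segment_eq_image']; exact ⟨ε, ⟨h0.le, h1⟩, rfl⟩)

theorem angle_near {c x y : E2} {ε δ : ℝ} (hε : 0 < ε) (hδ : 0 < δ) :
    EuclideanGeometry.angle (c + ε • (x - c)) c (c + δ • (y - c)) =
      EuclideanGeometry.angle x c y := by
  simp only [EuclideanGeometry.angle, vsub_eq_sub, add_sub_cancel_left]
  rw [InnerProductGeometry.angle_smul_left_of_pos _ _ hε,
    InnerProductGeometry.angle_smul_right_of_pos _ _ hδ]

theorem near_ne {c x : E2} {ε : ℝ} (hε : 0 < ε) (hx : x ≠ c) : c + ε • (x - c) ≠ c := by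
  intro h
  have : ε • (x - c) = 0 := by simpa using h
  rcases smul_eq_zero.1 this with h | h
  · exact hε.ne' h
  · exact hx (sub_eq_zero.1 h)

theorem isCompact_image_face (hP : IsConvexPolyhedron P) (f : Face P) (ψ : E3 →ᵃ[ℝ] E2) :
    IsCompact (ψ '' f.carrier) := by
  have h : f.carrier = convexHull ℝ (f.carrier ∩ P.extremePoints ℝ) :=
    support_eq_convexHull hP f.normal
  have : IsCompact f.carrier := by
    rw [h]
    exact (hP.finite_extremePoints.subset Set.inter_subset_right).isCompact_convexHull ℝ
  exact this.image ψ.continuous_of_finiteDimensional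

theorem isCompact_region (hP : IsConvexPolyhedron P) (S : Finset (Face P))
    (φ : Face P → E3 →ᵃ[ℝ] E2) : IsCompact (region S φ) :=
  S.isCompact_biUnion fun f _ => isCompact_image_face hP f (φ f)

/-- The face `f'` is placed by `ψ` next to a layout, so that it is attached to `f` along the
edge `u v`. -/
structure Attachment (K : Set (Sym2 (Vertex P))) (S : Finset (Face P))
    (φ : Face P → E3 →ᵃ[ℝ] E2) (f f' : Face P) (u v : Vertex P) (ψ : E3 →ᵃ[ℝ] E2) : Prop where
  layout : Layout K S φ
  mem : f ∈ S
  notMem : f' ∉ S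
  adj : (skeleton P).Adj u v
  uncut : s(u, v) ∉ K
  left : segment ℝ (u : E3) (v : E3) ⊆ f.carrier
  right : segment ℝ (u : E3) (v : E3) ⊆ f'.carrier
  isometry : ∀ x ∈ f'.carrier, ∀ y ∈ f'.carrier, dist (ψ x) (ψ y) = dist x y
  map_fst : ψ u = φ f u
  map_snd : ψ v = φ f v
  separated : ∃ σ : ℝ, σ ≠ 0 ∧ (∀ y ∈ region S φ, 0 ≤ σ * cr (φ f v - φ f u) (y - φ f u)) ∧
    (∀ x ∈ f'.carrier, σ * cr (φ f v - φ f u) (ψ x - φ f u) ≤ 0) ∧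
    ∀ x ∈ f'.carrier, cr (φ f v - φ f u) (ψ x - φ f u) = 0 → x ∈ segment ℝ (u : E3) (v : E3)

namespace Attachment

variable {K : Set (Sym2 (Vertex P))} {S : Finset (Face P)} {φ : Face P → E3 →ᵃ[ℝ] E2}
  {f f' : Face P} {u v : Vertex P} {ψ : E3 →ᵃ[ℝ] E2}

theorem symm (A : Attachment K S φ f f' u v ψ) : Attachment K S φ f f' v u ψ where
  layout := A.layout
  mem := A.mem
  notMem := A.notMem
  adj := A.adj.symm
  uncut := by rw [Sym2.eq_swap]; exact A.uncut
  left := by rw [segment_symm]; exact A.left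
  right := by rw [segment_symm]; exact A.right
  isometry := A.isometry
  map_fst := A.map_snd
  map_snd := A.map_fst
  separated := by
    obtain ⟨σ, hσ, h1, h2, h3⟩ := A.separated
    have hrev : ∀ y, cr (φ f u - φ f v) (y - φ f v) = -cr (φ f v - φ f u) (y - φ f u) :=
      fun y => by simp [cr]; ring
    refine ⟨-σ, neg_ne_zero.2 hσ, fun y hy => ?_, fun x hx => ?_, fun x hx h0 => ?_⟩
    · rw [hrev, neg_mul_neg]; exact h1 y hy
    · rw [hrev, neg_mul_neg]; exact h2 x hx
    · rw [segment_symm]; exact h3 x hx (by rw [hrev] at h0; linarith)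

theorem eq_on (A : Attachment K S φ f f' u v ψ) {x : E3} (hx : x ∈ segment ℝ (u : E3) (v : E3)) :
    ψ x = φ f x :=
  affineMap_eq_on_segment A.map_fst A.map_snd hx

theorem joinedAt (A : Attachment K S φ f f' u v ψ) {x : E3}
    (hx : x ∈ segment ℝ (u : E3) (v : E3)) : JoinedAt K x f f' :=
  ⟨u, v, A.adj, A.uncut, hx, A.left, A.right⟩

/-- The old region and the new face lie on opposite closed sides of the line of the shared edge, and
the new face touches that line only in the edge. -/
theorem meet (A : Attachment K S φ f f' u v ψ) {x : E3} (hx : x ∈ f'.carrier)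
    (hU : ψ x ∈ region S φ) : x ∈ segment ℝ (u : E3) (v : E3) := by
  obtain ⟨σ, hσ, h1, h2, h3⟩ := A.separated
  refine h3 x hx ?_
  have := le_antisymm (h2 x hx) (h1 _ hU)
  simpa [hσ] using this

theorem injective (A : Attachment K S φ f f' u v ψ) {g : Face P} (hg : g ∈ S) {x y : E3}
    (hx : x ∈ g.carrier) (hy : y ∈ f'.carrier) (h : φ g x = ψ y) :
    x = y ∧ x ∈ segment ℝ (u : E3) (v : E3) ∧ ConnectedAt K x g f := by
  have hys := A.meet hy (mem_region.2 ⟨g, hg, x, hx, h⟩)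
  rw [A.eq_on hys] at h
  obtain ⟨rfl, h2⟩ := A.layout.injective g hg f A.mem x hx y (A.left hys) h
  exact ⟨rfl, hys, h2⟩

theorem fst_ne_snd (A : Attachment K S φ f f' u v ψ) : φ f u ≠ φ f v := by
  have h := A.layout.isometry f A.mem u (A.left (left_mem_segment ℝ _ _)) v
    (A.left (right_mem_segment ℝ _ _))
  intro h0
  rw [h0, dist_self] at h
  exact A.adj.1 (Subtype.ext (dist_eq_zero.1 h.symm))

theorem face_angle_le (hP : IsConvexPolyhedron P) (A : Attachment K S φ f f' u v ψ) {w : Vertex P}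
    (hw : (w : E3) ∈ f'.carrier) {x y : E2} (hx : x ∈ ψ '' f'.carrier) (hy : y ∈ ψ '' f'.carrier)
    (hxw : x ≠ ψ w) (hyw : y ≠ ψ w) : EuclideanGeometry.angle x (ψ w) y ≤ f'.angle w := by
  obtain ⟨x, hx, rfl⟩ := hx
  obtain ⟨y, hy, rfl⟩ := hy
  rw [angle_eq_of_dist_eq (A.isometry x hx w hw) (A.isometry y hy w hw) (A.isometry x hx y hy)]
  exact f'.angle_le hP hw hx hy (fun h => hxw (by rw [h])) fun h => hyw (by rw [h])

theorem fst_mem (A : Attachment K S φ f f' u v ψ) : φ f u ∈ region S φ :=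
  mem_region.2 ⟨f, A.mem, u, A.left (left_mem_segment ℝ _ _), rfl⟩

theorem angle_le (hP : IsConvexPolyhedron P) (A : Attachment K S φ f f' u v ψ) {x y : E2}
    (hx : x ∈ region S φ) (hy : y ∈ ψ '' f'.carrier) (hxu : x ≠ φ f u) (hyu : y ≠ φ f u) :
    EuclideanGeometry.angle x (φ f u) (φ f v) ≤ fan K S u f ∧
      EuclideanGeometry.angle (φ f v) (φ f u) y ≤ f'.angle u := by
  have huf := A.left (left_mem_segment ℝ _ _)
  have huf' := A.right (left_mem_segment ℝ _ _)
  have hvf' := A.right (right_mem_segment ℝ _ _)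
  refine ⟨A.layout.angle_le f A.mem u huf x hx _ A.symm.fst_mem hxu A.fst_ne_snd.symm, ?_⟩
  have h := A.face_angle_le hP huf' ⟨v, hvf', rfl⟩ hy
    (by rw [A.map_fst, A.map_snd]; exact A.fst_ne_snd.symm) (by rwa [A.map_fst])
  rwa [A.map_fst, A.map_snd] at h

theorem fan_insert_eq [DecidableEq (Face P)] (A : Attachment K S φ f f' u v ψ) {g : Face P}
    (hg : ConnectedAt K (u : E3) g f) :
    fan K (insert f' S) u g = f'.angle u + fan K S u f := by
  rw [fan_congr _ hg]
  have := fan_insert A.notMem (Relation.ReflTransGen.single (A.joinedAt (left_mem_segment ℝ _ _)))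
  convert this

/-- At an end of the shared edge, an angle between a point of the old region and a point of the new
face is split by the edge. The triangle inequality for angles adds the old fan and the angle of the
new face. -/
theorem angle_le_insert [DecidableEq (Face P)] (hP : IsConvexPolyhedron P)
    (A : Attachment K S φ f f' u v ψ)
    {g : Face P} (hg : ConnectedAt K (u : E3) g f) {x y : E2}
    (hx : x ∈ ψ '' f'.carrier ∪ region S φ) (hy : y ∈ ψ '' f'.carrier ∪ region S φ)
    (hxu : x ≠ φ f u) (hyu : y ≠ φ f u) :
    EuclideanGeometry.angle x (φ f u) y ≤ fan K (insert f' S) u g := by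
  have huf := A.left (left_mem_segment ℝ _ _)
  have huf' := A.right (left_mem_segment ℝ _ _)
  rw [A.fan_insert_eq hg]
  have h0 := f'.angle_nonneg u
  rcases hx with hx | hx <;> rcases hy with hy | hy
  · have h1 := A.face_angle_le hP huf' hx hy (by rwa [A.map_fst]) (by rwa [A.map_fst])
    rw [A.map_fst] at h1
    have h2 := (A.angle_le hP A.symm.fst_mem hx A.fst_ne_snd.symm hxu).1
    have h3 := EuclideanGeometry.angle_nonneg (φ f v) (φ f u) (φ f v)
    linarith
  · obtain ⟨h1, h2⟩ := A.angle_le hP hy hx hyu hxu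
    have := EuclideanGeometry.angle_le_angle_add_angle (φ f u) y (φ f v) x
    rw [EuclideanGeometry.angle_comm]
    linarith
  · obtain ⟨h1, h2⟩ := A.angle_le hP hx hy hxu hyu
    have := EuclideanGeometry.angle_le_angle_add_angle (φ f u) x (φ f v) y
    linarith
  · have := A.layout.angle_le f A.mem u huf x hx y hy hxu hyu
    linarith

/-- This is where the quasigeodesic condition is used: old fan and new face angle together are at
most the side angle, hence at most π. As the face angle is positive, the old fan alone is below π,
as `crossing_param_nonneg` also requires. -/
theorem param_nonneg [Finite (Face P)] (hP : IsConvexPolyhedron P)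
    (A : Attachment K S φ f f' u v ψ) (hπ : sideAngle K u f ≤ Real.pi) {x y : E2}
    (hx : x ∈ region S φ) (hy : y ∈ ψ '' f'.carrier) (hyU : y ∉ region S φ) {t s : ℝ} (ht0 : 0 ≤ t)
    (ht1 : t ≤ 1) (hz : x + t • (y - x) = φ f u + s • (φ f v - φ f u)) : 0 ≤ s := by
  classical
  obtain ⟨σ, hσ, h1, h2, h3⟩ := A.separated
  have hyu : y ≠ φ f u := by rintro rfl; exact hyU A.fst_mem
  refine crossing_param_nonneg A.fst_ne_snd (h1 x hx) ?_ (fun hxu => ?_) ht0 ht1 hz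
  · obtain ⟨y, hy, rfl⟩ := hy
    refine (h2 y hy).lt_of_ne fun h0 => hyU ?_
    have hys := h3 y hy (by simpa [hσ] using h0)
    exact mem_region.2 ⟨f, A.mem, y, A.left hys, (A.eq_on hys).symm⟩
  · obtain ⟨e1, e2⟩ := A.angle_le hP hx hy hxu hyu
    have e3 := (fan_le_sideAngle K (insert f' S) u f).trans hπ
    rw [A.fan_insert_eq .refl] at e3
    have e4 := f'.angle_pos hP (A.right (left_mem_segment ℝ _ _))
    exact ⟨by linarith, by linarith⟩

/-- A segment from the old region to a point of the new face off that region crosses the line of the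
shared edge between both ends, by `param_nonneg` at `u` and, through `symm`, at `v`. The crossing
point divides it into a piece in each of two convex sets. -/
theorem convex [Finite (Face P)] (hP : IsConvexPolyhedron P) (A : Attachment K S φ f f' u v ψ)
    (hu : sideAngle K u f ≤ Real.pi) (hv : sideAngle K v f ≤ Real.pi) :
    Convex ℝ (ψ '' f'.carrier ∪ region S φ) := by
  have hC : Convex ℝ (ψ '' f'.carrier) := (f'.convex hP).affine_image ψ
  have key : ∀ x ∈ region S φ, ∀ y ∈ ψ '' f'.carrier,
      segment ℝ x y ⊆ ψ '' f'.carrier ∪ region S φ := by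
    intro x hx y hy
    by_cases hyU : y ∈ region S φ
    · exact (A.layout.convex.segment_subset hx hyU).trans Set.subset_union_right
    obtain ⟨σ, hσ, h1, h2, h3⟩ := A.separated
    have hx' := h1 x hx
    have hy' : σ * cr (φ f v - φ f u) (y - φ f u) < 0 := by
      obtain ⟨y, hy, rfl⟩ := hy
      refine (h2 y hy).lt_of_ne fun h0 => hyU ?_
      have hys := h3 y hy (by simpa [hσ] using h0)
      exact mem_region.2 ⟨f, A.mem, y, A.left hys, (A.eq_on hys).symm⟩
    set hX := σ * cr (φ f v - φ f u) (x - φ f u) with hhX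
    set hY := σ * cr (φ f v - φ f u) (y - φ f u) with hhY
    set t := hX / (hX - hY) with ht
    have hXY : 0 < hX - hY := by linarith
    have ht0 : 0 ≤ t := div_nonneg hx' hXY.le
    have ht1 : t ≤ 1 := by rw [ht, div_le_one hXY]; linarith
    have hcr : cr (φ f v - φ f u) (x + t • (y - x) - φ f u) = 0 := by
      have e : x + t • (y - x) - φ f u = (1 - t) • (x - φ f u) + t • (y - φ f u) := by module
      have : σ * cr (φ f v - φ f u) (x + t • (y - x) - φ f u) = 0 := by
        rw [e, cr_add_right, cr_smul_right, cr_smul_right]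
        have : (1 - t) * hX + t * hY = 0 := by rw [ht]; field_simp; ring
        rw [← this, hhX, hhY]; ring
      simpa [hσ] using this
    obtain ⟨s, hs⟩ := eq_smul_of_cr_eq_zero (sub_ne_zero.2 A.fst_ne_snd.symm) hcr
    have hz : x + t • (y - x) = φ f u + s • (φ f v - φ f u) := by rw [← hs]; abel
    have hs0 := A.param_nonneg hP hu hx hy hyU ht0 ht1 hz
    have hs1 := A.symm.param_nonneg hP hv hx hy hyU (s := 1 - s) ht0 ht1 (by rw [hz]; module)
    set z := x + t • (y - x) with hzd
    have hzs : z ∈ segment ℝ (φ f u) (φ f v) := by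
      rw [segment_eq_image']
      exact ⟨s, ⟨hs0, by linarith⟩, hz.symm⟩
    have hzC : z ∈ ψ '' f'.carrier := by
      refine hC.segment_subset ⟨u, A.right (left_mem_segment ℝ _ _), A.map_fst⟩
        ⟨v, A.right (right_mem_segment ℝ _ _), A.map_snd⟩ hzs
    have hzU : z ∈ region S φ := A.layout.convex.segment_subset A.fst_mem A.symm.fst_mem hzs
    have hzxy : z ∈ segment ℝ x y := by
      rw [segment_eq_image']
      exact ⟨t, ⟨ht0, ht1⟩, rfl⟩
    intro w hw
    have hwz : w ∈ segment ℝ x z ∪ segment ℝ z y := by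
      rw [segment_eq_image'] at hw
      obtain ⟨r, hr, rfl⟩ := hw
      rw [hzd]
      rcases le_total r t with hrt | hrt
      · left
        have : segment ℝ x (x + t • (y - x)) =
            AffineMap.lineMap x y '' segment ℝ (0 : ℝ) t := by
          rw [image_segment, AffineMap.lineMap_apply_zero, AffineMap.lineMap_apply]
          simp [add_comm]
        rw [this, segment_eq_Icc ht0]
        exact ⟨r, ⟨hr.1, hrt⟩, by simp [AffineMap.lineMap_apply, add_comm]⟩
      · right
        have : segment ℝ (x + t • (y - x)) y =
            AffineMap.lineMap x y '' segment ℝ t (1 : ℝ) := by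
          rw [image_segment, AffineMap.lineMap_apply_one, AffineMap.lineMap_apply]
          simp [add_comm]
        rw [this, segment_eq_Icc ht1]
        exact ⟨r, ⟨hrt, hr.2⟩, by simp [AffineMap.lineMap_apply, add_comm]⟩
    rcases hwz with hw | hw
    · exact Or.inr (A.layout.convex.segment_subset hx hzU hw)
    · exact Or.inl (hC.segment_subset hzC hy hw)
  rw [convex_iff_segment_subset]
  rintro x (hx | hx) y (hy | hy)
  · exact (hC.segment_subset hx hy).trans Set.subset_union_left
  · rw [segment_symm]; exact key y hy x hx
  · exact key x hx y hy
  · exact (A.layout.convex.segment_subset hx hy).trans Set.subset_union_right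

end Attachment

end Polyhedron

end

/-! ### Extending layouts up to a maximal one -/

section

namespace Polyhedron

open PlanarArc

variable {P : Set E3}

theorem region_update [DecidableEq (Face P)] {S : Finset (Face P)} {φ : Face P → E3 →ᵃ[ℝ] E2}
    {f' : Face P} (hf' : f' ∉ S) (ψ : E3 →ᵃ[ℝ] E2) :
    region (insert f' S) (Function.update φ f' ψ) = ψ '' f'.carrier ∪ region S φ := by
  unfold region
  rw [Finset.set_biUnion_insert, Function.update_self]
  congr 1
  refine Set.iUnion₂_congr fun g hg => ?_
  rw [Function.update_of_ne (ne_of_mem_of_not_mem hg hf')]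

theorem eq_of_mem_edge (hP : IsConvexPolyhedron P) {u v : Vertex P} (h : (skeleton P).Adj u v)
    {f g k : Face P} (hfg : f ≠ g) (hf : segment ℝ (u : E3) (v : E3) ⊆ f.carrier)
    (hg : segment ℝ (u : E3) (v : E3) ⊆ g.carrier)
    (hk : segment ℝ (u : E3) (v : E3) ⊆ k.carrier) : k = f ∨ k = g := by
  obtain ⟨a, b, -, -, -, honly, -⟩ := edge_faces hP h
  rcases honly f hf with rfl | rfl <;> rcases honly g hg with rfl | rfl <;>
    rcases honly k hk with rfl | rfl <;> simp_all

theorem segment_congr_edge {a b u v : Vertex P} (h : s(a, b) = s(u, v)) :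
    segment ℝ (a : E3) (b : E3) = segment ℝ (u : E3) (v : E3) := by
  rcases Sym2.eq_iff.1 h with ⟨rfl, rfl⟩ | ⟨rfl, rfl⟩
  · rfl
  · exact segment_symm _ _ _

/-- A half-plane condition whose bounding line passes through `m` needs to be checked only near `m`,
where the part `C` of the region is absent. -/
theorem side_of_near {U : Set E2} (hU : Convex ℝ U) {C : Set E2} (hC : IsClosed C) {d p m : E2}
    (hmU : m ∈ U) (hmC : m ∉ C) (hm : cr d (m - p) = 0) {σ : ℝ}
    (h : ∀ y ∈ U, y ∉ C → 0 ≤ σ * cr d (y - p)) : ∀ y ∈ U, 0 ≤ σ * cr d (y - p) := by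
  intro y hy
  obtain ⟨ε, h0, h1, hε⟩ := exists_near hC hmC y
  have h2 := h _ (mem_of_near hU hmU hy h0 h1) hε
  have e : m + ε • (y - m) - p = (1 - ε) • (m - p) + ε • (y - p) := by module
  rw [e, cr_add_right, cr_smul_right, cr_smul_right, hm] at h2
  have h3 : 0 ≤ ε * (σ * cr d (y - p)) := by linarith
  exact nonneg_of_mul_nonneg_right h3 h0

theorem cr_midpoint (p q : E2) : cr (q - p) (midpoint ℝ p q - p) = 0 := by
  rw [midpoint_sub_left, cr_smul_right, cr_self, mul_zero]

namespace Attachment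

variable {K : Set (Sym2 (Vertex P))} {S : Finset (Face P)} {φ : Face P → E3 →ᵃ[ℝ] E2}
  {f f' : Face P} {u v : Vertex P} {ψ : E3 →ᵃ[ℝ] E2}

theorem angle_le_of_mem_edge [DecidableEq (Face P)] (hP : IsConvexPolyhedron P)
    (A : Attachment K S φ f f' u v ψ) {g : Face P} {w : Vertex P}
    (hw : (w : E3) ∈ segment ℝ (u : E3) (v : E3)) (hg : ConnectedAt K (w : E3) g f) {x y : E2}
    (hx : x ∈ ψ '' f'.carrier ∪ region S φ) (hy : y ∈ ψ '' f'.carrier ∪ region S φ)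
    (hxw : x ≠ φ f w) (hyw : y ≠ φ f w) :
    EuclideanGeometry.angle x (φ f w) y ≤ fan K (insert f' S) w g := by
  rcases vertex_mem_segment hw with rfl | rfl
  · exact A.angle_le_insert hP hg hx hy hxw hyw
  · exact A.symm.angle_le_insert hP hg hx hy hxw hyw

/-- By `huniq` the new face is attached along `u v` only, so gluing conditions involving it concern
just that edge. The angle and side conditions are local: at a point in only one of the two pieces
they are inherited from it, and points in both pieces come from the shared edge, where the angle
estimates at its ends apply. -/
theorem layout_insert [DecidableEq (Face P)] [Finite (Face P)] (hP : IsConvexPolyhedron P)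
    (A : Attachment K S φ f f' u v ψ)
    (huniq : ∀ g ∈ S, ∀ a b : Vertex P, (skeleton P).Adj a b → s(a, b) ∉ K →
      segment ℝ (a : E3) (b : E3) ⊆ g.carrier → segment ℝ (a : E3) (b : E3) ⊆ f'.carrier →
      s(a, b) = s(u, v))
    (hu : sideAngle K u f ≤ Real.pi) (hv : sideAngle K v f ≤ Real.pi) :
    Layout K (insert f' S) (Function.update φ f' ψ) := by
  have hff' : f ≠ f' := fun h => A.notMem (h ▸ A.mem)
  have hφ : ∀ g ∈ S, Function.update φ f' ψ g = φ g := fun g hg =>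
    Function.update_of_ne (ne_of_mem_of_not_mem hg A.notMem) _ _
  have hφ' : Function.update φ f' ψ f' = ψ := Function.update_self _ _ _
  have hCc := (isCompact_image_face hP f' ψ).isClosed
  have hUc := (isCompact_region hP S φ).isClosed
  have hconv := A.convex hP hu hv
  have hmid : ∀ {g : Face P} {a b : Vertex P}, segment ℝ (a : E3) (b : E3) ⊆ g.carrier →
      midpoint ℝ (a : E3) (b : E3) ∈ g.carrier := fun h => h (midpoint_mem_segment _ _)
  have hcut : ∀ {g : Face P} {a b : Vertex P}, s(a, b) = s(u, v) →
      ¬ (s(a, b) ∈ K ∨ ∀ h ∈ insert f' S, segment ℝ (a : E3) (b : E3) ⊆ h.carrier → h = g) := by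
    rintro g a b hab (h | h)
    · rw [hab] at h; exact A.uncut h
    · have e := segment_congr_edge hab
      have h1 := h f (Finset.mem_insert_of_mem A.mem) (by rw [e]; exact A.left)
      have h2 := h f' (Finset.mem_insert_self _ _) (by rw [e]; exact A.right)
      exact hff' (h1.trans h2.symm)
  have hedge : ∀ g ∈ S, ∀ a b : Vertex P, (skeleton P).Adj a b → s(a, b) ∉ K →
      segment ℝ (a : E3) (b : E3) ⊆ g.carrier → segment ℝ (a : E3) (b : E3) ⊆ f'.carrier →
      g = f ∧ s(a, b) = s(u, v) := by
    intro g hg a b hab hK h1 h2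
    have h3 := huniq g hg a b hab hK h1 h2
    refine ⟨?_, h3⟩
    rw [segment_congr_edge h3] at h1
    exact (eq_of_mem_edge hP A.adj hff' A.left A.right h1).resolve_right
      fun h => A.notMem (h ▸ hg)
  constructor
  · intro g hg
    rcases Finset.mem_insert.1 hg with rfl | hgS
    · rw [hφ']; exact A.isometry
    · rw [hφ g hgS]; exact A.layout.isometry g hgS
  · intro c hc
    have h1 : ∀ g ∈ S, c g = c f := fun g hg => A.layout.connected c
      (fun g hg h hh => hc g (Finset.mem_insert_of_mem hg) h (Finset.mem_insert_of_mem hh))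
      g hg f A.mem
    have h2 : c f' = c f := hc f' (Finset.mem_insert_self _ _) f (Finset.mem_insert_of_mem A.mem)
      u v A.adj A.uncut A.right A.left
    intro g hg h hh
    rcases Finset.mem_insert.1 hg with rfl | hgS <;> rcases Finset.mem_insert.1 hh with rfl | hhS
    · rfl
    · rw [h2, h1 h hhS]
    · rw [h2, h1 g hgS]
    · rw [h1 g hgS, h1 h hhS]
  · intro g hg h hh a b hab hK hga hha
    rcases Finset.mem_insert.1 hg with rfl | hgS <;> rcases Finset.mem_insert.1 hh with rfl | hhS
    · rfl
    · obtain ⟨rfl, h3⟩ := hedge h hhS a b hab hK hha hga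
      rw [hφ', hφ h hhS]
      exact A.eq_on (by rw [← segment_congr_edge h3]; exact left_mem_segment ℝ _ _)
    · obtain ⟨rfl, h3⟩ := hedge g hgS a b hab hK hga hha
      rw [hφ', hφ g hgS]
      exact (A.eq_on (by rw [← segment_congr_edge h3]; exact left_mem_segment ℝ _ _)).symm
    · rw [hφ g hgS, hφ h hhS]
      exact A.layout.attached g hgS h hhS a b hab hK hga hha
  · have hopp : ∀ x ∈ f.carrier, ∀ y ∈ f'.carrier,
        (affineSpan ℝ {φ f u, φ f v}).WOppSide (φ f x) (ψ y) := by
      intro x hx y hy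
      obtain ⟨σ, hσ, h1, h2, h3⟩ := A.separated
      exact wOppSide_of_cr A.fst_ne_snd hσ (h1 _ (mem_region.2 ⟨f, A.mem, x, hx, rfl⟩)) (h2 y hy)
    have hpair : ∀ a b : Vertex P, s(a, b) = s(u, v) →
        ({φ f a, φ f b} : Set E2) = {φ f u, φ f v} ∧ ({ψ a, ψ b} : Set E2) = {φ f u, φ f v} := by
      intro a b hab
      rcases Sym2.eq_iff.1 hab with ⟨rfl, rfl⟩ | ⟨rfl, rfl⟩
      · rw [A.map_fst, A.map_snd]; exact ⟨rfl, rfl⟩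
      · rw [A.map_fst, A.map_snd]; exact ⟨Set.pair_comm _ _, Set.pair_comm _ _⟩
    intro g hg h hh hgh a b hab hK hga hha
    rcases Finset.mem_insert.1 hg with rfl | hgS <;> rcases Finset.mem_insert.1 hh with rfl | hhS
    · exact absurd rfl hgh
    · obtain ⟨rfl, h3⟩ := hedge h hhS a b hab hK hha hga
      rw [hφ', hφ h hhS, (hpair a b h3).2]
      exact fun x hx y hy => (hopp y hy x hx).symm
    · obtain ⟨rfl, h3⟩ := hedge g hgS a b hab hK hga hha
      rw [hφ', hφ g hgS, (hpair a b h3).1]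
      exact hopp
    · rw [hφ g hgS, hφ h hhS]
      exact A.layout.opposite g hgS h hhS hgh a b hab hK hga hha
  · rw [region_update A.notMem]
    exact hconv
  · rw [region_update A.notMem]
    intro g hg w hw x hx y hy hxw hyw
    rcases Finset.mem_insert.1 hg with rfl | hgS
    · rw [hφ'] at hxw hyw ⊢
      by_cases hcU : ψ w ∈ region S φ
      · have hws := A.meet hw hcU
        rw [A.eq_on hws] at hxw hyw ⊢
        exact A.angle_le_of_mem_edge hP hws
          (Relation.ReflTransGen.single (A.joinedAt hws).symm) hx hy hxw hyw
      · have hcC : ψ w ∈ ψ '' g.carrier := ⟨w, hw, rfl⟩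
        obtain ⟨ε, hε0, hε1, hε⟩ := exists_near hUc hcU x
        obtain ⟨δ, hδ0, hδ1, hδ⟩ := exists_near hUc hcU y
        rw [← angle_near hε0 hδ0]
        refine (A.face_angle_le hP hw
          ((mem_of_near hconv (Or.inl hcC) hx hε0 hε1).resolve_right hε)
          ((mem_of_near hconv (Or.inl hcC) hy hδ0 hδ1).resolve_right hδ)
          (near_ne hε0 hxw) (near_ne hδ0 hyw)).trans ?_
        exact angle_le_fan w (Finset.mem_insert_self _ _) .refl
    · rw [hφ g hgS] at hxw hyw ⊢
      have hcU : φ g w ∈ region S φ := mem_region.2 ⟨g, hgS, w, hw, rfl⟩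
      by_cases hcC : φ g w ∈ ψ '' f'.carrier
      · obtain ⟨w', hw', hww'⟩ := hcC
        obtain ⟨h1, hws, hgf⟩ := A.injective hgS hw hw' hww'.symm
        rw [← h1, A.eq_on hws] at hww'
        rw [← hww'] at hxw hyw ⊢
        exact A.angle_le_of_mem_edge hP hws hgf hx hy hxw hyw
      · obtain ⟨ε, hε0, hε1, hε⟩ := exists_near hCc hcC x
        obtain ⟨δ, hδ0, hδ1, hδ⟩ := exists_near hCc hcC y
        rw [← angle_near hε0 hδ0]
        refine (A.layout.angle_le g hgS w hw _
          ((mem_of_near hconv (Or.inr hcU) hx hε0 hε1).resolve_left hε) _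
          ((mem_of_near hconv (Or.inr hcU) hy hδ0 hδ1).resolve_left hδ)
          (near_ne hε0 hxw) (near_ne hδ0 hyw)).trans ?_
        exact fan_mono (Finset.subset_insert _ _) w g
  · rw [region_update A.notMem]
    intro g hg a b hab hga hor
    rcases Finset.mem_insert.1 hg with rfl | hgS
    · rw [hφ']
      obtain ⟨σ, hσ, hs⟩ := g.exists_side hab hga ψ
      refine ⟨σ, hσ, side_of_near (m := midpoint ℝ (ψ a) (ψ b)) hconv hUc ?_ ?_ (cr_midpoint _ _) ?_⟩
      · rw [← AffineMap.map_midpoint]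
        exact Or.inl ⟨_, hmid hga, rfl⟩
      · rw [← AffineMap.map_midpoint]
        intro hm
        exact hcut (edge_eq_of_midpoint_mem A.adj hab (A.meet (hmid hga) hm)) hor
      · rintro y (⟨y, hy, rfl⟩ | hy) hyU
        · exact hs y hy
        · exact absurd hy hyU
    · rw [hφ g hgS]
      obtain ⟨σ, hσ, hs⟩ := A.layout.side g hgS a b hab hga
        (hor.imp_right fun h k hk => h k (Finset.mem_insert_of_mem hk))
      refine ⟨σ, hσ, side_of_near (m := midpoint ℝ (φ g a) (φ g b)) hconv hCc ?_ ?_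
        (cr_midpoint _ _) ?_⟩
      · rw [← AffineMap.map_midpoint]
        exact Or.inr (mem_region.2 ⟨g, hgS, _, hmid hga, rfl⟩)
      · rw [← AffineMap.map_midpoint]
        rintro ⟨y, hy, hym⟩
        obtain ⟨-, h1, -⟩ := A.injective hgS (hmid hga) hy hym.symm
        exact hcut (edge_eq_of_midpoint_mem A.adj hab h1) hor
      · rintro y (hy | hy) hyC
        · exact absurd hy hyC
        · exact hs y hy
  · intro g hg h hh x hx y hy hxy
    rcases Finset.mem_insert.1 hg with rfl | hgS <;> rcases Finset.mem_insert.1 hh with rfl | hhS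
    · refine ⟨?_, .refl⟩
      have := A.isometry x hx y hy
      rw [hφ'] at hxy
      rw [hxy, dist_self] at this
      exact dist_eq_zero.1 this.symm
    · rw [hφ', hφ h hhS] at hxy
      obtain ⟨rfl, h2, h3⟩ := A.injective hhS hy hx hxy.symm
      exact ⟨rfl, ConnectedAt.symm (h3.tail (A.joinedAt h2))⟩
    · rw [hφ', hφ g hgS] at hxy
      obtain ⟨rfl, h2, h3⟩ := A.injective hgS hx hy hxy
      exact ⟨rfl, h3.tail (A.joinedAt h2)⟩
    · rw [hφ g hgS, hφ h hhS] at hxy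
      exact A.layout.injective g hgS h hhS x hx y hy hxy

end Attachment

theorem Layout.singleton (hP : IsConvexPolyhedron P) (K : Set (Sym2 (Vertex P))) (f : Face P)
    (φ : Face P → E3 →ᵃ[ℝ] E2)
    (h : ∀ x ∈ f.carrier, ∀ y ∈ f.carrier, dist (φ f x) (φ f y) = dist x y) :
    Layout K {f} φ := by
  have hreg : region {f} φ = φ f '' f.carrier := by simp [region]
  constructor
  · simpa using h
  · simp
  · simp
  · intro g hg h hh hgh
    rw [Finset.mem_singleton] at hg hh
    exact absurd (hg.trans hh.symm) hgh
  · rw [hreg]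
    exact (f.convex hP).affine_image _
  · rw [hreg]
    rintro g hg w hw _ ⟨x, hx, rfl⟩ _ ⟨y, hy, rfl⟩ hxw hyw
    obtain rfl := Finset.mem_singleton.1 hg
    rw [angle_eq_of_dist_eq (h x hx w hw) (h y hy w hw) (h x hx y hy)]
    refine (g.angle_le hP hw hx hy (fun h => hxw (by rw [h])) fun h => hyw (by rw [h])).trans ?_
    exact angle_le_fan w hg .refl
  · rw [hreg]
    rintro g hg a b hab hga -
    obtain rfl := Finset.mem_singleton.1 hg
    obtain ⟨σ, hσ, hs⟩ := g.exists_side hab hga (φ g)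
    refine ⟨σ, hσ, ?_⟩
    rintro _ ⟨y, hy, rfl⟩
    exact hs y hy
  · intro g hg k hk x hx y hy hxy
    obtain rfl := Finset.mem_singleton.1 hg
    obtain rfl := Finset.mem_singleton.1 hk
    have := h x hx y hy
    rw [hxy, dist_self] at this
    exact ⟨dist_eq_zero.1 this.symm, .refl⟩

/-- A layout can be extended across an uncut edge, unless the new face is also attached to the
layout along another edge. -/
theorem Layout.exists_extension [DecidableEq (Face P)] [Finite (Face P)] (hP : IsConvexPolyhedron P)
    {K : Set (Sym2 (Vertex P))} {S : Finset (Face P)} {φ : Face P → E3 →ᵃ[ℝ] E2} (L : Layout K S φ)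
    {f f' : Face P} (hf : f ∈ S) (hf' : f' ∉ S) {u v : Vertex P} (huv : (skeleton P).Adj u v)
    (hK : s(u, v) ∉ K) (h : segment ℝ (u : E3) (v : E3) ⊆ f.carrier)
    (h' : segment ℝ (u : E3) (v : E3) ⊆ f'.carrier)
    (huniq : ∀ g ∈ S, ∀ a b : Vertex P, (skeleton P).Adj a b → s(a, b) ∉ K →
      segment ℝ (a : E3) (b : E3) ⊆ g.carrier → segment ℝ (a : E3) (b : E3) ⊆ f'.carrier →
      s(a, b) = s(u, v))
    (hπ : ∀ (w : Vertex P) (f : Face P), (w : E3) ∈ f.carrier → sideAngle K w f ≤ Real.pi) :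
    ∃ ψ, Layout K (insert f' S) (Function.update φ f' ψ) := by
  have hff' : f ≠ f' := fun h => hf' (h ▸ hf)
  have huf := h (left_mem_segment ℝ _ _)
  have hvf := h (right_mem_segment ℝ _ _)
  obtain ⟨σ, hσ, hs⟩ := L.side f hf u v huv h (Or.inr fun g hg hgs =>
    (eq_of_mem_edge hP huv hff' h h' hgs).resolve_right fun e => hf' (e ▸ hg))
  obtain ⟨ψ, h1, h2, h3, h4, h5, -⟩ := f'.exists_placement huv h'
    (L.isometry f hf u huf v hvf) hσ
  have A : Attachment K S φ f f' u v ψ :=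
    ⟨L, hf, hf', huv, hK, h, h', h1, h2, h3, σ, hσ, hs, h4, h5⟩
  exact ⟨ψ, A.layout_insert hP huniq (hπ u f huf) (hπ v f hvf)⟩

/-- A maximal layout. -/
theorem exists_closed_layout [Fintype (Face P)] [Fintype (Vertex P)] (hP : IsConvexPolyhedron P)
    {K : Set (Sym2 (Vertex P))} {T : SimpleGraph (Vertex P)} (hT : T ≤ skeleton P)
    (hconn : T.Preconnected) (hTK : T.edgeSet ⊆ K)
    (hπ : ∀ (w : Vertex P) (f : Face P), (w : E3) ∈ f.carrier → sideAngle K w f ≤ Real.pi)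
    (f₀ : Face P) (ψ₀ : E3 →ᵃ[ℝ] E2)
    (h₀ : ∀ x ∈ f₀.carrier, ∀ y ∈ f₀.carrier, dist (ψ₀ x) (ψ₀ y) = dist x y) :
    ∃ (S : Finset (Face P)) (φ : Face P → E3 →ᵃ[ℝ] E2), Layout K S φ ∧ f₀ ∈ S ∧ φ f₀ = ψ₀ ∧
      ∀ f ∈ S, ∀ g : Face P, ∀ u v : Vertex P, (skeleton P).Adj u v → s(u, v) ∉ K →
        segment ℝ (u : E3) (v : E3) ⊆ f.carrier → segment ℝ (u : E3) (v : E3) ⊆ g.carrier →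
        g ∈ S := by
  classical
  set good : Finset (Face P) → Prop := fun S =>
    ∃ φ : Face P → E3 →ᵃ[ℝ] E2, Layout K S φ ∧ f₀ ∈ S ∧ φ f₀ = ψ₀ with hgood
  have hne : (Finset.univ.filter good).Nonempty := ⟨{f₀}, by
    rw [Finset.mem_filter]
    exact ⟨Finset.mem_univ _, fun _ => ψ₀, Layout.singleton hP K f₀ _ h₀, by simp, rfl⟩⟩
  obtain ⟨S, hS, hmax⟩ := Finset.exists_max_image _ Finset.card hne
  obtain ⟨φ, L, hfS, hφ⟩ := (Finset.mem_filter.1 hS).2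
  refine ⟨S, φ, L, hfS, hφ, fun f hf g u v huv hK hfu hgu => ?_⟩
  by_contra hg
  -- Suppose `g` also met the layout along a second uncut edge `a b`. The chain `c` separating the
  -- two sides of `a b` is constant on the layout and does not change across `u v`, so `k` and `g`
  -- get equal values, yet it changes across `a b`.
  have huniq : ∀ k ∈ S, ∀ a b : Vertex P, (skeleton P).Adj a b → s(a, b) ∉ K →
      segment ℝ (a : E3) (b : E3) ⊆ k.carrier → segment ℝ (a : E3) (b : E3) ⊆ g.carrier →
      s(a, b) = s(u, v) := by
    intro k hk a b hab habK hka hga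
    by_contra hne
    obtain ⟨c, hc1, hc0⟩ := exists_separating hP hT hconn hab
      (fun h => habK (hTK ((SimpleGraph.mem_edgeSet T).2 h)))
    have hbd : ∀ {x y : Vertex P} {f g : Face P}, (skeleton P).Adj x y → f ≠ g →
        segment ℝ (x : E3) (y : E3) ⊆ f.carrier → segment ℝ (x : E3) (y : E3) ⊆ g.carrier →
        bd c x y = c f + c g := by
      intro x y f g hxy hfg h1 h2
      obtain ⟨e1, e2⟩ := (f.edge_subset_iff hP).1 h1
      obtain ⟨e3, e4⟩ := (g.edge_subset_iff hP).1 h2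
      exact bd_edge c hxy hfg e1 e2 e3 e4 fun m m1 m2 =>
        eq_of_mem_edge hP hxy hfg h1 h2 ((m.edge_subset_iff hP).2 ⟨m1, m2⟩)
    have hkg : k ≠ g := fun h => hg (h ▸ hk)
    have hfg : f ≠ g := fun h => hg (h ▸ hf)
    have h1 := hbd hab hkg hka hga
    have h2 := hbd huv hfg hfu hgu
    rw [hc1] at h1
    rw [hc0 u v (fun h => hK (hTK ((SimpleGraph.mem_edgeSet T).2 h))) (fun h => hne h.symm)] at h2
    have h3 : c f = c k := by
      refine L.connected c (fun m hm n hn x y hxy hxyK hmx hnx => ?_) f hf k hk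
      by_cases hmn : m = n
      · rw [hmn]
      by_cases hxyab : s(x, y) = s(a, b)
      · rw [segment_congr_edge hxyab] at hmx hnx
        rcases eq_of_mem_edge hP hab hmn hmx hnx hga with h | h
        · exact absurd (h ▸ hm) hg
        · exact absurd (h ▸ hn) hg
      · have := hbd hxy hmn hmx hnx
        rw [hc0 x y (fun h => hxyK (hTK ((SimpleGraph.mem_edgeSet T).2 h))) hxyab] at this
        exact zmod2_add_eq_zero.1 this.symm
    rw [h3, ← h1] at h2
    exact zero_ne_one h2
  obtain ⟨ψ, L'⟩ := L.exists_extension hP hf hg huv hK hfu hgu huniq hπ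
  have h1 := hmax (insert g S) (Finset.mem_filter.2 ⟨Finset.mem_univ _, _, L',
    Finset.mem_insert_of_mem hfS, by
      rw [Function.update_of_ne (ne_of_mem_of_not_mem hfS hg), hφ]⟩)
  rw [Finset.card_insert_of_notMem hg] at h1
  omega

end Polyhedron

end

/-! ### Gluing the two halves -/

section

namespace SimpleGraph.Walk

/-- A Hamiltonian path is a spanning tree. -/
theorem IsHamiltonian.isTree_fromEdgeSet {V : Type*} [Fintype V] [DecidableEq V]
    {G : SimpleGraph V} {a b : V} {p : G.Walk a b} (hp : p.IsHamiltonian) :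
    (SimpleGraph.fromEdgeSet p.edgeSet).IsTree ∧
      (SimpleGraph.fromEdgeSet p.edgeSet).edgeSet = p.edgeSet := by
  have hE : (SimpleGraph.fromEdgeSet p.edgeSet).edgeSet = p.edgeSet := by
    rw [SimpleGraph.edgeSet_fromEdgeSet]
    refine sdiff_eq_left.2 (Set.disjoint_left.2 fun e hd he => ?_)
    exact G.not_isDiag_of_mem_edgeSet (p.edges_subset_edgeSet hd) he
  refine ⟨SimpleGraph.isTree_iff_connected_and_card.2 ⟨?_, ?_⟩, hE⟩
  · have hq : ∀ e ∈ p.edges, e ∈ (SimpleGraph.fromEdgeSet p.edgeSet).edgeSet := by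
      rw [hE]; exact fun e he => he
    have hr : ∀ w, (SimpleGraph.fromEdgeSet p.edgeSet).Reachable a w := fun w =>
      ⟨(p.transfer _ hq).takeUntil w (by rw [support_transfer]; exact hp.mem_support w)⟩
    exact { preconnected := fun x y => (hr x).symm.trans (hr y), nonempty := ⟨a⟩ }
  · have h1 : p.edgeSet = (p.edges.toFinset : Set (Sym2 V)) := by ext; simp
    rw [hE, h1, Nat.card_coe_set_eq, Set.ncard_coe_finset,
      List.toFinset_card_of_nodup hp.isPath.isTrail.edges_nodup, length_edges, hp.length_eq,
      Nat.card_eq_fintype_card]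
    have : 0 < Fintype.card V := Fintype.card_pos_iff.2 ⟨a⟩
    omega

end SimpleGraph.Walk

namespace Polyhedron

open PlanarArc

variable {P : Set E3} {K : Set (Sym2 (Vertex P))}

/-- The two fans consist of different faces at the same vertex, so `sum_angle_lt` bounds their
total. -/
theorem fan_add_fan_lt [Finite (Face P)] (hP : IsConvexPolyhedron P) {S₁ S₂ : Finset (Face P)}
    (hS : Disjoint S₁ S₂) {w : Vertex P} {f g : Face P} (hf : (w : E3) ∈ f.carrier)
    (hg : (w : E3) ∈ g.carrier) : fan K S₁ w f + fan K S₂ w g < 2 * Real.pi := by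
  classical
  have := Fintype.ofFinite (Face P)
  refine lt_of_le_of_lt ?_ (sum_angle_lt hP w)
  unfold fan
  rw [← Finset.sum_union (Finset.disjoint_filter_filter hS),
    ← Finset.sum_subtype (Finset.univ.filter fun g : Face P => (w : E3) ∈ g.carrier) (by simp)
      (fun g : Face P => g.angle w)]
  refine Finset.sum_le_sum_of_subset_of_nonneg (fun k hk => ?_) fun g _ _ => g.angle_nonneg w
  simp only [Finset.mem_union, Finset.mem_filter, Finset.mem_univ, true_and] at hk ⊢
  rcases hk with hk | hk
  · exact hk.2.mem hf
  · exact hk.2.mem hg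

theorem Layout.exists_eq_convexHull (hP : IsConvexPolyhedron P) {S : Finset (Face P)}
    {φ : Face P → E3 →ᵃ[ℝ] E2} (L : Layout K S φ) :
    ∃ T : Set E2, T.Finite ∧ region S φ = convexHull ℝ T := by
  have hf : ∀ f : Face P, φ f '' f.carrier =
      convexHull ℝ (φ f '' (f.carrier ∩ P.extremePoints ℝ)) := by
    intro f
    rw [← AffineMap.image_convexHull]
    congr 1
    exact support_eq_convexHull hP f.normal
  refine ⟨⋃ f ∈ S, φ f '' (f.carrier ∩ P.extremePoints ℝ), ?_, Set.Subset.antisymm ?_ ?_⟩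
  · exact S.finite_toSet.biUnion fun f _ =>
      (hP.finite_extremePoints.subset Set.inter_subset_right).image _
  · refine Set.iUnion₂_subset fun f hfS => ?_
    rw [hf]
    exact convexHull_mono (Set.subset_biUnion_of_mem (u := fun f : Face P =>
      φ f '' (f.carrier ∩ P.extremePoints ℝ)) hfS)
  · refine convexHull_min (Set.iUnion₂_mono fun f _ => ?_) L.convex
    exact Set.image_mono Set.inter_subset_left

/-- A common point of both regions on the line beyond `p` would give each region an angle π at `p`.
Both fans at `w` would then be at least π, although their sum is less than 2π. -/
theorem param_nonneg_of_common [Finite (Face P)] (hP : IsConvexPolyhedron P)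
    {S₁ S₂ : Finset (Face P)} {φ₁ φ₂ : Face P → E3 →ᵃ[ℝ] E2} (L₁ : Layout K S₁ φ₁)
    (L₂ : Layout K S₂ φ₂) (hS : Disjoint S₁ S₂) {f₁ f₂ : Face P} (hf₁ : f₁ ∈ S₁) (hf₂ : f₂ ∈ S₂)
    {w : Vertex P} (hw₁ : (w : E3) ∈ f₁.carrier) (hw₂ : (w : E3) ∈ f₂.carrier) {p q : E2}
    (hp₁ : φ₁ f₁ w = p) (hp₂ : φ₂ f₂ w = p) (hq₁ : q ∈ region S₁ φ₁) (hq₂ : q ∈ region S₂ φ₂)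
    (hpq : q ≠ p) {s : ℝ} (hy₁ : p + s • (q - p) ∈ region S₁ φ₁)
    (hy₂ : p + s • (q - p) ∈ region S₂ φ₂) : 0 ≤ s := by
  by_contra hs
  push Not at hs
  have hd : q - p ≠ 0 := sub_ne_zero.2 hpq
  have hyp : p + s • (q - p) ≠ p := by simp [hs.ne, hd]
  have hang : EuclideanGeometry.angle (p + s • (q - p)) p q = Real.pi := by
    simp only [EuclideanGeometry.angle, vsub_eq_sub, add_sub_cancel_left]
    rw [InnerProductGeometry.angle_comm, InnerProductGeometry.angle_eq_pi_iff]
    exact ⟨hd, s, hs, rfl⟩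
  have h1 := L₁.angle_le f₁ hf₁ w hw₁ _ hy₁ q hq₁ (by rwa [hp₁]) (by rwa [hp₁])
  have h2 := L₂.angle_le f₂ hf₂ w hw₂ _ hy₂ q hq₂ (by rwa [hp₂]) (by rwa [hp₂])
  rw [hp₁, hang] at h1
  rw [hp₂, hang] at h2
  linarith [fan_add_fan_lt (K := K) hP hS hw₁ hw₂]

/-- The closure property of maximal layouts. -/
def IsClosedUnder (K : Set (Sym2 (Vertex P))) (S : Finset (Face P)) : Prop :=
  ∀ f ∈ S, ∀ g : Face P, ∀ u v : Vertex P, (skeleton P).Adj u v → s(u, v) ∉ K →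
    segment ℝ (u : E3) (v : E3) ⊆ f.carrier → segment ℝ (u : E3) (v : E3) ⊆ g.carrier → g ∈ S

theorem bd_eq_add [Fintype (Face P)] (hP : IsConvexPolyhedron P) (c : Face P → ZMod 2) {x y : Vertex P}
    {f g : Face P} (hxy : (skeleton P).Adj x y) (hfg : f ≠ g)
    (h1 : segment ℝ (x : E3) (y : E3) ⊆ f.carrier)
    (h2 : segment ℝ (x : E3) (y : E3) ⊆ g.carrier) : bd c x y = c f + c g := by
  obtain ⟨e1, e2⟩ := (f.edge_subset_iff hP).1 h1
  obtain ⟨e3, e4⟩ := (g.edge_subset_iff hP).1 h2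
  exact bd_edge c hxy hfg e1 e2 e3 e4 fun m m1 m2 =>
    eq_of_mem_edge hP hxy hfg h1 h2 ((m.edge_subset_iff hP).2 ⟨m1, m2⟩)

section Halves

variable [Fintype (Face P)] [Fintype (Vertex P)] {T : SimpleGraph (Vertex P)} {a b : Vertex P}
  {S₁ S₂ : Finset (Face P)} {φ₁ φ₂ : Face P → E3 →ᵃ[ℝ] E2} {f₁ f₂ : Face P}

/-- The chain separating the two sides of `a b` is constant on each layout, since layouts cross only
uncut edges, and its two values differ across `a b`. -/
theorem disjoint_halves (hP : IsConvexPolyhedron P) (hT : T ≤ skeleton P)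
    (hconn : T.Preconnected) (hTK : T.edgeSet ⊆ K) (hab : (skeleton P).Adj a b)
    (habK : s(a, b) ∈ K) (habT : s(a, b) ∉ T.edgeSet) (L₁ : Layout K S₁ φ₁)
    (L₂ : Layout K S₂ φ₂) (hf : f₁ ≠ f₂) (hf₁ : f₁ ∈ S₁) (hf₂ : f₂ ∈ S₂)
    (h₁ : segment ℝ (a : E3) (b : E3) ⊆ f₁.carrier)
    (h₂ : segment ℝ (a : E3) (b : E3) ⊆ f₂.carrier) : Disjoint S₁ S₂ := by
  obtain ⟨c, hc1, hc0⟩ := exists_separating hP hT hconn hab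
    (fun h => habT ((SimpleGraph.mem_edgeSet T).2 h))
  rw [bd_eq_add hP c hab hf h₁ h₂] at hc1
  have key : ∀ {S : Finset (Face P)} {φ : Face P → E3 →ᵃ[ℝ] E2}, Layout K S φ →
      ∀ f ∈ S, ∀ g ∈ S, c f = c g := by
    intro S φ L
    refine L.connected c fun f _ g _ u v huv huvK hfu hgu => ?_
    by_cases hfg : f = g
    · rw [hfg]
    have := bd_eq_add hP c huv hfg hfu hgu
    rw [hc0 u v (fun h => huvK (hTK ((SimpleGraph.mem_edgeSet T).2 h)))
      (fun h => huvK (h ▸ habK))] at this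
    exact zmod2_add_eq_zero.1 this.symm
  refine Finset.disjoint_left.2 fun k hk1 hk2 => ?_
  rw [key L₁ f₁ hf₁ k hk1, key L₂ f₂ hf₂ k hk2, zmod2_add_self] at hc1
  exact zero_ne_one hc1

/-- The indicator of the union of the halves does not change across uncut edges, by closedness, nor
across `a b`, whose two faces are both included. Its boundary is thus a cycle in the tree `T` and
vanishes, so the indicator is constant. -/
theorem mem_halves (hP : IsConvexPolyhedron P) (hT : T ≤ skeleton P) (hTree : T.IsTree)
    (hK : ∀ e, e ∉ T.edgeSet → e = s(a, b) ∨ e ∉ K) (hab : (skeleton P).Adj a b)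
    (hS₁ : IsClosedUnder K S₁) (hS₂ : IsClosedUnder K S₂) (hf : f₁ ≠ f₂) (hf₁ : f₁ ∈ S₁)
    (hf₂ : f₂ ∈ S₂) (h₁ : segment ℝ (a : E3) (b : E3) ⊆ f₁.carrier)
    (h₂ : segment ℝ (a : E3) (b : E3) ⊆ f₂.carrier) (g : Face P) : g ∈ S₁ ∨ g ∈ S₂ := by
  classical
  set c : Face P → ZMod 2 := fun g => if g ∈ S₁ ∨ g ∈ S₂ then 1 else 0 with hc
  have hadj : ∀ u w, bd c u w ≠ 0 → T.Adj u w := by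
    intro u w
    contrapose!
    intro huwT
    by_cases huw : (skeleton P).Adj u w
    · obtain ⟨f, g, hfg, hfu, hgu, -, -⟩ := edge_faces hP huw
      rw [bd_eq_add hP c huw hfg hfu hgu]
      have hcc : c f = c g := by
        rcases hK s(u, w) (fun h => huwT ((SimpleGraph.mem_edgeSet T).1 h)) with h | h
        · rw [segment_congr_edge h] at hfu hgu
          have key : ∀ k : Face P, segment ℝ (a : E3) (b : E3) ⊆ k.carrier → c k = 1 := by
            intro k hk
            rcases eq_of_mem_edge hP hab hf h₁ h₂ hk with rfl | rfl
            · exact if_pos (Or.inl hf₁)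
            · exact if_pos (Or.inr hf₂)
          rw [key f hfu, key g hgu]
        · have : (f ∈ S₁ ∨ f ∈ S₂) ↔ (g ∈ S₁ ∨ g ∈ S₂) :=
            ⟨Or.imp (fun hm => hS₁ f hm g u w huw h hfu hgu)
              fun hm => hS₂ f hm g u w huw h hfu hgu,
              Or.imp (fun hm => hS₁ g hm f u w huw h hgu hfu)
              fun hm => hS₂ g hm f u w huw h hgu hfu⟩
          simp only [hc, this]
      rw [hcc, zmod2_add_self]
    · exact bd_eq_zero_of_not_adj c huw
  have hz := eq_zero_of_isAcyclic hTree.isAcyclic (bd_comm c) hadj (sum_bd hP c)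
  have hconst := eq_of_bd_eq_zero hP (hTree.connected.preconnected.mono hT) hz g f₁
  by_contra hcon
  simp [hc, hcon, hf₁] at hconst

/-- Two convex layouts glued together along an edge. -/
theorem hasNet_of_halves (hP : IsConvexPolyhedron P) (hT : T ≤ skeleton P) (hTree : T.IsTree)
    (hTK : T.edgeSet ⊆ K) (hK : ∀ e, e ∉ T.edgeSet → e = s(a, b) ∨ e ∉ K)
    (hab : (skeleton P).Adj a b) (habK : s(a, b) ∈ K) (habT : s(a, b) ∉ T.edgeSet)
    (L₁ : Layout K S₁ φ₁) (L₂ : Layout K S₂ φ₂)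
    (hS₁ : IsClosedUnder K S₁) (hS₂ : IsClosedUnder K S₂) (hf : f₁ ≠ f₂) (hf₁ : f₁ ∈ S₁)
    (hf₂ : f₂ ∈ S₂) (h₁ : segment ℝ (a : E3) (b : E3) ⊆ f₁.carrier)
    (h₂ : segment ℝ (a : E3) (b : E3) ⊆ f₂.carrier) (hφa : φ₂ f₂ a = φ₁ f₁ a)
    (hφb : φ₂ f₂ b = φ₁ f₁ b)
    (hpos : ∀ y ∈ region S₁ φ₁, 0 ≤ cr (φ₁ f₁ b - φ₁ f₁ a) (y - φ₁ f₁ a))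
    (hneg : ∀ y ∈ region S₂ φ₂, cr (φ₁ f₁ b - φ₁ f₁ a) (y - φ₁ f₁ a) ≤ 0)
    (hex₁ : ∃ y ∈ region S₁ φ₁, 0 < cr (φ₁ f₁ b - φ₁ f₁ a) (y - φ₁ f₁ a))
    (hex₂ : ∃ y ∈ region S₂ φ₂, cr (φ₁ f₁ b - φ₁ f₁ a) (y - φ₁ f₁ a) < 0) : HasNet P := by
  classical
  have hdisj := disjoint_halves hP hT hTree.connected.preconnected hTK hab habK habT L₁ L₂ hf hf₁
    hf₂ h₁ h₂
  have hcover := mem_halves hP hT hTree hK hab hS₁ hS₂ hf hf₁ hf₂ h₁ h₂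
  have haf₁ := h₁ (left_mem_segment ℝ _ _)
  have hbf₁ := h₁ (right_mem_segment ℝ _ _)
  have haf₂ := h₂ (left_mem_segment ℝ _ _)
  have hbf₂ := h₂ (right_mem_segment ℝ _ _)
  have hag : ∀ z ∈ segment ℝ (a : E3) (b : E3), φ₂ f₂ z = φ₁ f₁ z := fun z hz =>
    affineMap_eq_on_segment hφa hφb hz
  have hpq : φ₁ f₁ a ≠ φ₁ f₁ b := by
    intro h0
    have h := L₁.isometry f₁ hf₁ a haf₁ b hbf₁
    rw [h0, dist_self] at h
    exact hab.1 (Subtype.ext (dist_eq_zero.1 h.symm))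
  have hsub₁ : segment ℝ (φ₁ f₁ a) (φ₁ f₁ b) ⊆ region S₁ φ₁ :=
    L₁.convex.segment_subset (mem_region.2 ⟨f₁, hf₁, a, haf₁, rfl⟩)
      (mem_region.2 ⟨f₁, hf₁, b, hbf₁, rfl⟩)
  have hsub₂ : segment ℝ (φ₁ f₁ a) (φ₁ f₁ b) ⊆ region S₂ φ₂ :=
    L₂.convex.segment_subset (mem_region.2 ⟨f₂, hf₂, a, haf₂, hφa⟩)
      (mem_region.2 ⟨f₂, hf₂, b, hbf₂, hφb⟩)
  have hint : region S₁ φ₁ ∩ region S₂ φ₂ = segment ℝ (φ₁ f₁ a) (φ₁ f₁ b) := by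
    refine Set.Subset.antisymm ?_ (Set.subset_inter hsub₁ hsub₂)
    rintro y ⟨hy₁, hy₂⟩
    obtain ⟨s, hs⟩ := eq_smul_of_cr_eq_zero (sub_ne_zero.2 hpq.symm)
      (le_antisymm (hneg y hy₂) (hpos y hy₁))
    obtain rfl : y = φ₁ f₁ a + s • (φ₁ f₁ b - φ₁ f₁ a) := by rw [← hs]; abel
    have e : φ₁ f₁ a + s • (φ₁ f₁ b - φ₁ f₁ a) =
      φ₁ f₁ b + (1 - s) • (φ₁ f₁ a - φ₁ f₁ b) := by module
    have hs0 := param_nonneg_of_common hP L₁ L₂ hdisj hf₁ hf₂ haf₁ haf₂ rfl hφa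
      (hsub₁ (right_mem_segment ℝ _ _)) (hsub₂ (right_mem_segment ℝ _ _)) hpq.symm hy₁ hy₂
    rw [e] at hy₁ hy₂
    have hs1 := param_nonneg_of_common hP L₁ L₂ hdisj hf₁ hf₂ hbf₁ hbf₂ rfl hφb
      (hsub₁ (left_mem_segment ℝ _ _)) (hsub₂ (left_mem_segment ℝ _ _)) hpq hy₁ hy₂
    rw [segment_eq_image']
    exact ⟨s, ⟨hs0, by linarith⟩, rfl⟩
  have hopp : ∀ x ∈ f₁.carrier, ∀ y ∈ f₂.carrier,
      (affineSpan ℝ {φ₁ f₁ a, φ₁ f₁ b}).WOppSide (φ₁ f₁ x) (φ₂ f₂ y) := by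
    intro x hx y hy
    refine wOppSide_of_cr hpq one_ne_zero ?_ ?_ <;> rw [one_mul]
    · exact hpos _ (mem_region.2 ⟨f₁, hf₁, x, hx, rfl⟩)
    · exact hneg _ (mem_region.2 ⟨f₂, hf₂, y, hy, rfl⟩)
  set φ : Face P → E3 → E2 := fun g => if g ∈ S₁ then φ₁ g else φ₂ g with hφ
  have e₁ : ∀ g ∈ S₁, φ g = φ₁ g := fun g hg => if_pos hg
  have e₂ : ∀ g ∈ S₂, φ g = φ₂ g := fun g hg => if_neg (Finset.disjoint_right.1 hdisj hg)
  have hcases : ∀ f g : Face P, ∀ u w : Vertex P, (skeleton P).Adj u w → s(u, w) ∉ T.edgeSet →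
      segment ℝ (u : E3) (w : E3) ⊆ f.carrier → segment ℝ (u : E3) (w : E3) ⊆ g.carrier →
      (s(u, w) = s(a, b) ∧ (f = f₁ ∨ f = f₂) ∧ (g = f₁ ∨ g = f₂)) ∨
        (s(u, w) ∉ K ∧ (f ∈ S₁ ∧ g ∈ S₁ ∨ f ∈ S₂ ∧ g ∈ S₂)) := by
    intro f g u w huw huwT hfu hgu
    rcases hK _ huwT with h | h
    · left
      rw [segment_congr_edge h] at hfu hgu
      exact ⟨h, eq_of_mem_edge hP hab hf h₁ h₂ hfu, eq_of_mem_edge hP hab hf h₁ h₂ hgu⟩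
    · right
      exact ⟨h, (hcover f).imp (fun hm => ⟨hm, hS₁ f hm g u w huw h hfu hgu⟩)
        fun hm => ⟨hm, hS₂ f hm g u w huw h hfu hgu⟩⟩
  have hatt : ∀ {S : Finset (Face P)} {ψ : Face P → E3 →ᵃ[ℝ] E2}, Layout K S ψ → ∀ f ∈ S, ∀ g ∈ S,
      ∀ u w : Vertex P, (skeleton P).Adj u w → s(u, w) ∉ K →
      segment ℝ (u : E3) (w : E3) ⊆ f.carrier → segment ℝ (u : E3) (w : E3) ⊆ g.carrier →
      ∀ x ∈ segment ℝ (u : E3) (w : E3), ψ f x = ψ g x := by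
    intro S ψ L f hf g hg u w huw h hfu hgu x hx
    refine affineMap_eq_on_segment (L.attached f hf g hg u w huw h hfu hgu)
      (L.attached f hf g hg w u huw.symm ?_ ?_ ?_) hx
    · rwa [Sym2.eq_swap]
    · rwa [segment_symm]
    · rwa [segment_symm]
  have hjoin : ∀ z ∈ segment ℝ (a : E3) (b : E3), ConnectedAt T.edgeSet z f₁ f₂ := fun z hz =>
    Relation.ReflTransGen.single ⟨a, b, hab, habT, hz, h₁, h₂⟩
  have hcross : ∀ f ∈ S₁, ∀ g ∈ S₂, ∀ x ∈ f.carrier, ∀ y ∈ g.carrier, φ₁ f x = φ₂ g y →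
      x = y ∧ ConnectedAt T.edgeSet x f g := by
    intro f hfS g hgS x hx y hy hxy
    -- A common image point comes from a point `z` of the glued edge. Injectivity in each layout
    -- identifies `z` with `x` and with `y`; the faces are connected there through `f₁` and `f₂`
    -- across `a b`.
    have hm : φ₁ f x ∈ segment ℝ (φ₁ f₁ a) (φ₁ f₁ b) := by
      rw [← hint]
      exact ⟨mem_region.2 ⟨f, hfS, x, hx, rfl⟩, mem_region.2 ⟨g, hgS, y, hy, hxy.symm⟩⟩
    rw [← image_segment] at hm
    obtain ⟨z, hz, hzx⟩ := hm
    obtain ⟨rfl, c1⟩ := L₁.injective f₁ hf₁ f hfS z (h₁ hz) x hx hzx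
    obtain ⟨rfl, c2⟩ := L₂.injective f₂ hf₂ g hgS z (h₂ hz) y hy
      (by rw [hag z hz, hzx, hxy])
    exact ⟨rfl, ((c1.mono hTK).symm.trans (hjoin z hz)).trans (c2.mono hTK)⟩
  refine ⟨T, ⟨hT, hTree⟩, φ, ⟨?_, ?_, ?_⟩, ⟨?_, ?_⟩⟩
  · intro f
    rcases hcover f with h | h
    · rw [e₁ f h]; exact L₁.isometry f h
    · rw [e₂ f h]; exact L₂.isometry f h
  · rintro f g x ⟨u, w, huw, huwT, hx, hfu, hgu⟩
    rcases hcases f g u w huw huwT hfu hgu with ⟨h, hfe, hge⟩ | ⟨h, ⟨hm, hm'⟩ | ⟨hm, hm'⟩⟩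
    · rw [segment_congr_edge h] at hx
      rcases hfe with rfl | rfl <;> rcases hge with rfl | rfl
      · rfl
      · rw [e₁ _ hf₁, e₂ _ hf₂, hag x hx]
      · rw [e₁ _ hf₁, e₂ _ hf₂, hag x hx]
      · rfl
    · rw [e₁ _ hm, e₁ _ hm']; exact hatt L₁ f hm g hm' u w huw h hfu hgu x hx
    · rw [e₂ _ hm, e₂ _ hm']; exact hatt L₂ f hm g hm' u w huw h hfu hgu x hx
  · intro f g hfg u w huw huwT hfu hgu
    rcases hcases f g u w huw (fun h => huwT ((SimpleGraph.mem_edgeSet T).1 h)) hfu hgu with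
      ⟨h, hfe, hge⟩ | ⟨h, ⟨hm, hm'⟩ | ⟨hm, hm'⟩⟩
    · have hpair : ({φ₁ f₁ u, φ₁ f₁ w} : Set E2) = {φ₁ f₁ a, φ₁ f₁ b} ∧
          ({φ₂ f₂ u, φ₂ f₂ w} : Set E2) = {φ₁ f₁ a, φ₁ f₁ b} := by
        rcases Sym2.eq_iff.1 h with ⟨rfl, rfl⟩ | ⟨rfl, rfl⟩
        · rw [hφa, hφb]; exact ⟨rfl, rfl⟩
        · rw [hφa, hφb]; exact ⟨Set.pair_comm _ _, Set.pair_comm _ _⟩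
      rcases hfe with rfl | rfl <;> rcases hge with rfl | rfl
      · exact absurd rfl hfg
      · rw [e₁ _ hf₁, e₂ _ hf₂, hpair.1]; exact hopp
      · rw [e₁ _ hf₁, e₂ _ hf₂, hpair.2]; exact fun x hx y hy => (hopp y hy x hx).symm
      · exact absurd rfl hfg
    · rw [e₁ _ hm, e₁ _ hm']; exact L₁.opposite f hm g hm' hfg u w huw h hfu hgu
    · rw [e₂ _ hm, e₂ _ hm']; exact L₂.opposite f hm g hm' hfg u w huw h hfu hgu
  · intro f g x hx y hy hxy
    rcases hcover f with hm | hm <;> rcases hcover g with hm' | hm'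
    · rw [e₁ _ hm, e₁ _ hm'] at hxy
      exact (L₁.injective f hm g hm' x hx y hy hxy).imp_right (ConnectedAt.mono hTK)
    · rw [e₁ _ hm, e₂ _ hm'] at hxy
      exact hcross f hm g hm' x hx y hy hxy
    · rw [e₂ _ hm, e₁ _ hm'] at hxy
      obtain ⟨rfl, h⟩ := hcross g hm' f hm y hy x hx hxy.symm
      exact ⟨rfl, h.symm⟩
    · rw [e₂ _ hm, e₂ _ hm'] at hxy
      exact (L₂.injective f hm g hm' x hx y hy hxy).imp_right (ConnectedAt.mono hTK)
  · have hunion : (⋃ f : Face P, φ f '' f.carrier) = region S₁ φ₁ ∪ region S₂ φ₂ := by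
      ext y
      simp only [Set.mem_iUnion, Set.mem_union, mem_region, Set.mem_image]
      constructor
      · rintro ⟨f, x, hx, rfl⟩
        rcases hcover f with hm | hm
        · left; exact ⟨f, hm, x, hx, by rw [e₁ _ hm]⟩
        · right; exact ⟨f, hm, x, hx, by rw [e₂ _ hm]⟩
      · rintro (⟨f, hm, x, hx, rfl⟩ | ⟨f, hm, x, hx, rfl⟩)
        · exact ⟨f, x, hx, by rw [e₁ _ hm]⟩
        · exact ⟨f, x, hx, by rw [e₂ _ hm]⟩
    obtain ⟨V₁, hV₁, hr₁⟩ := L₁.exists_eq_convexHull hP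
    obtain ⟨V₂, hV₂, hr₂⟩ := L₂.exists_eq_convexHull hP
    rw [hunion]
    rw [hr₁] at hpos hex₁ hint ⊢
    rw [hr₂] at hneg hex₂ hint ⊢
    exact exists_simplePolygon hV₁ hV₂ hpq hpos hneg hex₁ hex₂ hint

end Halves

/-- The layouts are grown with all of `Q` as barrier (`K`), so that the bound π applies on each
side. The cut tree `T` omits the first edge of `Q`, along which the two halves are glued afterwards.
-/
theorem IsHamiltonianQuasigeodesic.hasNet (hP : IsConvexPolyhedron P) {v : Vertex P}
    {Q : (skeleton P).Walk v v} (hQ : IsHamiltonianQuasigeodesic Q) : HasNet P := by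
  classical
  have := finite_face hP
  have := hP.finite_vertex
  have := Fintype.ofFinite (Face P)
  have := Fintype.ofFinite (Vertex P)
  obtain ⟨hQH, hπ⟩ := hQ
  cases Q with
  | nil => exact absurd hQH.isCycle SimpleGraph.Walk.not_isCycle_nil
  | @cons _ b _ hab q =>
    have hq : q.IsHamiltonian := by
      have := hQH.isHamiltonian_tail
      simpa [SimpleGraph.Walk.IsHamiltonian] using this
    have hvq : s(v, b) ∉ q.edges := ((SimpleGraph.Walk.cons_isCycle_iff q hab).1 hQH.isCycle).2
    obtain ⟨hTree, hTE⟩ := hq.isTree_fromEdgeSet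
    set T := SimpleGraph.fromEdgeSet q.edgeSet with hTd
    set K := (SimpleGraph.Walk.cons hab q).edgeSet with hKd
    have hKi : ∀ e, e ∈ K ↔ e = s(v, b) ∨ e ∈ T.edgeSet := by
      intro e
      rw [hTE, hKd]
      simp
    have hTS : T ≤ skeleton P := by
      rw [← SimpleGraph.edgeSet_subset_edgeSet, hTE]
      exact fun e he => q.edges_subset_edgeSet he
    have hTK : T.edgeSet ⊆ K := fun e he => (hKi e).2 (Or.inr he)
    have hTK' : ∀ e, e ∉ T.edgeSet → e = s(v, b) ∨ e ∉ K := by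
      intro e he
      by_cases h : e = s(v, b)
      · exact Or.inl h
      · exact Or.inr fun hk => ((hKi e).1 hk).elim h he
    have hvT : s(v, b) ∉ T.edgeSet := by rw [hTE]; exact hvq
    have hvK : s(v, b) ∈ K := (hKi _).2 (Or.inl rfl)
    obtain ⟨f₁, f₂, hf, h₁, h₂, -, -⟩ := edge_faces hP hab
    -- The glued edge is placed from the origin to any vector of the right length. The signs `-1`
    -- and `1` passed to `exists_placement` send the two initial faces to opposite sides of it.
    obtain ⟨q₀, hq₀⟩ := exists_norm_eq E2 (dist_nonneg (x := (v : E3)) (y := b))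
    obtain ⟨ψ₁, i₁, e₁, e₁', -, -, x₁, hx₁, hx₁'⟩ := f₁.exists_placement hab h₁ (p := 0) (q := q₀)
      (by rw [dist_zero_left, hq₀]) (neg_ne_zero.2 one_ne_zero)
    obtain ⟨S₁, φ₁, L₁, hf₁, rfl, hS₁⟩ :=
      exists_closed_layout hP hTS hTree.connected.preconnected hTK hπ f₁ ψ₁ i₁
    -- The edge is in `K`, so the whole region lies on one side of its line; the point `x₁` of the
    -- initial face tells on which.
    obtain ⟨σ₁, hσ₁, hs₁⟩ := L₁.side f₁ hf₁ v b hab h₁ (Or.inl hvK)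
    rw [← e₁, ← e₁', neg_one_mul, neg_lt_zero] at hx₁'
    have hm₁ : φ₁ f₁ x₁ ∈ region S₁ φ₁ := mem_region.2 ⟨f₁, hf₁, x₁, hx₁, rfl⟩
    have hσ₁' : 0 < σ₁ :=
      lt_of_le_of_ne (nonneg_of_mul_nonneg_left (hs₁ _ hm₁) hx₁') hσ₁.symm
    obtain ⟨ψ₂, i₂, e₂, e₂', -, -, x₂, hx₂, hx₂'⟩ := f₂.exists_placement hab h₂
      (p := φ₁ f₁ v) (q := φ₁ f₁ b)
      (i₁ v (h₁ (left_mem_segment ℝ _ _)) b (h₁ (right_mem_segment ℝ _ _))) one_ne_zero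
    obtain ⟨S₂, φ₂, L₂, hf₂, rfl, hS₂⟩ :=
      exists_closed_layout hP hTS hTree.connected.preconnected hTK hπ f₂ ψ₂ i₂
    obtain ⟨σ₂, hσ₂, hs₂⟩ := L₂.side f₂ hf₂ v b hab h₂ (Or.inl hvK)
    rw [e₂, e₂'] at hs₂
    rw [one_mul] at hx₂'
    have hm₂ : φ₂ f₂ x₂ ∈ region S₂ φ₂ := mem_region.2 ⟨f₂, hf₂, x₂, hx₂, rfl⟩
    have hσ₂' : σ₂ < 0 := by
      by_contra hcon
      push Not at hcon
      have := mul_neg_of_pos_of_neg (lt_of_le_of_ne hcon hσ₂.symm) hx₂'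
      linarith [hs₂ _ hm₂]
    refine hasNet_of_halves hP hTS hTree hTK hTK' hab hvK hvT L₁ L₂ hS₁ hS₂ hf hf₁ hf₂ h₁ h₂ e₂ e₂'
      (fun y hy => nonneg_of_mul_nonneg_right (hs₁ y hy) hσ₁') (fun y hy => ?_)
      ⟨_, hm₁, hx₁'⟩ ⟨_, hm₂, hx₂'⟩
    by_contra hcon
    push Not at hcon
    have := mul_neg_of_neg_of_pos hσ₂' hcon
    linarith [hs₂ y hy]

end Polyhedron

end

theorem theorem1 (P : Set E3) (hP : Polyhedron.IsConvexPolyhedron P)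
    (v : Polyhedron.Vertex P) (Q : (Polyhedron.skeleton P).Walk v v)
    (hQ : Polyhedron.IsHamiltonianQuasigeodesic Q) :
    Polyhedron.HasNet P :=
  hQ.hasNet hP
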